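/- **Definitions.** For $0\le N\le\omega$ (where $N$ is a natural number or $\omega$) let $\mathcal G_N$ be the category of $N$-globular sets, and let $T_N$ be the free strict $N$-category monad on $\mathcal G_N$. For finite $K\le N$ let $R=R^N_K:\mathcal G_N\to\mathcal G_K$ be truncation (forgetting the cells of dimension $>K$); there is a canonical isomorphism $T_K R\cong R\,T_N$, which makes $R$ a morphism of monads, so that $R$ sends $T_N$-operads to $T_K$-operads. A $T_N$-operad has an underlying map of globular sets $C\to T_N1$; for $\pi\in(T_N1)(m)$ write $C(\pi)$ for the set of $m$-cells of $C$ over $\pi$. A *precontraction* $\kappa$ on a $T_N$-operad $C$ consists of a function $\kappa_\pi:P_\pi(C)\to C(\pi)$ for each finite $m$ with $1\le m\le N$ and each $\pi\in(T_N1)(m)$, where $P_\pi(C)$ is the set of pairs $(\theta_0,\theta_1)\in C(s\pi)\times C(t\pi)$ such that, if $m\ge2$, $s\theta_0=s\theta_1$ and $t\theta_0=t\theta_1$; it is required that $s(\kappa_\pi(\theta_0,\theta_1))=\theta_0$ and $t(\kappa_\pi(\theta_0,\theta_1))=\theta_1$. Write $\mathbf{OWP}_N$ for the category of $T_N$-operads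 with precontraction and operad maps preserving the precontractions. For finite $n\ge 1$ let $\mathbf{OWC}_n$ be the full subcategory of those $(C,\kappa)$ such that, for all $\pi\in(T_n1)(n)$ and $\theta_0,\theta_1\in C(\pi)$, if $s\theta_0=s\theta_1$ and $t\theta_0=t\theta_1$ then $\theta_0=\theta_1$. Let $\mathbf{OWC}=\mathbf{OWP}_\omega$. Truncation induces functors $R^N_K:\mathbf{OWP}_N\to\mathbf{OWP}_K$. **Statement.** 1. For each $n\ge1$ the functor $R^n_{n-1}:\mathcal G_n\to\mathcal G_{n-1}$ has a right adjoint $S^n_{n-1}$. This induces an adjunction $R^n_{n-1}\dashv S^n_{n-1}$ between $\mathbf{OWP}_n$ and $\mathbf{OWP}_{n-1}$. Here *induced* means that for each $D\in\mathbf{OWP}_{n-1}$ the underlying object $S^n_{n-1}(D)\to T_n1$ of $\mathcal G_n/T_n1$ is the pullback of $S^n_{n-1}(D)\to S^n_{n-1}(T_{n-1}1)$ (the functor on globular sets applied to the underlying map of $D$) along the transpose $T_n1\to S^n_{n-1}(T_{n-1}1)$ of the canonical isomorphism $R^n_{n-1}(T_n1)\cong T_{n-1}1$, the first projection of this pullback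 being the transpose of the counit of the adjunction between $\mathbf{OWP}_n$ and $\mathbf{OWP}_{n-1}$. 2. For each $n\ge1$ the adjunction of (1) restricts to an equivalence $\mathbf{OWC}_n\simeq\mathbf{OWP}_{n-1}$: the functor $S^n_{n-1}$ takes values in $\mathbf{OWC}_n$, the unit is an isomorphism at every object of $\mathbf{OWC}_n$, the counit is an isomorphism at every object of $\mathbf{OWP}_{n-1}$, and so both $R^n_{n-1}:\mathbf{OWC}_n\to\mathbf{OWP}_{n-1}$ and $S^n_{n-1}:\mathbf{OWP}_{n-1}\to\mathbf{OWC}_n$ are equivalences of categories. 3. For each $k\ge0$ the functor $R^\omega_k:\mathcal G_\omega\to\mathcal G_k$ has a right adjoint $S^\omega_k$, which in the same sense induces an adjunction $R^\omega_k\dashv S^\omega_k$ between $\mathbf{OWC}$ and $\mathbf{OWP}_k$. 4. The category $\mathbf{OWC}$ has an initial object, and if $L$ is any initial object of $\mathbf{OWC}$ then, for each $n\ge1$, $S^n_{n-1}R^\omega_{n-1}(L)$ is an initial object of $\mathbf{OWC}_n$. In particular $\mathbf{OWC}_n$ has an initial object. -/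

import Mathlib

open CategoryTheory

universe u

attribute [-instance] CategoryTheory.catToReflQuiver

namespace GlobOp

/-- The two kinds of boundary map, source and target. -/
inductive Side : Type
  | src
  | tgt

/-- The objects of (the opposite of) the globe category truncated at level `N`: the dimensions `0 ≤ dim ≤ N`.
The value `N = ⊤` stands for `ω`, and then all natural numbers are allowed. -/
@[ext]
structure Glb (N : ℕ∞) : Type where
  dim : ℕ
  le : (dim : ℕ∞) ≤ N

namespace Glb

variable {N K : ℕ∞}

instance : LT (Glb N) := ⟨fun p m => p.dim < m.dim⟩

instance (p m : Glb N) : Decidable (p < m) := inferInstanceAs (Decidable (p.dim < m.dim))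

theorem lt_trans' {p q m : Glb N} (h : p < q) (h' : q < m) : p < m := Nat.lt_trans h h'

theorem tri (p q : Glb N) : p < q ∨ p = q ∨ q < p := by
  rcases Nat.lt_trichotomy p.dim q.dim with h | h | h
  · exact Or.inl h
  · exact Or.inr (Or.inl (Glb.ext h))
  · exact Or.inr (Or.inr h)

theorem lt_irrefl' {p : Glb N} (h : p < p) : False := Nat.lt_irrefl _ h

theorem lt_asymm' {p q : Glb N} (h : p < q) (h' : q < p) : False := Nat.lt_asymm h h'

/-- The arrows in normal form: the globularity relations `ss = st` and `ts = tt` (in the order in which the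
maps act on cells) say that a composite of boundary maps is determined by its last factor, so an arrow
`m ⟶ p` is an identity or, when `p < m`, one of the two maps: `p`-dimensional source, target. -/
inductive Hom : ℕ → ℕ → Type
  | id (m : ℕ) : Hom m m
  | bd (ε : Side) {m p : ℕ} (h : p < m) : Hom m p

def Hom.comp : {m p q : ℕ} → Hom m p → Hom p q → Hom m q
  | _, _, _, .id _, g => g
  | _, _, _, .bd ε h, .id _ => .bd ε h
  | _, _, _, .bd _ h, .bd ε h' => .bd ε (Nat.lt_trans h' h)

theorem Hom.id_comp' {m p : ℕ} (f : Hom m p) : (Hom.id m).comp f = f := by cases f <;> rfl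

theorem Hom.comp_id' {m p : ℕ} (f : Hom m p) : f.comp (Hom.id p) = f := by cases f <;> rfl

theorem Hom.assoc' {m p q r : ℕ} (f : Hom m p) (g : Hom p q) (h : Hom q r) :
    (f.comp g).comp h = f.comp (g.comp h) := by cases f <;> cases g <;> cases h <;> rfl

instance : SmallCategory (Glb N) where
  Hom m p := Hom m.dim p.dim
  id m := .id m.dim
  comp := Hom.comp
  id_comp := Hom.id_comp'
  comp_id := Hom.comp_id'
  assoc := Hom.assoc'

theorem hom_ind {motive : ∀ {m p : Glb N}, (m ⟶ p) → Prop} (id : ∀ m, motive (𝟙 m))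
    (bd : ∀ (ε : Side) {m p : Glb N} (h : p < m), motive (Hom.bd ε h : m ⟶ p)) {m p : Glb N}
    (f : m ⟶ p) : motive f := by
  obtain ⟨m, hm⟩ := m
  obtain ⟨p, hp⟩ := p
  change Hom m p at f
  cases f with
  | id => exact id _
  | bd ε h => exact bd ε (m := ⟨m, hm⟩) (p := ⟨p, hp⟩) h

def δ (ε : Side) {m p : Glb N} (h : p < m) : m ⟶ p := Hom.bd ε h

theorem δ_comp_δ (ε ε' : Side) {m p q : Glb N} (h : p < m) (h' : q < p) :
    δ ε h ≫ δ ε' h' = δ ε' (lt_trans' h' h) := rfl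

/-- The inclusion of the dimensions `≤ K` in the dimensions `≤ N`. -/
def incl (h : K ≤ N) : Glb K ⥤ Glb N where
  obj m := ⟨m.dim, m.le.trans h⟩
  map f := f
  map_id _ := rfl
  map_comp _ _ := rfl

end Glb

open Glb

/-- `N`-globular sets. -/
abbrev GlobSet (N : ℕ∞) := Glb N ⥤ Type u

/-- The `p`-dimensional source or target of an `m`-cell. -/
def face {N : ℕ∞} (X : GlobSet.{u} N) (ε : Side) {m p : Glb N} (h : p < m) (x : X.obj m) :
    X.obj p := X.map (δ ε h) x

section
variable {N K : ℕ∞}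

theorem face_face (X : GlobSet.{u} N) (ε ε' : Side) {m p q : Glb N} (h : p < m) (h' : q < p)
    (x : X.obj m) : face X ε' h' (face X ε h x) = face X ε' (lt_trans' h' h) x := by
  simp only [face]
  rw [← δ_comp_δ ε ε' h h', Functor.map_comp_apply]

theorem face_app {X Y : GlobSet.{u} N} (f : X ⟶ Y) (ε : Side) {m p : Glb N} (h : p < m)
    (x : X.obj m) : f.app p (face X ε h x) = face Y ε h (f.app m x) := by
  simp only [face]
  exact NatTrans.naturality_apply f _ x

theorem globSet_hom_ext {X Y : GlobSet.{u} N} {f g : X ⟶ Y}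
    (h : ∀ m x, f.app m x = g.app m x) : f = g := by
  ext m x
  exact h m x

def mkGlobSet (obj : Glb N → Type u)
    (bd : ∀ (_ : Side) {m p : Glb N} (_ : p < m), obj m → obj p)
    (bd_bd : ∀ (ε ε' : Side) {m p q : Glb N} (h : p < m) (h' : q < p) (x : obj m),
      bd ε' h' (bd ε h x) = bd ε' (lt_trans' h' h) x) : GlobSet.{u} N where
  obj := obj
  map {m p} f := match m, p, f with
    | ⟨_, _⟩, ⟨_, _⟩, .id _ => 𝟙 _
    | ⟨_, _⟩, ⟨_, _⟩, .bd ε h => TypeCat.ofHom (bd ε h)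
  map_id _ := rfl
  map_comp f g := by
    induction f using hom_ind <;> induction g using hom_ind <;> ext x
    · rfl
    · rfl
    · rfl
    · exact (bd_bd _ _ _ _ _).symm

theorem natural_of_face {X Y : GlobSet.{u} N} (f : ∀ m, X.obj m → Y.obj m)
    (hf : ∀ ε {m p : Glb N} (h : p < m) x, f p (face X ε h x) = face Y ε h (f m x))
    {m p : Glb N} (g : m ⟶ p) : X.map g ≫ TypeCat.ofHom (f p) = TypeCat.ofHom (f m) ≫ Y.map g := by
  induction g using hom_ind with
  | id => simp
  | bd ε h =>
    ext x
    exact hf ε h x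

def mkGlobMap {X Y : GlobSet.{u} N} (f : ∀ m, X.obj m → Y.obj m)
    (hf : ∀ ε {m p : Glb N} (h : p < m) x, f p (face X ε h x) = face Y ε h (f m x)) : X ⟶ Y where
  app m := TypeCat.ofHom (f m)
  naturality _ _ g := natural_of_face f hf g

/-- Truncation of globular sets, forgetting the cells of dimension `> K`. -/
abbrev truncation (h : K ≤ N) : GlobSet.{u} N ⥤ GlobSet.{u} K :=
  (Functor.whiskeringLeft _ _ _).obj (incl h)

end

/-- Strict `N`-categories (`N = ⊤`: strict `ω`-categories): globular sets with identities and binary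
compositions along all lower-dimensional cells, with the usual axioms. `comp h x y` is the composite of
`x` followed by `y` along their common `p`-dimensional boundary; `ident h x` is the iterated identity. -/
structure StrictCat (N : ℕ∞) where
  cells : GlobSet.{u} N
  ident {p m : Glb N} (h : p < m) (x : cells.obj p) : cells.obj m
  comp {p m : Glb N} (h : p < m) (x y : cells.obj m)
    (e : face cells .tgt h x = face cells .src h y) : cells.obj m
  face_ident_eq (ε : Side) {p m : Glb N} (h : p < m) (x : cells.obj p) :
    face cells ε h (ident h x) = x
  face_ident_gt (ε : Side) {p q m : Glb N} (h : p < q) (h' : q < m) (x : cells.obj p) :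
    face cells ε h' (ident (lt_trans' h h') x) = ident h x
  src_comp {p m : Glb N} (h : p < m) (x y : cells.obj m) (e) :
    face cells .src h (comp h x y e) = face cells .src h x
  tgt_comp {p m : Glb N} (h : p < m) (x y : cells.obj m) (e) :
    face cells .tgt h (comp h x y e) = face cells .tgt h y
  face_comp (ε : Side) {p q m : Glb N} (h : p < q) (h' : q < m) (x y : cells.obj m) (e e') :
    face cells ε h' (comp (lt_trans' h h') x y e) =
      comp h (face cells ε h' x) (face cells ε h' y) e'
  assoc {p m : Glb N} (h : p < m) (x y z : cells.obj m) (e₁ e₂ e₃ e₄) :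
    comp h (comp h x y e₁) z e₂ = comp h x (comp h y z e₃) e₄
  ident_comp {p m : Glb N} (h : p < m) (x : cells.obj m) (e) :
    comp h (ident h (face cells .src h x)) x e = x
  comp_ident {p m : Glb N} (h : p < m) (x : cells.obj m) (e) :
    comp h x (ident h (face cells .tgt h x)) e = x
  interchange {q p m : Glb N} (h : q < p) (h' : p < m) (x y x' y' : cells.obj m)
    (e₁ e₂ e₃ e₄ e₅ e₆) :
    comp (lt_trans' h h') (comp h' x y e₁) (comp h' x' y' e₂) e₃ =
      comp h' (comp (lt_trans' h h') x x' e₄) (comp (lt_trans' h h') y y' e₅) e₆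
  ident_ident {p m l : Glb N} (h : p < m) (h' : m < l) (x : cells.obj p) :
    ident h' (ident h x) = ident (lt_trans' h h') x
  ident_of_comp {p m l : Glb N} (h : p < m) (h' : m < l) (x y : cells.obj m) (e e') :
    ident h' (comp h x y e) = comp (lt_trans' h h') (ident h' x) (ident h' y) e'

namespace StrictCat

variable {N K : ℕ∞}

/-- Strict functors. -/
@[ext]
structure Hom (A B : StrictCat.{u} N) where
  map : A.cells ⟶ B.cells
  map_ident {p m : Glb N} (h : p < m) (x : A.cells.obj p) :
    map.app m (A.ident h x) = B.ident h (map.app p x)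
  map_comp {p m : Glb N} (h : p < m) (x y : A.cells.obj m) (e) (e') :
    map.app m (A.comp h x y e) = B.comp h (map.app m x) (map.app m y) e'

theorem Hom.comp_compat {A B : StrictCat.{u} N} (f : A.cells ⟶ B.cells) {p m : Glb N}
    (h : p < m) {x y : A.cells.obj m} (e : face A.cells .tgt h x = face A.cells .src h y) :
    face B.cells .tgt h (f.app m x) = face B.cells .src h (f.app m y) := by
  rw [← face_app, ← face_app, e]

instance : Category (StrictCat.{u} N) where
  Hom := Hom
  id A := ⟨𝟙 _, fun _ _ => rfl, fun _ _ _ _ _ => rfl⟩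
  comp {A B D} f g :=
    { map := f.map ≫ g.map
      map_ident := fun h x => by
        simp [f.map_ident, g.map_ident]
      map_comp := fun h x y e e' => by
        have := f.map_comp h x y e (Hom.comp_compat f.map h e)
        simp only [NatTrans.comp_app, ConcreteCategory.comp_apply]
        rw [this, g.map_comp] }

@[ext]
theorem hom_ext {A B : StrictCat.{u} N} {f g : A ⟶ B} (h : f.map = g.map) : f = g := Hom.ext h

def forget (N : ℕ∞) : StrictCat.{u} N ⥤ GlobSet.{u} N where
  obj A := A.cells
  map f := f.map

/-- Truncation of strict categories. -/
def trunc (h : K ≤ N) : StrictCat.{u} N ⥤ StrictCat.{u} K where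
  obj A :=
    { cells := (truncation h).obj A.cells
      ident := fun h' x => A.ident (p := (incl h).obj _) (m := (incl h).obj _) h' x
      comp := fun h' x y e => A.comp (p := (incl h).obj _) (m := (incl h).obj _) h' x y e
      face_ident_eq := fun ε _ _ h' x => A.face_ident_eq ε _ x
      face_ident_gt := fun ε _ _ _ h' h'' x => A.face_ident_gt ε _ _ x
      src_comp := fun _ x y e => A.src_comp _ x y e
      tgt_comp := fun _ x y e => A.tgt_comp _ x y e
      face_comp := fun ε _ _ _ _ _ x y e e' => A.face_comp ε _ _ x y e e'
      assoc := fun _ x y z e₁ e₂ e₃ e₄ => A.assoc _ x y z e₁ e₂ e₃ e₄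
      ident_comp := fun _ x e => A.ident_comp _ x e
      comp_ident := fun _ x e => A.comp_ident _ x e
      interchange := fun {q p m} h₁ h₂ x y x' y' e₁ e₂ e₃ e₄ e₅ e₆ =>
        A.interchange (q := (incl h).obj q) (p := (incl h).obj p) (m := (incl h).obj m)
          h₁ h₂ x y x' y' e₁ e₂ e₃ e₄ e₅ e₆
      ident_ident := fun _ _ x => A.ident_ident _ _ x
      ident_of_comp := fun _ _ x y e e' => A.ident_of_comp _ _ x y e e' }
  map f :=
    { map := (truncation h).map f.map
      map_ident := fun {p m} h' x =>
        f.map_ident (p := (incl h).obj p) (m := (incl h).obj m) h' x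
      map_comp := fun {p m} h' x y e e' =>
        f.map_comp (p := (incl h).obj p) (m := (incl h).obj m) h' x y e e' }
  map_id _ := rfl
  map_comp _ _ := rfl

end StrictCat

/-- Formal composites and identities of cells of `X`, not yet required to be composable. -/
inductive Raw {N : ℕ∞} (X : GlobSet.{u} N) : Glb N → Type u
  | var {m : Glb N} (x : X.obj m) : Raw X m
  | ident {p m : Glb N} (h : p < m) (a : Raw X p) : Raw X m
  | comp {p m : Glb N} (h : p < m) (a b : Raw X m) : Raw X m

namespace Raw

variable {N : ℕ∞} {X : GlobSet.{u} N}

/-- Formal sources and targets. -/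
def bd (ε : Side) : {m q : Glb N} → (q < m) → Raw X m → Raw X q
  | _, _, h, .var x => .var (face X ε h x)
  | _, q, h, .ident (p := p) _ a =>
      if h₁ : q < p then a.bd ε h₁
      else if h₂ : p < q then .ident h₂ a
      else cast (congrArg (Raw X) (((tri p q).resolve_left h₂).resolve_right h₁)) a
  | _, q, h, .comp (p := p) _ a b =>
      if h₂ : p < q then .comp h₂ (a.bd ε h) (b.bd ε h)
      else if q < p then a.bd ε h
      else match ε with
        | .src => a.bd .src h
        | .tgt => b.bd .tgt h

theorem bd_ident_lt (ε : Side) {p m q : Glb N} (h : p < m) (a : Raw X p) (hq : q < p) (hm) :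
    (ident h a).bd ε hm = a.bd ε hq := by
  simp [bd, hq]

theorem bd_ident_eq (ε : Side) {p m : Glb N} (h : p < m) (a : Raw X p) (hm) :
    (ident h a).bd ε hm = a := by
  have : ¬ p < p := lt_irrefl'
  simp [bd, this]

theorem bd_ident_gt (ε : Side) {p m q : Glb N} (h : p < m) (a : Raw X p) (hq : p < q) (hm) :
    (ident h a).bd ε (q := q) hm = ident hq a := by
  have : ¬ q < p := fun h' => lt_asymm' hq h'
  simp [bd, this, hq]

theorem bd_comp_lt (ε : Side) {p m q : Glb N} (h : p < m) (a b : Raw X m) (hq : q < p) (hm) :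
    (comp h a b).bd ε (q := q) hm = a.bd ε hm := by
  have : ¬ p < q := fun h' => lt_asymm' hq h'
  simp [bd, this, hq]

theorem src_comp {p m : Glb N} (h : p < m) (a b : Raw X m) (hm) :
    (comp h a b).bd .src (q := p) hm = a.bd .src hm := by
  have : ¬ p < p := lt_irrefl'
  simp [bd, this]

theorem tgt_comp {p m : Glb N} (h : p < m) (a b : Raw X m) (hm) :
    (comp h a b).bd .tgt (q := p) hm = b.bd .tgt hm := by
  have : ¬ p < p := lt_irrefl'
  simp [bd, this]

theorem bd_comp_gt (ε : Side) {p m q : Glb N} (h : p < m) (a b : Raw X m) (hq : p < q) (hm) :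
    (comp h a b).bd ε (q := q) hm = comp hq (a.bd ε hm) (b.bd ε hm) := by
  simp [bd, hq]

/-- The partial equivalence relation generated by the axioms of a strict category. A term is related to
itself exactly when all formal compositions in it are composable. -/
inductive Eqv : {m : Glb N} → Raw X m → Raw X m → Prop
  | var {m : Glb N} (x : X.obj m) : Eqv (.var x) (.var x)
  | symm {m : Glb N} {a b : Raw X m} : Eqv a b → Eqv b a
  | trans {m : Glb N} {a b c : Raw X m} : Eqv a b → Eqv b c → Eqv a c
  | ident {p m : Glb N} (h : p < m) {a a' : Raw X p} : Eqv a a' → Eqv (.ident h a) (.ident h a')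
  | comp {p m : Glb N} (h : p < m) {a a' b b' : Raw X m} : Eqv a a' → Eqv b b' →
      Eqv (a.bd .tgt h) (b.bd .src h) → Eqv (.comp h a b) (.comp h a' b')
  | assoc {p m : Glb N} (h : p < m) {a b c : Raw X m} : Eqv a a → Eqv b b → Eqv c c →
      Eqv (a.bd .tgt h) (b.bd .src h) → Eqv (b.bd .tgt h) (c.bd .src h) →
      Eqv (.comp h (.comp h a b) c) (.comp h a (.comp h b c))
  | ident_comp {p m : Glb N} (h : p < m) {a : Raw X m} : Eqv a a →
      Eqv (.comp h (.ident h (a.bd .src h)) a) a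
  | comp_ident {p m : Glb N} (h : p < m) {a : Raw X m} : Eqv a a →
      Eqv (.comp h a (.ident h (a.bd .tgt h))) a
  | interchange {q p m : Glb N} (h : q < p) (h' : p < m) {a b a' b' : Raw X m} :
      Eqv a a → Eqv b b → Eqv a' a' → Eqv b' b' →
      Eqv (a.bd .tgt h') (b.bd .src h') → Eqv (a'.bd .tgt h') (b'.bd .src h') →
      Eqv (a.bd .tgt (lt_trans' h h')) (a'.bd .src (lt_trans' h h')) →
      Eqv (b.bd .tgt (lt_trans' h h')) (b'.bd .src (lt_trans' h h')) →
      Eqv (.comp (lt_trans' h h') (.comp h' a b) (.comp h' a' b'))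
        (.comp h' (.comp (lt_trans' h h') a a') (.comp (lt_trans' h h') b b'))
  | ident_ident {p m l : Glb N} (h : p < m) (h' : m < l) {a : Raw X p} : Eqv a a →
      Eqv (.ident h' (.ident h a)) (.ident (lt_trans' h h') a)
  | ident_of_comp {p m l : Glb N} (h : p < m) (h' : m < l) {a b : Raw X m} :
      Eqv a a → Eqv b b → Eqv (a.bd .tgt h) (b.bd .src h) →
      Eqv (.ident h' (.comp h a b)) (.comp (lt_trans' h h') (.ident h' a) (.ident h' b))

theorem Eqv.left {m : Glb N} {a b : Raw X m} (h : Eqv a b) : Eqv a a := h.trans h.symm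
theorem Eqv.right {m : Glb N} {a b : Raw X m} (h : Eqv a b) : Eqv b b := h.symm.trans h

inductive WF : {m : Glb N} → Raw X m → Prop
  | var {m : Glb N} (x : X.obj m) : WF (.var x)
  | ident {p m : Glb N} (h : p < m) {a : Raw X p} : WF a → WF (.ident h a)
  | comp {p m : Glb N} (h : p < m) {a b : Raw X m} : WF a → WF b →
      Eqv a a → Eqv b b →
      Eqv (a.bd .tgt h) (b.bd .src h) → WF (.comp h a b)

structure Good {m : Glb N} (a : Raw X m) : Prop where
  wf : WF a
  refl : Eqv a a
  bd (ε) {q : Glb N} (hq : q < m) : Eqv (a.bd ε hq) (a.bd ε hq)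
  bd_bd (ε ε') {q r : Glb N} (hq : q < m) (hr : r < q) :
    Eqv ((a.bd ε hq).bd ε' hr) (a.bd ε' (lt_trans' hr hq))

structure Both {m : Glb N} (a b : Raw X m) : Prop where
  left : Good a
  right : Good b
  bd (ε) {q : Glb N} (hq : q < m) : Eqv (a.bd ε hq) (b.bd ε hq)

def Low (X : GlobSet.{u} N) (n : ℕ) : Prop :=
  ∀ (m : Glb N), m.dim < n → ∀ a b : Raw X m, Eqv a b → Both a b

theorem good_var {m : Glb N} (x : X.obj m) : Good (.var x) where
  wf := .var x
  refl := .var x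
  bd ε q hq := .var _
  bd_bd ε ε' q r hq hr := by
    simp only [Raw.bd, face_face]
    exact .var _

theorem good_ident {p m : Glb N} (h : p < m) {a : Raw X p} (ha : Good a) :
    Good (.ident h a) where
  wf := .ident h ha.wf
  refl := .ident h ha.refl
  bd ε q hq := by
    rcases tri q p with h₁ | rfl | h₁
    · rw [bd_ident_lt _ _ _ h₁]; exact ha.bd _ _
    · rw [bd_ident_eq]; exact ha.refl
    · rw [bd_ident_gt _ _ _ h₁]; exact .ident _ ha.refl
  bd_bd ε ε' q r hq hr := by
    rcases tri q p with h₁ | rfl | h₁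
    · rw [bd_ident_lt _ _ _ h₁, bd_ident_lt _ _ _ (lt_trans' hr h₁)]; exact ha.bd_bd _ _ _ _
    · rw [bd_ident_eq, bd_ident_lt _ _ _ hr]; exact ha.bd _ _
    · rw [bd_ident_gt _ _ _ h₁]
      rcases tri r p with h₂ | rfl | h₂
      · rw [bd_ident_lt _ _ _ h₂, bd_ident_lt _ _ _ h₂]; exact ha.bd _ _
      · rw [bd_ident_eq, bd_ident_eq]; exact ha.refl
      · rw [bd_ident_gt _ _ _ h₂, bd_ident_gt _ _ _ h₂]; exact .ident _ ha.refl

theorem low_bd {n : ℕ} (hl : Low X n) {m : Glb N} (hm : m.dim < n) {a b : Raw X m}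
    (h : Eqv a b) (ε : Side) {q : Glb N} (hq : q < m) : Eqv (a.bd ε hq) (b.bd ε hq) :=
  (hl m hm a b h).bd ε hq

/-- composability passes to higher faces -/
theorem compat_up {p q m : Glb N} (h : p < q) (hq : q < m) {a b : Raw X m} (ha : Good a)
    (hb : Good b) (e : Eqv (a.bd .tgt (lt_trans' h hq)) (b.bd .src (lt_trans' h hq))) (ε) :
    Eqv ((a.bd ε hq).bd .tgt h) ((b.bd ε hq).bd .src h) :=
  (ha.bd_bd _ _ _ _).trans (e.trans (hb.bd_bd _ _ _ _).symm)

/-- composability passes to lower faces -/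
theorem compat_down {p q m : Glb N} (hl : Low X m.dim) (h : q < p) (hp : p < m) {a b : Raw X m}
    (ha : Good a)
    (hb : Good b) (e : Eqv (a.bd .tgt hp) (b.bd .src hp)) (ε) :
    Eqv (a.bd ε (lt_trans' h hp)) (b.bd ε (lt_trans' h hp)) :=
  (ha.bd_bd .tgt _ hp h).symm.trans ((low_bd hl hp e _ _).trans (hb.bd_bd _ _ _ _))

theorem good_comp {p m : Glb N} (hl : Low X m.dim) (h : p < m) {a b : Raw X m} (ha : Good a)
    (hb : Good b) (e : Eqv (a.bd .tgt h) (b.bd .src h)) : Good (.comp h a b) where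
  wf := .comp h ha.wf hb.wf ha.refl hb.refl e
  refl := .comp h ha.refl hb.refl e
  bd ε q hq := by
    rcases tri q p with h₁ | rfl | h₁
    · rw [bd_comp_lt _ _ _ _ h₁]; exact ha.bd _ _
    · cases ε
      · rw [src_comp]; exact ha.bd _ _
      · rw [tgt_comp]; exact hb.bd _ _
    · rw [bd_comp_gt _ _ _ _ h₁]
      exact .comp _ (ha.bd _ _) (hb.bd _ _) (compat_up _ _ ha hb e _)
  bd_bd ε ε' q r hq hr := by
    rcases tri q p with h₁ | rfl | h₁
    · rw [bd_comp_lt _ _ _ _ h₁, bd_comp_lt _ _ _ _ (lt_trans' hr h₁)]; exact ha.bd_bd _ _ _ _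
    · rw [bd_comp_lt _ _ _ _ hr]
      cases ε
      · rw [src_comp]; exact ha.bd_bd _ _ _ _
      · rw [tgt_comp]
        exact (hb.bd_bd _ _ _ _).trans (compat_down hl hr hq ha hb e _).symm
    · rw [bd_comp_gt _ _ _ _ h₁]
      rcases tri r p with h₂ | rfl | h₂
      · rw [bd_comp_lt _ _ _ _ h₂, bd_comp_lt _ _ _ _ h₂]; exact ha.bd_bd _ _ _ _
      · cases ε'
        · rw [src_comp, src_comp]; exact ha.bd_bd _ _ _ _
        · rw [tgt_comp, tgt_comp]; exact hb.bd_bd _ _ _ _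
      · rw [bd_comp_gt _ _ _ _ h₂, bd_comp_gt _ _ _ _ h₂]
        refine .comp _ (ha.bd_bd _ _ _ _) (hb.bd_bd _ _ _ _) ?_
        have h2 := low_bd hl (lt_trans' hr hq) (ha.bd_bd ε ε' hq hr) .tgt h₂
        have h3 := low_bd hl (lt_trans' hr hq) (hb.bd_bd ε ε' hq hr) .src h₂
        exact h2.trans ((compat_up h₂ (lt_trans' hr hq) ha hb e ε').trans h3.symm)

theorem both {n : ℕ} : ∀ (m : Glb N), m.dim = n → ∀ a b : Raw X m, Eqv a b → Both a b := by
  induction n using Nat.strong_induction_on with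
  | _ n IH =>
  have hl : Low X n := fun m hm => IH m.dim hm m rfl
  intro m hm a b hab
  induction hab with
  | var x => exact ⟨good_var x, good_var x, (good_var x).bd⟩
  | symm _ ih => exact ⟨(ih hm).right, (ih hm).left, fun ε _ hq => ((ih hm).bd ε hq).symm⟩
  | trans _ _ ih ih' =>
    exact ⟨(ih hm).left, (ih' hm).right, fun ε _ hq => ((ih hm).bd ε hq).trans ((ih' hm).bd ε hq)⟩
  | @ident p m h a a' e _ =>
    have hb := hl p (hm ▸ h) _ _ e
    refine ⟨good_ident h hb.left, good_ident h hb.right, fun ε q hq => ?_⟩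
    rcases tri q p with h₁ | rfl | h₁
    · rw [bd_ident_lt _ _ _ h₁, bd_ident_lt _ _ _ h₁]; exact hb.bd _ _
    · rw [bd_ident_eq, bd_ident_eq]; exact e
    · rw [bd_ident_gt _ _ _ h₁, bd_ident_gt _ _ _ h₁]; exact .ident _ e
  | @comp p m h a a' b b' ea eb e iha ihb _ =>
    subst hm
    have ha := iha rfl
    have hb := ihb rfl
    have e' := (ha.bd .tgt h).symm.trans (e.trans (hb.bd .src h))
    refine ⟨good_comp hl h ha.left hb.left e, good_comp hl h ha.right hb.right e',
      fun ε q hq => ?_⟩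
    rcases tri q p with h₁ | rfl | h₁
    · rw [bd_comp_lt _ _ _ _ h₁, bd_comp_lt _ _ _ _ h₁]; exact ha.bd _ _
    · cases ε
      · rw [src_comp, src_comp]; exact ha.bd _ _
      · rw [tgt_comp, tgt_comp]; exact hb.bd _ _
    · rw [bd_comp_gt _ _ _ _ h₁, bd_comp_gt _ _ _ _ h₁]
      exact .comp _ (ha.bd _ _) (hb.bd _ _) (compat_up _ _ ha.left hb.left e _)
  | @assoc p m h a b c _ _ _ e e' iha ihb ihc _ _ =>
    subst hm
    have ha := (iha rfl).left
    have hb := (ihb rfl).left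
    have hc := (ihc rfl).left
    refine ⟨good_comp hl h (good_comp hl h ha hb e) hc (by rw [tgt_comp]; exact e'),
      good_comp hl h ha (good_comp hl h hb hc e') (by rw [src_comp]; exact e),
      fun ε q hq => ?_⟩
    rcases tri q p with h₁ | rfl | h₁
    · simp only [bd_comp_lt _ _ _ _ h₁]; exact ha.bd _ _
    · cases ε
      · simp only [src_comp]; exact ha.bd _ _
      · simp only [tgt_comp]; exact hc.bd _ _
    · simp only [bd_comp_gt _ _ _ _ h₁]
      exact .assoc _ (ha.bd _ _) (hb.bd _ _) (hc.bd _ _) (compat_up _ _ ha hb e _)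
        (compat_up _ _ hb hc e' _)
  | @ident_comp p m h a _ iha =>
    subst hm
    have ha := (iha rfl).left
    have hs := (hl p h _ _ (ha.bd .src h)).left
    refine ⟨good_comp hl h (good_ident h hs) ha (by rw [bd_ident_eq]; exact ha.bd _ _), ha,
      fun ε q hq => ?_⟩
    rcases tri q p with h₁ | rfl | h₁
    · rw [bd_comp_lt _ _ _ _ h₁, bd_ident_lt _ _ _ h₁]; exact ha.bd_bd _ _ _ _
    · cases ε
      · rw [src_comp, bd_ident_eq]; exact ha.bd _ _
      · rw [tgt_comp]; exact ha.bd _ _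
    · rw [bd_comp_gt _ _ _ _ h₁, bd_ident_gt _ _ _ h₁]
      refine Eqv.trans (.comp h₁ (.ident h₁ (ha.bd_bd ε .src hq h₁).symm) (ha.bd ε hq) ?_)
        (.ident_comp h₁ (ha.bd ε hq))
      rw [bd_ident_eq]
      exact (ha.bd_bd ε .src hq h₁).symm
  | @comp_ident p m h a _ iha =>
    subst hm
    have ha := (iha rfl).left
    have hs := (hl p h _ _ (ha.bd .tgt h)).left
    refine ⟨good_comp hl h ha (good_ident h hs) (by rw [bd_ident_eq]; exact ha.bd _ _), ha,
      fun ε q hq => ?_⟩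
    rcases tri q p with h₁ | rfl | h₁
    · rw [bd_comp_lt _ _ _ _ h₁]; exact ha.bd _ _
    · cases ε
      · rw [src_comp]; exact ha.bd _ _
      · rw [tgt_comp, bd_ident_eq]; exact ha.bd _ _
    · rw [bd_comp_gt _ _ _ _ h₁, bd_ident_gt _ _ _ h₁]
      refine Eqv.trans (.comp h₁ (ha.bd ε hq) (.ident h₁ (ha.bd_bd ε .tgt hq h₁).symm) ?_)
        (.comp_ident h₁ (ha.bd ε hq))
      rw [bd_ident_eq]
      exact ha.bd_bd ε .tgt hq h₁
  | @interchange q p m h h' a b a' b' _ _ _ _ e₁ e₂ e₃ e₄ iha ihb iha' ihb' _ _ _ _ =>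
    subst hm
    have ha := (iha rfl).left
    have hb := (ihb rfl).left
    have ha' := (iha' rfl).left
    have hb' := (ihb' rfl).left
    refine ⟨good_comp hl _ (good_comp hl _ ha hb e₁) (good_comp hl _ ha' hb' e₂)
        (by rw [bd_comp_lt _ _ _ _ h, bd_comp_lt _ _ _ _ h]; exact e₃),
      good_comp hl _ (good_comp hl _ ha ha' e₃) (good_comp hl _ hb hb' e₄)
        (by
          rw [bd_comp_gt _ _ _ _ h, bd_comp_gt _ _ _ _ h]
          exact .comp _ e₁ e₂ (compat_up _ _ ha ha' e₃ _)), fun ε r hr => ?_⟩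
    rcases tri r q with h₁ | rfl | h₁
    · simp only [bd_comp_lt _ _ _ _ h₁, bd_comp_lt _ _ _ _ (lt_trans' h₁ h)]; exact ha.bd _ _
    · cases ε
      · simp only [src_comp, bd_comp_lt _ _ _ _ h]; exact ha.bd _ _
      · simp only [tgt_comp, bd_comp_lt _ _ _ _ h]; exact ha'.bd _ _
    · rcases tri r p with h₂ | rfl | h₂
      · simp only [bd_comp_gt _ _ _ _ h₁, bd_comp_lt _ _ _ _ h₂]
        exact .comp _ (ha.bd _ _) (ha'.bd _ _) (compat_up _ _ ha ha' e₃ _)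
      · cases ε
        · simp only [src_comp, bd_comp_gt _ _ _ _ h₁]
          exact .comp _ (ha.bd _ _) (ha'.bd _ _) (compat_up _ _ ha ha' e₃ _)
        · simp only [tgt_comp, bd_comp_gt _ _ _ _ h₁]
          exact .comp _ (hb.bd _ _) (hb'.bd _ _) (compat_up _ _ hb hb' e₄ _)
      · simp only [bd_comp_gt _ _ _ _ h₁, bd_comp_gt _ _ _ _ h₂]
        exact .interchange h h₂ (ha.bd _ _) (hb.bd _ _) (ha'.bd _ _) (hb'.bd _ _)
          (compat_up _ _ ha hb e₁ _) (compat_up _ _ ha' hb' e₂ _)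
          (compat_up _ _ ha ha' e₃ _) (compat_up _ _ hb hb' e₄ _)
  | @ident_ident p m l h h' a e _ =>
    have ha := (hl p (hm ▸ lt_trans' h h') _ _ e).left
    refine ⟨good_ident _ (good_ident _ ha), good_ident _ ha, fun ε q hq => ?_⟩
    rcases tri q p with h₁ | rfl | h₁
    · rw [bd_ident_lt _ _ _ (lt_trans' h₁ h), bd_ident_lt _ _ _ h₁, bd_ident_lt _ _ _ h₁]
      exact ha.bd _ _
    · rw [bd_ident_lt _ _ _ h, bd_ident_eq, bd_ident_eq]; exact e
    · rw [bd_ident_gt _ (lt_trans' h h') _ h₁]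
      rcases tri q m with h₂ | rfl | h₂
      · rw [bd_ident_lt _ _ _ h₂, bd_ident_gt _ _ _ h₁]; exact .ident _ e
      · rw [bd_ident_eq]; exact .ident _ e
      · rw [bd_ident_gt _ _ _ h₂]; exact .ident_ident _ _ e
  | @ident_of_comp p m l h h' a b ea eb e _ _ _ =>
    have hl' : Low X m.dim := fun k hk => hl k (lt_of_lt_of_eq (Nat.lt_trans hk h') hm)
    have hml : m.dim < n := lt_of_lt_of_eq h' hm
    have ha := (hl m hml _ _ ea).left
    have hb := (hl m hml _ _ eb).left
    have hl'' : Low X l.dim := hm ▸ hl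
    refine ⟨good_ident _ (good_comp hl' _ ha hb e),
      good_comp hl'' _ (good_ident _ ha) (good_ident _ hb)
        (by rw [bd_ident_lt _ _ _ h, bd_ident_lt _ _ _ h]; exact e), fun ε q hq => ?_⟩
    rcases tri q m with h₂ | rfl | h₂
    · rw [bd_ident_lt _ _ _ h₂]
      rcases tri q p with h₁ | rfl | h₁
      · rw [bd_comp_lt _ _ _ _ h₁, bd_comp_lt _ _ _ _ h₁, bd_ident_lt _ _ _ h₂]; exact ha.bd _ _
      · cases ε
        · rw [src_comp, src_comp, bd_ident_lt _ _ _ h₂]; exact ha.bd _ _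
        · rw [tgt_comp, tgt_comp, bd_ident_lt _ _ _ h₂]; exact hb.bd _ _
      · rw [bd_comp_gt _ _ _ _ h₁, bd_comp_gt _ _ _ _ h₁, bd_ident_lt _ _ _ h₂,
          bd_ident_lt _ _ _ h₂]
        exact .comp _ (ha.bd _ _) (hb.bd _ _) (compat_up _ _ ha hb e _)
    · rw [bd_ident_eq, bd_comp_gt _ _ _ _ h, bd_ident_eq, bd_ident_eq]
      exact .comp _ ea eb e
    · rw [bd_ident_gt _ _ _ h₂, bd_comp_gt _ _ _ _ (lt_trans' h h₂), bd_ident_gt _ _ _ h₂,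
        bd_ident_gt _ _ _ h₂]
      exact .ident_of_comp _ _ ea eb e

theorem Eqv.good {m : Glb N} {a : Raw X m} (h : Eqv a a) : Good a := (both m rfl a a h).left

theorem Eqv.bd {m q : Glb N} {a b : Raw X m} (h : Eqv a b) (ε : Side) (hq : q < m) :
    Eqv (a.bd ε hq) (b.bd ε hq) := (both m rfl a b h).bd ε hq

end Raw

namespace Free

open Raw

variable {N K : ℕ∞}

def setoid (X : GlobSet.{u} N) (m : Glb N) : Setoid {a : Raw X m // Eqv a a} where
  r a b := Eqv a.1 b.1
  iseqv := ⟨fun a => a.2, fun h => h.symm, fun h h' => h.trans h'⟩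

/-- Cells of the free strict `N`-category: meaningful terms modulo the axioms. -/
def Cell (X : GlobSet.{u} N) (m : Glb N) : Type u := Quotient (setoid X m)

variable {X : GlobSet.{u} N}

def mk {m : Glb N} (a : Raw X m) (h : Eqv a a) : Cell X m := Quotient.mk (setoid X m) ⟨a, h⟩

theorem mk_eq {m : Glb N} {a b : Raw X m} {ha hb} : mk a ha = mk b hb ↔ Eqv a b :=
  ⟨fun h => Quotient.exact h, fun h => Quotient.sound (s := setoid X m) h⟩

theorem ind {m : Glb N} {P : Cell X m → Prop} (h : ∀ a ha, P (mk a ha)) (x : Cell X m) : P x :=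
  Quotient.inductionOn x fun a => h a.1 a.2

noncomputable def rep {m : Glb N} (x : Cell X m) : Raw X m := (Quotient.out x).1

theorem rep_refl {m : Glb N} (x : Cell X m) : Eqv (rep x) (rep x) := (Quotient.out x).2

theorem mk_rep {m : Glb N} (x : Cell X m) : mk (rep x) (rep_refl x) = x := Quotient.out_eq x

theorem rep_mk {m : Glb N} (a : Raw X m) (ha) : Eqv (rep (mk a ha)) a :=
  mk_eq.1 (mk_rep (mk a ha))

noncomputable def cells (X : GlobSet.{u} N) : GlobSet.{u} N :=
  mkGlobSet (Cell X) (fun ε _ _ h x => mk ((rep x).bd ε h) ((rep_refl x).bd ε h))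
    (fun ε ε' _ _ _ h h' x => mk_eq.2
      (((rep_mk _ _).bd ε' h').trans ((rep_refl x).good.bd_bd ε ε' h h')))

theorem face_mk (ε : Side) {m p : Glb N} (h : p < m) (a : Raw X m) (ha) :
    face (cells X) ε h (mk a ha) = mk (a.bd ε h) (ha.bd ε h) :=
  mk_eq.2 ((rep_mk a ha).bd ε h)

noncomputable def ident {p m : Glb N} (h : p < m) (x : (cells X).obj p) : (cells X).obj m :=
  mk (.ident h (rep x)) (.ident h (rep_refl x))

theorem ident_mk {p m : Glb N} (h : p < m) (a : Raw X p) (ha) :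
    ident h (mk a ha) = mk (.ident h a) (.ident h ha) :=
  mk_eq.2 (.ident h (rep_mk a ha))

noncomputable def comp {p m : Glb N} (h : p < m) (x y : (cells X).obj m)
    (e : face (cells X) .tgt h x = face (cells X) .src h y) : (cells X).obj m :=
  mk (.comp h (rep x) (rep y)) (.comp h (rep_refl x) (rep_refl y) (mk_eq.1 e))

theorem compat_mk {p m : Glb N} {h : p < m} {a b : Raw X m} {ha hb}
    (e : face (cells X) .tgt h (mk a ha) = face (cells X) .src h (mk b hb)) :
    Eqv (a.bd .tgt h) (b.bd .src h) := by
  rw [face_mk, face_mk] at e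
  exact mk_eq.1 e

theorem comp_mk {p m : Glb N} (h : p < m) (a b : Raw X m) (ha hb) (e) :
    comp h (mk a ha) (mk b hb) e = mk (.comp h a b) (.comp h ha hb (compat_mk e)) :=
  mk_eq.2 (.comp h (rep_mk a ha) (rep_mk b hb) (mk_eq.1 e))

/-- The free strict `N`-category on a globular set; see `freeAdj` for its universal property. -/
noncomputable def strictCat (X : GlobSet.{u} N) : StrictCat.{u} N where
  cells := cells X
  ident := ident
  comp := comp
  face_ident_eq ε p m h x := by
    induction x using ind with
    | h a ha =>
    simp only [ident_mk, face_mk, bd_ident_eq]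
    rfl
  face_ident_gt ε p q m h h' x := by
    induction x using ind with
    | h a ha =>
    simp only [ident_mk, face_mk]
    refine mk_eq.2 ?_
    rw [bd_ident_gt _ _ _ h]
    exact .ident _ ha
  src_comp h x y e := by
    induction x using ind with
    | h a ha =>
    induction y using ind with
    | h b hb =>
    simp only [comp_mk, face_mk, Raw.src_comp]
    rfl
  tgt_comp h x y e := by
    induction x using ind with
    | h a ha =>
    induction y using ind with
    | h b hb =>
    simp only [comp_mk, face_mk, Raw.tgt_comp]
    rfl
  face_comp ε p q m h h' x y e e' := by
    induction x using ind with
    | h a ha =>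
    induction y using ind with
    | h b hb =>
    simp only [face_mk] at e'
    simp only [comp_mk, face_mk]
    refine mk_eq.2 ?_
    rw [bd_comp_gt _ _ _ _ h]
    exact .comp _ (ha.bd _ _) (hb.bd _ _) (mk_eq.1 e')
  assoc h x y z e₁ e₂ e₃ e₄ := by
    induction x using ind with
    | h a ha =>
    induction y using ind with
    | h b hb =>
    induction z using ind with
    | h c hc =>
    simp only [comp_mk]
    exact mk_eq.2 (.assoc h ha hb hc (compat_mk e₁) (compat_mk e₃))
  ident_comp h x e := by
    induction x using ind with
    | h a ha =>
    simp only [face_mk, ident_mk, comp_mk]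
    exact mk_eq.2 (.ident_comp h ha)
  comp_ident h x e := by
    induction x using ind with
    | h a ha =>
    simp only [face_mk, ident_mk, comp_mk]
    exact mk_eq.2 (.comp_ident h ha)
  interchange h h' x y x' y' e₁ e₂ e₃ e₄ e₅ e₆ := by
    induction x using ind with
    | h a ha =>
    induction y using ind with
    | h b hb =>
    induction x' using ind with
    | h a' ha' =>
    induction y' using ind with
    | h b' hb' =>
    simp only [comp_mk]
    exact mk_eq.2 (.interchange h h' ha hb ha' hb' (compat_mk e₁) (compat_mk e₂) (compat_mk e₄)
      (compat_mk e₅))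
  ident_ident h h' x := by
    induction x using ind with
    | h a ha =>
    simp only [ident_mk]
    exact mk_eq.2 (.ident_ident h h' ha)
  ident_of_comp h h' x y e e' := by
    induction x using ind with
    | h a ha =>
    induction y using ind with
    | h b hb =>
    simp only [ident_mk, comp_mk]
    exact mk_eq.2 (.ident_of_comp h h' ha hb (compat_mk e))

noncomputable def η (X : GlobSet.{u} N) : X ⟶ (strictCat X).cells :=
  mkGlobMap (fun _ x => mk (.var x) (.var x)) fun ε _ _ h x => by
    change _ = face (cells X) ε h _
    rw [face_mk]
    rfl

section Lift

variable (hKN : K ≤ N) {A : StrictCat.{u} K} (g : (truncation hKN).obj X ⟶ A.cells)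

/-- The relation "the raw cell `a` has value `v` in `A`". -/
def Ev : {m : Glb N} → (hm : (m.dim : ℕ∞) ≤ K) → Raw X m → A.cells.obj ⟨m.dim, hm⟩ → Prop
  | m, hm, .var x, v => v = g.app ⟨m.dim, hm⟩ x
  | m, hm, .ident (p := p) h a, v =>
      ∃ w, Ev (m := p) ((Nat.cast_le.2 (le_of_lt h)).trans hm) a w ∧
        v = A.ident (m := ⟨m.dim, hm⟩) h w
  | m, hm, .comp (p := p) h a b, v =>
      ∃ x y e, Ev hm a x ∧ Ev hm b y ∧
        v = A.comp (p := ⟨p.dim, (Nat.cast_le.2 (le_of_lt h)).trans hm⟩) (m := ⟨m.dim, hm⟩) h x y e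

variable {g}

theorem Ev.unique {m : Glb N} {hm} {a : Raw X m} {v w} (hv : Ev hKN g hm a v)
    (hw : Ev hKN g hm a w) : v = w := by
  induction a with
  | var x => exact hv.trans hw.symm
  | ident h a ih =>
    obtain ⟨v', hv', rfl⟩ := hv
    obtain ⟨w', hw', rfl⟩ := hw
    rw [ih hv' hw']
  | comp h a b iha ihb =>
    obtain ⟨x, y, e, hx, hy, rfl⟩ := hv
    obtain ⟨x', y', e', hx', hy', rfl⟩ := hw
    obtain rfl := iha hx hx'
    obtain rfl := ihb hy hy'
    rfl

theorem Ev.bd {m q : Glb N} {hm : (m.dim : ℕ∞) ≤ K} {a : Raw X m} {v} (hv : Ev hKN g hm a v)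
    (ε : Side) (hq : q < m) (hq' : (q.dim : ℕ∞) ≤ K) :
    Ev hKN g hq' (a.bd ε hq) (face A.cells ε (m := ⟨m.dim, hm⟩) (p := ⟨q.dim, hq'⟩) hq v) := by
  induction a generalizing q with
  | @var m x =>
    obtain rfl := hv
    exact (face_app g ε (m := ⟨m.dim, hm⟩) (p := ⟨q.dim, hq'⟩) hq x).symm
  | @ident p m h a ih =>
    obtain ⟨w, hw, rfl⟩ := hv
    have hp : (p.dim : ℕ∞) ≤ K := (Nat.cast_le.2 (le_of_lt h)).trans hm
    rcases tri q p with h₁ | rfl | h₁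
    · rw [bd_ident_lt _ _ _ h₁]
      have := ih hw h₁ hq'
      rw [← face_face A.cells ε ε (m := ⟨m.dim, hm⟩) (p := ⟨p.dim, hp⟩) (q := ⟨q.dim, hq'⟩) h h₁,
        A.face_ident_eq]
      exact this
    · rw [bd_ident_eq, A.face_ident_eq]
      exact hw
    · rw [bd_ident_gt _ _ _ h₁]
      exact ⟨w, hw, A.face_ident_gt ε (p := ⟨p.dim, hp⟩) (m := ⟨m.dim, hm⟩)
        (q := ⟨q.dim, hq'⟩) h₁ hq w⟩
  | @comp p m h a b iha ihb =>
    obtain ⟨x, y, e, hx, hy, rfl⟩ := hv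
    have hp : (p.dim : ℕ∞) ≤ K := (Nat.cast_le.2 (le_of_lt h)).trans hm
    rcases tri q p with h₁ | rfl | h₁
    · rw [bd_comp_lt _ _ _ _ h₁]
      have := iha hx hq hq'
      rw [← face_face A.cells .src ε (m := ⟨m.dim, hm⟩) (p := ⟨p.dim, hp⟩) (q := ⟨q.dim, hq'⟩) h h₁]
      rw [A.src_comp, face_face]
      exact this
    · cases ε
      · rw [Raw.src_comp, A.src_comp]; exact iha hx _ _
      · rw [Raw.tgt_comp, A.tgt_comp]; exact ihb hy _ _
    · rw [bd_comp_gt _ _ _ _ h₁]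
      have e' : face A.cells .tgt (m := ⟨q.dim, hq'⟩) (p := ⟨p.dim, hp⟩) h₁
          (face A.cells ε (m := ⟨m.dim, hm⟩) (p := ⟨q.dim, hq'⟩) hq x) =
          face A.cells .src (m := ⟨q.dim, hq'⟩) (p := ⟨p.dim, hp⟩) h₁
          (face A.cells ε (m := ⟨m.dim, hm⟩) (p := ⟨q.dim, hq'⟩) hq y) := by
        rw [face_face, face_face]; exact e
      exact ⟨_, _, e', iha hx hq hq', ihb hy hq hq',
        A.face_comp ε (p := ⟨p.dim, hp⟩) (m := ⟨m.dim, hm⟩) (q := ⟨q.dim, hq'⟩) h₁ hq x y e e'⟩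

theorem Ev.compat {p m : Glb N} {hm : (m.dim : ℕ∞) ≤ K} {hp : (p.dim : ℕ∞) ≤ K} {a b : Raw X m}
    (h : p < m) {x y}
    (hx : Ev hKN g hm a x) (hy : Ev hKN g hm b y)
    (e : ∃ v, Ev hKN g hp (a.bd .tgt h) v ∧ Ev hKN g hp (b.bd .src h) v) :
    face A.cells .tgt (m := ⟨m.dim, hm⟩) (p := ⟨p.dim, hp⟩) h x = face A.cells .src h y := by
  obtain ⟨v, hv, hv'⟩ := e
  exact ((hx.bd hKN .tgt h hp).unique hKN hv).trans ((hy.bd hKN .src h hp).unique hKN hv').symm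

theorem dim_le {p m : Glb N} (h : p < m) (hm : (m.dim : ℕ∞) ≤ K) : (p.dim : ℕ∞) ≤ K :=
  (Nat.cast_le.2 (le_of_lt h)).trans hm

variable (g)

theorem sound {m : Glb N} (hm : (m.dim : ℕ∞) ≤ K) {a b : Raw X m} (hab : Eqv a b) :
    ∃ v, Ev hKN g hm a v ∧ Ev hKN g hm b v := by
  induction hab with
  | var x => exact ⟨_, rfl, rfl⟩
  | symm _ ih => obtain ⟨v, h, h'⟩ := ih hm; exact ⟨v, h', h⟩
  | trans _ _ ih ih' =>
    obtain ⟨v, h, h'⟩ := ih hm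
    obtain ⟨w, k, k'⟩ := ih' hm
    obtain rfl := h'.unique hKN k
    exact ⟨_, h, k'⟩
  | ident h _ ih =>
    obtain ⟨v, h, h'⟩ := ih (dim_le h hm)
    exact ⟨_, ⟨v, h, rfl⟩, ⟨v, h', rfl⟩⟩
  | comp h _ _ _ iha ihb ih =>
    obtain ⟨x, hx, hx'⟩ := iha hm
    obtain ⟨y, hy, hy'⟩ := ihb hm
    have e := Ev.compat hKN h hx hy (ih (dim_le h hm))
    exact ⟨_, ⟨x, y, e, hx, hy, rfl⟩, ⟨x, y, e, hx', hy', rfl⟩⟩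
  | assoc h _ _ _ _ _ iha ihb ihc ih ih' =>
    obtain ⟨x, hx, -⟩ := iha hm
    obtain ⟨y, hy, -⟩ := ihb hm
    obtain ⟨z, hz, -⟩ := ihc hm
    have e := Ev.compat hKN h hx hy (ih (dim_le h hm))
    have e' := Ev.compat hKN h hy hz (ih' (dim_le h hm))
    refine ⟨_, ⟨_, z, ?_, ⟨x, y, e, hx, hy, rfl⟩, hz, rfl⟩,
      ⟨x, _, ?_, hx, ⟨y, z, e', hy, hz, rfl⟩, A.assoc ..⟩⟩
    · rw [A.tgt_comp]; exact e'
    · rw [A.src_comp]; exact e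
  | @ident_comp p m h a _ ih =>
    obtain ⟨x, hx, -⟩ := ih hm
    refine ⟨x, ⟨_, x, ?_, ⟨_, hx.bd hKN .src h (dim_le h hm), rfl⟩, hx,
      (A.ident_comp (p := ⟨p.dim, dim_le h hm⟩) (m := ⟨m.dim, hm⟩) h x ?_).symm⟩, hx⟩
    all_goals rw [A.face_ident_eq]
  | @comp_ident p m h a _ ih =>
    obtain ⟨x, hx, -⟩ := ih hm
    refine ⟨x, ⟨x, _, ?_, hx, ⟨_, hx.bd hKN .tgt h (dim_le h hm), rfl⟩,
      (A.comp_ident (p := ⟨p.dim, dim_le h hm⟩) (m := ⟨m.dim, hm⟩) h x ?_).symm⟩, hx⟩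
    all_goals rw [A.face_ident_eq]
  | @interchange q p m h h' a b a' b' _ _ _ _ _ _ _ _ iha ihb iha' ihb' ih₁ ih₂ ih₃ ih₄ =>
    obtain ⟨x, hx, -⟩ := iha hm
    obtain ⟨y, hy, -⟩ := ihb hm
    obtain ⟨x', hx', -⟩ := iha' hm
    obtain ⟨y', hy', -⟩ := ihb' hm
    have hp := dim_le h' hm
    have hq := dim_le h hp
    have e₁ := Ev.compat hKN h' hx hy (ih₁ hp)
    have e₂ := Ev.compat hKN h' hx' hy' (ih₂ hp)
    have e₃ := Ev.compat hKN (lt_trans' h h') hx hx' (ih₃ hq)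
    have e₄ := Ev.compat hKN (lt_trans' h h') hy hy' (ih₄ hq)
    have hqm : (⟨q.dim, hq⟩ : Glb K) < ⟨m.dim, hm⟩ := Nat.lt_trans h h'
    have e₅ : face A.cells .tgt (m := ⟨m.dim, hm⟩) (p := ⟨q.dim, hq⟩) hqm
        (A.comp (p := ⟨p.dim, hp⟩) h' x y e₁) = face A.cells .src hqm
        (A.comp (p := ⟨p.dim, hp⟩) h' x' y' e₂) := by
      rw [← face_face A.cells .src .tgt (m := ⟨m.dim, hm⟩) (p := ⟨p.dim, hp⟩) (q := ⟨q.dim, hq⟩)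
        h' h, ← face_face A.cells .src .src (m := ⟨m.dim, hm⟩) (p := ⟨p.dim, hp⟩)
        (q := ⟨q.dim, hq⟩) h' h, A.src_comp, A.src_comp, face_face, face_face]
      exact e₃
    have hf : ∀ ε u v e, face A.cells ε (m := ⟨m.dim, hm⟩) (p := ⟨p.dim, hp⟩) h'
        (A.comp (p := ⟨q.dim, hq⟩) hqm u v e) =
        A.comp (p := ⟨q.dim, hq⟩) (m := ⟨p.dim, hp⟩) h (face A.cells ε h' u)
          (face A.cells ε h' v) (by rw [face_face, face_face]; exact e) :=
      fun ε u v e => A.face_comp ε (p := ⟨q.dim, hq⟩) (q := ⟨p.dim, hp⟩) (m := ⟨m.dim, hm⟩)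
        h h' u v e _
    have e₆ : face A.cells .tgt (m := ⟨m.dim, hm⟩) (p := ⟨p.dim, hp⟩) h'
        (A.comp (p := ⟨q.dim, hq⟩) hqm x x' e₃) = face A.cells .src h'
        (A.comp (p := ⟨q.dim, hq⟩) hqm y y' e₄) := by
      rw [hf, hf]
      congr 1
    exact ⟨_, ⟨_, _, e₅, ⟨x, y, e₁, hx, hy, rfl⟩, ⟨x', y', e₂, hx', hy', rfl⟩, rfl⟩,
      ⟨_, _, e₆, ⟨x, x', e₃, hx, hx', rfl⟩, ⟨y, y', e₄, hy, hy', rfl⟩,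
        A.interchange (q := ⟨q.dim, hq⟩) (p := ⟨p.dim, hp⟩) (m := ⟨m.dim, hm⟩) h h' ..⟩⟩
  | @ident_ident p m l h h' a _ ih =>
    have hm' := dim_le h' hm
    obtain ⟨x, hx, -⟩ := ih (dim_le h hm')
    exact ⟨_, ⟨_, ⟨x, hx, rfl⟩, rfl⟩, ⟨x, hx,
      A.ident_ident (p := ⟨p.dim, dim_le h hm'⟩) (m := ⟨m.dim, hm'⟩) (l := ⟨l.dim, hm⟩) h h' x⟩⟩
  | @ident_of_comp p m l h h' a b _ _ _ iha ihb ih =>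
    have hm' := dim_le h' hm
    have hp := dim_le h hm'
    obtain ⟨x, hx, -⟩ := iha hm'
    obtain ⟨y, hy, -⟩ := ihb hm'
    have e := Ev.compat hKN h hx hy (ih hp)
    have hpl : (⟨p.dim, hp⟩ : Glb K) < ⟨l.dim, hm⟩ := Nat.lt_trans h h'
    have hf : ∀ ε u, face A.cells ε (m := ⟨l.dim, hm⟩) (p := ⟨p.dim, hp⟩) hpl
        (A.ident (p := ⟨m.dim, hm'⟩) h' u) = face A.cells ε h u := fun ε u => by
      rw [← face_face A.cells ε ε (m := ⟨l.dim, hm⟩) (p := ⟨m.dim, hm'⟩) (q := ⟨p.dim, hp⟩) h' h,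
        A.face_ident_eq]
    exact ⟨_, ⟨_, ⟨x, y, e, hx, hy, rfl⟩, rfl⟩, ⟨_, _, by rw [hf, hf]; exact e, ⟨x, hx, rfl⟩,
      ⟨y, hy, rfl⟩, A.ident_of_comp (p := ⟨p.dim, hp⟩) (m := ⟨m.dim, hm'⟩) (l := ⟨l.dim, hm⟩)
        h h' ..⟩⟩

noncomputable def val {m : Glb N} (hm : (m.dim : ℕ∞) ≤ K) (x : (cells X).obj m) :
    A.cells.obj ⟨m.dim, hm⟩ := (sound hKN g hm (rep_refl x)).choose

theorem ev_val {m : Glb N} (hm : (m.dim : ℕ∞) ≤ K) (x : (cells X).obj m) :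
    Ev hKN g hm (rep x) (val hKN g hm x) := (sound hKN g hm (rep_refl x)).choose_spec.1

theorem val_mk {m : Glb N} (hm : (m.dim : ℕ∞) ≤ K) {a : Raw X m} {ha} {v}
    (h : Ev hKN g hm a v) : val hKN g hm (mk a ha) = v := by
  obtain ⟨w, hw, hw'⟩ := sound hKN g hm (rep_mk a ha)
  exact ((ev_val hKN g hm _).unique hKN hw).trans (hw'.unique hKN h)

/-- A map from the truncation of `X` to a strict `K`-category extends to the truncation of the
free strict `N`-category on `X`. -/
noncomputable def lift : (StrictCat.trunc hKN).obj (strictCat X) ⟶ A where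
  map := mkGlobMap (fun m x => val hKN g (m := (incl hKN).obj m) m.le x) fun ε m p h x =>
    val_mk hKN g _ ((ev_val hKN g (m := (incl hKN).obj m) m.le x).bd hKN ε h p.le)
  map_ident {p m} h x :=
    val_mk hKN g (m := (incl hKN).obj m) m.le
      ⟨_, ev_val hKN g (m := (incl hKN).obj p) p.le x, rfl⟩
  map_comp {p m} h x y e e' :=
    val_mk hKN g (m := (incl hKN).obj m) m.le
      ⟨_, _, e', ev_val hKN g (m := (incl hKN).obj m) m.le x,
        ev_val hKN g (m := (incl hKN).obj m) m.le y, rfl⟩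

theorem η_lift : (truncation hKN).map (η X) ≫ (lift hKN g).map = g := by
  apply globSet_hom_ext
  intro m x
  exact val_mk hKN g (m := (incl hKN).obj m) m.le (a := .var x) rfl

variable {g}

theorem hom_ext {f f' : (StrictCat.trunc hKN).obj (strictCat X) ⟶ A}
    (h : (truncation hKN).map (η X) ≫ f.map = (truncation hKN).map (η X) ≫ f'.map) : f = f' := by
  apply StrictCat.hom_ext
  have key : ∀ (m : Glb N) (a : Raw X m), WF a → ∀ (ha : Eqv a a) (hm : (m.dim : ℕ∞) ≤ K),
      f.map.app ⟨m.dim, hm⟩ (mk a ha) = f'.map.app ⟨m.dim, hm⟩ (mk a ha) := by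
    intro m a hw
    induction hw with
    | @var m x =>
      intro ha hm
      exact congrArg (fun k : (truncation hKN).obj X ⟶ A.cells => k.app ⟨m.dim, hm⟩ x) h
    | @ident p m h a hw ih =>
      intro ha hm
      have hp := dim_le h hm
      have haa : Eqv a a := by have := ha.bd .src h; rwa [bd_ident_eq] at this
      have e := ih haa hp
      have h1 := f.map_ident (p := ⟨p.dim, hp⟩) (m := ⟨m.dim, hm⟩) h (mk a haa)
      have h2 := f'.map_ident (p := ⟨p.dim, hp⟩) (m := ⟨m.dim, hm⟩) h (mk a haa)
      have h3 : mk _ ha = ident h (mk a haa) := (ident_mk h a haa).symm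
      exact (congrArg (fun z => f.map.app ⟨m.dim, hm⟩ z) h3).trans (h1.trans
        ((congrArg _ e).trans (h2.symm.trans
          (congrArg (fun z => f'.map.app ⟨m.dim, hm⟩ z) h3.symm))))
    | @comp p m h a b _ _ haa hbb e iha ihb =>
      intro ha hm
      have hp := dim_le h hm
      have ea := iha haa hm
      have eb := ihb hbb hm
      have e' : face (cells X) .tgt h (mk a haa) = face (cells X) .src h (mk b hbb) := by
        rw [face_mk, face_mk]; exact mk_eq.2 e
      have h3 : mk _ ha = comp h (mk a haa) (mk b hbb) e' := (comp_mk h a b haa hbb e').symm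
      have h1 := f.map_comp (p := ⟨p.dim, hp⟩) (m := ⟨m.dim, hm⟩) h (mk a haa) (mk b hbb) e'
        (StrictCat.Hom.comp_compat f.map (p := ⟨p.dim, hp⟩) (m := ⟨m.dim, hm⟩) h e')
      have h2 := f'.map_comp (p := ⟨p.dim, hp⟩) (m := ⟨m.dim, hm⟩) h (mk a haa) (mk b hbb) e'
        (StrictCat.Hom.comp_compat f'.map (p := ⟨p.dim, hp⟩) (m := ⟨m.dim, hm⟩) h e')
      refine (congrArg (fun z => f.map.app ⟨m.dim, hm⟩ z) h3).trans (h1.trans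
        (Eq.trans ?_ (h2.symm.trans (congrArg (fun z => f'.map.app ⟨m.dim, hm⟩ z) h3.symm))))
      congr 1
  apply globSet_hom_ext
  intro m x
  induction x using ind (m := (incl hKN).obj m) with
  | h a ha => exact key _ a ha.good.wf ha m.le

end Lift

end Free

section Monad

variable {N K : ℕ∞}

noncomputable def freeEquiv (h : K ≤ N) (X : GlobSet.{u} N) (A : StrictCat.{u} K) :
    ((StrictCat.trunc h).obj (Free.strictCat X) ⟶ A) ≃ ((truncation h).obj X ⟶ A.cells) where
  toFun f := (truncation h).map (Free.η X) ≫ f.map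
  invFun g := Free.lift h g
  left_inv f := Free.hom_ext h (Free.η_lift h _)
  right_inv g := Free.η_lift h g

noncomputable def free (N : ℕ∞) : GlobSet.{u} N ⥤ StrictCat.{u} N :=
  Adjunction.leftAdjointOfEquiv (G := StrictCat.forget N) (F_obj := Free.strictCat)
    (freeEquiv (le_refl N)) (fun _ _ _ _ _ => rfl)

/-- The adjunction between `N`-globular sets and strict `N`-categories. -/
noncomputable def freeAdj (N : ℕ∞) : free.{u} N ⊣ StrictCat.forget N :=
  Adjunction.adjunctionOfEquivLeft _ _

noncomputable def unit (X : GlobSet.{u} N) : X ⟶ ((free N).obj X).cells := Free.η X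

/-- The free strict `N`-category monad on `N`-globular sets. -/
noncomputable def T (N : ℕ∞) : Monad (GlobSet.{u} N) := (freeAdj N).toMonad

theorem T_η (X : GlobSet.{u} N) : (T N).η.app X = unit X := by
  simp [T, freeAdj]
  rfl

theorem free_map {X Y : GlobSet.{u} N} (f : X ⟶ Y) :
    unit X ≫ ((free N).map f).map = f ≫ unit Y :=
  (T_η X ▸ T_η Y ▸ ((T N).η.naturality f).symm :)

theorem T_η_μ (A : StrictCat.{u} N) :
    unit A.cells ≫ ((freeAdj N).counit.app A).map = 𝟙 _ := by
  have := (freeAdj N).right_triangle_components A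
  have h2 := T_η A.cells
  change (freeAdj N).unit.app _ = _ at h2
  rw [← h2]
  exact this

noncomputable def compareHom (h : K ≤ N) (X : GlobSet.{u} N) :
    (free K).obj ((truncation h).obj X) ⟶ (StrictCat.trunc h).obj ((free N).obj X) :=
  Free.lift (le_refl K) ((truncation h).map (unit X))

noncomputable def compareInv (h : K ≤ N) (X : GlobSet.{u} N) :
    (StrictCat.trunc h).obj ((free N).obj X) ⟶ (free K).obj ((truncation h).obj X) :=
  Free.lift h (unit ((truncation h).obj X))

theorem η_compareHom (h : K ≤ N) (X : GlobSet.{u} N) :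
    unit ((truncation h).obj X) ≫ (compareHom h X).map = (truncation h).map (unit X) :=
  Free.η_lift (le_refl K) (X := (truncation h).obj X) (A := (StrictCat.trunc h).obj ((free N).obj X))
    ((truncation h).map (unit X))

theorem η_compareInv (h : K ≤ N) (X : GlobSet.{u} N) :
    (truncation h).map (unit X) ≫ (compareInv h X).map = unit ((truncation h).obj X) :=
  Free.η_lift h (unit ((truncation h).obj X))

theorem free_hom_ext {X : GlobSet.{u} N} {A : StrictCat.{u} N} {f g : (free N).obj X ⟶ A}
    (h : unit X ≫ f.map = unit X ≫ g.map) : f = g :=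
  Free.hom_ext (le_refl N) h

noncomputable def compare (h : K ≤ N) (X : GlobSet.{u} N) :
    (free K).obj ((truncation h).obj X) ≅ (StrictCat.trunc h).obj ((free N).obj X) where
  hom := compareHom h X
  inv := compareInv h X
  hom_inv_id := free_hom_ext (by
    change (unit _ ≫ (compareHom h X).map) ≫ (compareInv h X).map = _
    rw [η_compareHom]
    exact η_compareInv h X)
  inv_hom_id := Free.hom_ext h (by
    change ((truncation h).map (unit X) ≫ (compareInv h X).map) ≫ (compareHom h X).map = _
    rw [η_compareInv]
    exact η_compareHom h X)

/-- The canonical isomorphism `T_K R ≅ R T_N`, where `R` is truncation: the map of strict `K`-categories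
that extends the truncated unit. It is an isomorphism of monads along `R` by `η_θ` and `θ_μ`. -/
noncomputable def θ (h : K ≤ N) (X : GlobSet.{u} N) :
    (T K).obj ((truncation h).obj X) ≅ (truncation h).obj ((T N).obj X) :=
  (StrictCat.forget K).mapIso (compare h X)

theorem η_θ (h : K ≤ N) (X : GlobSet.{u} N) :
    (T K).η.app ((truncation h).obj X) ≫ (θ h X).hom = (truncation h).map ((T N).η.app X) := by
  rw [T_η, T_η]
  exact η_compareHom h X

theorem θ_naturality (h : K ≤ N) {X Y : GlobSet.{u} N} (f : X ⟶ Y) :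
    (T K).map ((truncation h).map f) ≫ (θ h Y).hom =
      (θ h X).hom ≫ (truncation h).map ((T N).map f) := by
  have : (free K).map ((truncation h).map f) ≫ compareHom h Y =
      compareHom h X ≫ (StrictCat.trunc h).map ((free N).map f) := by
    apply free_hom_ext
    change (unit _ ≫ ((free K).map ((truncation h).map f)).map) ≫ (compareHom h Y).map =
      (unit _ ≫ (compareHom h X).map) ≫ (truncation h).map ((free N).map f).map
    rw [free_map, Category.assoc, η_compareHom, η_compareHom]
    exact (congrArg (truncation h).map (free_map f)).symm
  exact congrArg StrictCat.Hom.map this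

theorem θ_μ (h : K ≤ N) (X : GlobSet.{u} N) :
    (T K).μ.app ((truncation h).obj X) ≫ (θ h X).hom =
      (T K).map (θ h X).hom ≫ (θ h ((T N).obj X)).hom ≫ (truncation h).map ((T N).μ.app X) := by
  have : (freeAdj K).counit.app ((free K).obj ((truncation h).obj X)) ≫ compareHom h X =
      (free K).map (compareHom h X).map ≫ compareHom h ((T N).obj X) ≫
        (StrictCat.trunc h).map ((freeAdj N).counit.app ((free N).obj X)) := by
    apply free_hom_ext
    change (unit _ ≫ ((freeAdj K).counit.app ((free K).obj ((truncation h).obj X))).map) ≫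
        (compareHom h X).map = (unit _ ≫ ((free K).map (compareHom h X).map).map) ≫
        (compareHom h ((T N).obj X)).map ≫
        (truncation h).map ((freeAdj N).counit.app ((free N).obj X)).map
    have e1 := T_η_μ ((free K).obj ((truncation h).obj X))
    have e2 := T_η_μ ((free N).obj X)
    have e3 := η_compareHom h ((free N).obj X).cells
    have e4 : (unit _ ≫ (compareHom h ((T N).obj X)).map) ≫
        (truncation h).map ((freeAdj N).counit.app ((free N).obj X)).map = 𝟙 _ :=
      (congrArg (· ≫ (truncation h).map ((freeAdj N).counit.app ((free N).obj X)).map) e3).trans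
        ((congrArg (truncation h).map e2).trans ((truncation h).map_id _))
    rw [free_map]
    exact (congrArg (· ≫ (compareHom h X).map) e1).trans ((Category.id_comp _).trans
      ((Category.comp_id _).symm.trans (congrArg ((compareHom h X).map ≫ ·) e4.symm)))
  exact congrArg StrictCat.Hom.map this

end Monad

section Pullback

variable {N : ℕ∞}

/-- The terminal globular set. -/
abbrev one (N : ℕ∞) : GlobSet.{u} N := (Functor.const (Glb N)).obj PUnit.{u + 1}

def toOne (X : GlobSet.{u} N) : X ⟶ one N := mkGlobMap (fun _ _ => PUnit.unit) (fun _ _ _ _ _ => rfl)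

theorem toOne_unique {X : GlobSet.{u} N} (f g : X ⟶ one N) : f = g :=
  globSet_hom_ext fun _ _ => rfl

/-- Pullbacks of globular sets. -/
def pb {X Y Z : GlobSet.{u} N} (f : X ⟶ Z) (g : Y ⟶ Z) : GlobSet.{u} N where
  obj m := {z : X.obj m × Y.obj m // f.app m z.1 = g.app m z.2}
  map k := TypeCat.ofHom fun z => ⟨(X.map k z.1.1, Y.map k z.1.2), by
    rw [NatTrans.naturality_apply f, NatTrans.naturality_apply g, z.2]⟩
  map_id m := by
    ext z <;> simp
  map_comp k l := by
    ext z <;> simp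

variable {X Y Z W : GlobSet.{u} N} {f : X ⟶ Z} {g : Y ⟶ Z}

def pbFst (f : X ⟶ Z) (g : Y ⟶ Z) : pb f g ⟶ X := mkGlobMap (fun _ z => z.1.1) fun _ _ _ _ _ => rfl

def pbSnd (f : X ⟶ Z) (g : Y ⟶ Z) : pb f g ⟶ Y := mkGlobMap (fun _ z => z.1.2) fun _ _ _ _ _ => rfl

theorem pb_condition (f : X ⟶ Z) (g : Y ⟶ Z) : pbFst f g ≫ f = pbSnd f g ≫ g :=
  globSet_hom_ext fun _ z => z.2

def pbLift (a : W ⟶ X) (b : W ⟶ Y) (e : a ≫ f = b ≫ g) : W ⟶ pb f g :=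
  mkGlobMap (fun m w => ⟨(a.app m w, b.app m w), congrArg (fun k : W ⟶ Z => k.app m w) e⟩)
    fun ε _ _ h w => Subtype.ext (Prod.ext (face_app a ε h w) (face_app b ε h w))

@[simp]
theorem pbLift_fst (a : W ⟶ X) (b : W ⟶ Y) (e : a ≫ f = b ≫ g) :
    pbLift a b e ≫ pbFst f g = a := rfl

@[simp]
theorem pbLift_snd (a : W ⟶ X) (b : W ⟶ Y) (e : a ≫ f = b ≫ g) :
    pbLift a b e ≫ pbSnd f g = b := rfl

@[simp]
theorem pbLift_fst_assoc {V : GlobSet.{u} N} (a : W ⟶ X) (b : W ⟶ Y) (e : a ≫ f = b ≫ g)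
    (c : X ⟶ V) : pbLift a b e ≫ pbFst f g ≫ c = a ≫ c := rfl

@[simp]
theorem pbLift_snd_assoc {V : GlobSet.{u} N} (a : W ⟶ X) (b : W ⟶ Y) (e : a ≫ f = b ≫ g)
    (c : Y ⟶ V) : pbLift a b e ≫ pbSnd f g ≫ c = b ≫ c := rfl

theorem pb_hom_ext {a b : W ⟶ pb f g} (h₁ : a ≫ pbFst f g = b ≫ pbFst f g)
    (h₂ : a ≫ pbSnd f g = b ≫ pbSnd f g) : a = b :=
  globSet_hom_ext fun m w => Subtype.ext (Prod.ext
    (congrArg (fun k : W ⟶ X => k.app m w) h₁) (congrArg (fun k : W ⟶ Y => k.app m w) h₂))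

end Pullback

/-- A collection `C → T1` with an identity and a composition `C ∘ C → C` over `T1`, where
`C ∘ C = TC ×_{T1} C`. -/
structure OperadData {N : ℕ∞} (T : Monad (GlobSet.{u} N)) where
  C : GlobSet.{u} N
  arity : C ⟶ T.obj (one N)
  ids : one N ⟶ C
  comp : pb (T.map (toOne C)) arity ⟶ C
  ids_arity : ids ≫ arity = T.η.app (one N)
  comp_arity : comp ≫ arity = pbFst _ _ ≫ T.map arity ≫ T.μ.app (one N)

namespace OperadData

variable {N : ℕ∞} {T : Monad (GlobSet.{u} N)} (O : OperadData T)

/-- `C ∘ C`. -/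
abbrev CC : GlobSet.{u} N := pb (T.map (toOne O.C)) O.arity

/-- The ternary composite, in the form `T(C ∘ C) ×_{T1} C`. -/
abbrev CCC : GlobSet.{u} N := pb (T.map (toOne O.CC)) O.arity

def unitLeft : O.C ⟶ O.CC :=
  pbLift (T.η.app O.C) (toOne O.C ≫ O.ids) (by
    rw [Category.assoc, O.ids_arity]
    exact (T.η.naturality (toOne O.C)).symm)

def unitRight : O.C ⟶ O.CC :=
  pbLift (O.arity ≫ T.map O.ids) (𝟙 O.C) (by
    rw [Category.assoc, ← T.map_comp, toOne_unique (O.ids ≫ toOne O.C) (𝟙 _), T.map_id,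
      Category.comp_id, Category.id_comp])

def assocLeft : O.CCC ⟶ O.CC :=
  pbLift (pbFst _ _ ≫ T.map O.comp) (pbSnd _ _) (by
    rw [Category.assoc, ← T.map_comp, toOne_unique (O.comp ≫ toOne O.C) (toOne _)]
    exact pb_condition _ _)

def assocInner : O.CCC ⟶ O.CC :=
  pbLift (pbFst _ _ ≫ T.map (pbSnd _ _)) (pbSnd _ _) (by
    rw [Category.assoc, ← T.map_comp, toOne_unique (pbSnd _ _ ≫ toOne O.C) (toOne _)]
    exact pb_condition _ _)

def assocRight : O.CCC ⟶ O.CC :=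
  pbLift (pbFst _ _ ≫ T.map (pbFst _ _) ≫ T.μ.app O.C) (O.assocInner ≫ O.comp) (by
    have h1 : T.μ.app O.C ≫ T.map (toOne O.C) = T.map (T.map (toOne O.C)) ≫ T.μ.app (one N) :=
      (T.μ.naturality (toOne O.C)).symm
    rw [Category.assoc, Category.assoc, Category.assoc, h1, O.comp_arity, ← T.map_comp_assoc,
      pb_condition, T.map_comp_assoc]
    rfl)

end OperadData

/-- `T`-operads: collections with an associative and unital composition. -/
structure Operad {N : ℕ∞} (T : Monad (GlobSet.{u} N)) extends OperadData T where
  unit_left : toOperadData.unitLeft ≫ comp = 𝟙 C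
  unit_right : toOperadData.unitRight ≫ comp = 𝟙 C
  assoc : toOperadData.assocLeft ≫ comp = toOperadData.assocRight ≫ comp

namespace Operad

variable {N K : ℕ∞}

def map₂ {T : Monad (GlobSet.{u} N)} {O P : Operad T} (f : O.C ⟶ P.C)
    (hf : f ≫ P.arity = O.arity) : O.CC ⟶ P.CC :=
  pbLift (pbFst _ _ ≫ T.map f) (pbSnd _ _ ≫ f) (by
    rw [Category.assoc, Category.assoc, hf, ← T.map_comp, toOne_unique (f ≫ toOne P.C) (toOne _)]
    exact pb_condition _ _)

@[ext]
structure Hom {T : Monad (GlobSet.{u} N)} (O P : Operad T) where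
  map : O.C ⟶ P.C
  map_arity : map ≫ P.arity = O.arity
  map_ids : O.ids ≫ map = P.ids
  map_comp : O.comp ≫ map = map₂ map map_arity ≫ P.comp

instance (T : Monad (GlobSet.{u} N)) : Category (Operad T) where
  Hom := Hom
  id O :=
    { map := 𝟙 _
      map_arity := Category.id_comp _
      map_ids := Category.comp_id _
      map_comp := by
        have : map₂ (𝟙 O.C) (Category.id_comp _) = 𝟙 O.CC :=
          pb_hom_ext (by simp [map₂]) (by simp [map₂])
        rw [this, Category.id_comp, Category.comp_id] }
  comp {O P Q} f g :=
    { map := f.map ≫ g.map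
      map_arity := by rw [Category.assoc, g.map_arity, f.map_arity]
      map_ids := by rw [← Category.assoc, f.map_ids, g.map_ids]
      map_comp := by
        rw [← Category.assoc, f.map_comp, Category.assoc, g.map_comp, ← Category.assoc]
        congr 1
        exact pb_hom_ext (by simp [map₂]) (by simp [map₂]) }

@[ext]
theorem hom_ext {T : Monad (GlobSet.{u} N)} {O P : Operad T} {f g : O ⟶ P}
    (h : f.map = g.map) : f = g := Hom.ext h

noncomputable section Truncation

variable (h : K ≤ N)

/-- The arity map of the truncated operad, transported along `θ`. -/
def truncArity (O : OperadData (T.{u} N)) : (truncation h).obj O.C ⟶ (T K).obj (one K) :=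
  (truncation h).map O.arity ≫ (θ h (one N)).inv

theorem T_map_comp {X Y Z : GlobSet.{u} N} (f : X ⟶ Y) (g : Y ⟶ Z) (m : Glb N)
    (x : ((T N).obj X).obj m) :
    ((T N).map (f ≫ g)).app m x = ((T N).map g).app m (((T N).map f).app m x) :=
  congrArg (fun k : (T N).obj X ⟶ (T N).obj Z => k.app m x) ((T N).map_comp f g)

theorem θ_nat {X Y : GlobSet.{u} N} (f : X ⟶ Y) (m : Glb K)
    (x : ((T K).obj ((truncation h).obj X)).obj m) :
    (θ h Y).hom.app m (((T K).map ((truncation h).map f)).app m x) =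
      ((T N).map f).app ((incl h).obj m) ((θ h X).hom.app m x) :=
  congrArg (fun k : (T K).obj ((truncation h).obj X) ⟶ (truncation h).obj ((T N).obj Y) =>
    k.app m x) (θ_naturality h f)

theorem truncArity_θ (O : OperadData (T.{u} N)) :
    truncArity h O ≫ (θ h (one N)).hom = (truncation h).map O.arity := by
  rw [truncArity, Category.assoc, Iso.inv_hom_id]
  exact Category.comp_id _

/-- The canonical map `RC ∘ RC → R(C ∘ C)`. -/
def truncPair (O : OperadData (T.{u} N)) :
    pb ((T K).map (toOne ((truncation h).obj O.C))) (truncArity h O) ⟶ (truncation h).obj O.CC :=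
  pbLift (f := (truncation h).map ((T N).map (toOne O.C))) (g := (truncation h).map O.arity)
    (pbFst _ _ ≫ (θ h O.C).hom) (pbSnd _ _) (by
      rw [Category.assoc, ← θ_naturality h (toOne O.C), ← truncArity_θ, ← Category.assoc,
        ← Category.assoc]
      exact congrArg (· ≫ (θ h (one N)).hom) (pb_condition _ _))

theorem θ_μ_inv (X : GlobSet.{u} N) :
    (θ h ((T N).obj X)).hom ≫ (truncation h).map ((T N).μ.app X) ≫ (θ h X).inv =
      (T K).map (θ h X).inv ≫ (T K).μ.app ((truncation h).obj X) := by
  have h1 : (T K).map (θ h X).inv ≫ (T K).map (θ h X).hom = 𝟙 _ := by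
    rw [← Functor.map_comp, Iso.inv_hom_id, CategoryTheory.Functor.map_id]
  rw [← Category.assoc, Iso.comp_inv_eq, Category.assoc, θ_μ, ← Category.assoc, h1,
    Category.id_comp]

def truncData (O : OperadData (T.{u} N)) : OperadData (T.{u} K) where
  C := (truncation h).obj O.C
  arity := truncArity h O
  ids := (truncation h).map O.ids
  comp := truncPair h O ≫ (truncation h).map O.comp
  ids_arity := by
    rw [truncArity, ← Category.assoc, ← Functor.map_comp, O.ids_arity, Iso.comp_inv_eq]
    exact (η_θ h (one N)).symm
  comp_arity := by
    have h1 : (truncation h).map O.comp ≫ (truncation h).map O.arity =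
        (truncation h).map (pbFst _ _) ≫ (truncation h).map ((T N).map O.arity) ≫
          (truncation h).map ((T N).μ.app (one N)) := by
      rw [← Functor.map_comp, O.comp_arity, Functor.map_comp, Functor.map_comp]
    have h2 : (T K).map (truncArity h O) ≫ (T K).μ.app (one K) =
        (T K).map ((truncation h).map O.arity) ≫ (T K).map (θ h (one N)).inv ≫
          (T K).μ.app ((truncation h).obj (one N)) := by
      rw [truncArity, Functor.map_comp, Category.assoc]
      rfl
    rw [h2, ← θ_μ_inv, ← Category.assoc ((T K).map _), θ_naturality]
    exact congrArg (fun k => truncPair h O ≫ k ≫ (θ h (one N)).inv) h1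

def truncTriple (O : OperadData (T.{u} N)) : (truncData h O).CCC ⟶ (truncation h).obj O.CCC :=
  pbLift (f := (truncation h).map ((T N).map (toOne O.CC))) (g := (truncation h).map O.arity)
    (pbFst _ _ ≫ (T K).map (truncPair h O) ≫ (θ h O.CC).hom) (pbSnd _ _) (by
      refine globSet_hom_ext fun m w => ?_
      exact (θ_nat h (toOne O.CC) m _).symm.trans ((congrArg ((θ h (one N)).hom.app m)
        ((T_map_comp (truncPair h O) ((truncation h).map (toOne O.CC)) m w.1.1).symm.trans
          w.2)).trans (congrArg (fun k => k.app m w.1.2) (truncArity_θ h O))))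

theorem trunc_assocLeft (O : OperadData (T.{u} N)) :
    (truncData h O).assocLeft ≫ truncPair h O =
      truncTriple h O ≫ (truncation h).map O.assocLeft := by
  refine globSet_hom_ext fun m w => Subtype.ext (Prod.ext ?_ rfl)
  exact (congrArg ((θ h O.C).hom.app m) (T_map_comp (truncPair h O)
    ((truncation h).map O.comp) m w.1.1)).trans (θ_nat h O.comp m _)

theorem trunc_assocInner (O : OperadData (T.{u} N)) :
    (truncData h O).assocInner ≫ truncPair h O =
      truncTriple h O ≫ (truncation h).map O.assocInner := by
  refine globSet_hom_ext fun m w => Subtype.ext (Prod.ext ?_ rfl)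
  exact (congrArg ((θ h O.C).hom.app m) (T_map_comp (truncPair h O)
    ((truncation h).map (pbSnd ((T N).map (toOne O.C)) O.arity)) m w.1.1)).trans (θ_nat h (pbSnd ((T N).map (toOne O.C)) O.arity) m _)

theorem trunc_assocRight (O : OperadData (T.{u} N)) :
    (truncData h O).assocRight ≫ truncPair h O =
      truncTriple h O ≫ (truncation h).map O.assocRight := by
  refine globSet_hom_ext fun m w => Subtype.ext (Prod.ext ?_ ?_)
  · have h1 := congrArg (fun k => k.app m (((T K).map (pbFst ((T K).map
      (toOne ((truncation h).obj O.C))) (truncArity h O))).app m w.1.1)) (θ_μ h O.C)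
    have h2 := (T_map_comp (pbFst ((T K).map (toOne ((truncation h).obj O.C))) (truncArity h O))
      (θ h O.C).hom m w.1.1).symm.trans (T_map_comp (truncPair h O)
      ((truncation h).map (pbFst ((T N).map (toOne O.C)) O.arity)) m w.1.1)
    have h3 := θ_nat h (pbFst ((T N).map (toOne O.C)) O.arity) m
      (((T K).map (truncPair h O)).app m w.1.1)
    exact h1.trans (congrArg (fun x => ((T N).μ.app O.C).app ((incl h).obj m) x)
      ((congrArg ((θ h ((T N).obj O.C)).hom.app m) h2).trans h3))
  · exact congrArg (fun k => O.comp.app ((incl h).obj m) (k.app m w)) (trunc_assocInner h O)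

theorem trunc_unitLeft (O : OperadData (T.{u} N)) :
    (truncData h O).unitLeft ≫ truncPair h O = (truncation h).map O.unitLeft := by
  refine globSet_hom_ext fun m w => Subtype.ext (Prod.ext ?_ rfl)
  exact congrArg (fun k => k.app m w) (η_θ h O.C)

theorem trunc_unitRight (O : OperadData (T.{u} N)) :
    (truncData h O).unitRight ≫ truncPair h O = (truncation h).map O.unitRight := by
  refine globSet_hom_ext fun m w => Subtype.ext (Prod.ext ?_ rfl)
  exact (θ_nat h O.ids m _).trans (congrArg (fun k => ((T N).map O.ids).app ((incl h).obj m)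
    (k.app m w)) (truncArity_θ h O))

def truncObj (O : Operad (T.{u} N)) : Operad (T.{u} K) where
  toOperadData := truncData h O.toOperadData
  unit_left :=
    (congrArg (· ≫ (truncation h).map O.comp) (trunc_unitLeft h O.toOperadData)).trans
      (congrArg (truncation h).map O.unit_left)
  unit_right :=
    (congrArg (· ≫ (truncation h).map O.comp) (trunc_unitRight h O.toOperadData)).trans
      (congrArg (truncation h).map O.unit_right)
  assoc :=
    (congrArg (· ≫ (truncation h).map O.comp) (trunc_assocLeft h O.toOperadData)).trans
      ((congrArg (truncTriple h O.toOperadData ≫ (truncation h).map ·) O.assoc).trans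
        (congrArg (· ≫ (truncation h).map O.comp) (trunc_assocRight h O.toOperadData)).symm)

theorem trunc_map_arity {O P : Operad (T.{u} N)} (f : O ⟶ P) :
    (truncation h).map f.map ≫ truncArity h P.toOperadData = truncArity h O.toOperadData := by
  rw [truncArity, truncArity, ← Category.assoc, ← Functor.map_comp, f.map_arity]

theorem truncPair_map₂ {O P : Operad (T.{u} N)} (f : O ⟶ P) :
    map₂ (O := truncObj h O) (P := truncObj h P) ((truncation h).map f.map)
        (trunc_map_arity h f) ≫ truncPair h P.toOperadData =
      truncPair h O.toOperadData ≫ (truncation h).map (map₂ f.map f.map_arity) := by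
  refine globSet_hom_ext fun m w => Subtype.ext (Prod.ext ?_ rfl)
  exact θ_nat h f.map m _

/-- Truncation of operads, induced by truncation of globular sets and the isomorphisms `θ`. -/
def trunc : Operad (T.{u} N) ⥤ Operad (T.{u} K) where
  obj := truncObj h
  map {O P} f :=
    { map := (truncation h).map f.map
      map_arity := trunc_map_arity h f
      map_ids := congrArg (truncation h).map f.map_ids
      map_comp := (congrArg (truncPair h O.toOperadData ≫ (truncation h).map ·) f.map_comp).trans
        (congrArg (· ≫ (truncation h).map P.comp) (truncPair_map₂ h f)).symm }
  map_id _ := rfl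
  map_comp _ _ := rfl

end Truncation

end Operad

noncomputable section

namespace Operad

variable {N K : ℕ∞}

/-- The set `C(π)` of operations of arity `π`. -/
def Fib (O : Operad (T.{u} N)) {m : Glb N} (π : ((T N).obj (one N)).obj m) : Type u :=
  {x : O.C.obj m // O.arity.app m x = π}

/-- The set `P_π(C)` of parallel pairs of operations of arities the source and the target of `π`.
If `π` has dimension `1` the condition `parallel` is empty. -/
structure P (O : Operad (T.{u} N)) {p m : Glb N} (h : p < m) (π : ((T N).obj (one N)).obj m) :
    Type u where
  src : O.Fib (face _ Side.src h π)
  tgt : O.Fib (face _ Side.tgt h π)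
  parallel : ∀ (ε : Side) {q : Glb N} (hq : q < p), q.dim + 1 = p.dim →
    face O.C ε hq src.1 = face O.C ε hq tgt.1

end Operad

/-- `T_N`-operads with precontraction: an operad `C` with maps `κ_π : P_π(C) → C(π)`, for all `π ∈ T1` of
dimension `m ≥ 1`, such that `κ_π (θ₀, θ₁)` has source `θ₀` and target `θ₁`. -/
structure OWP (N : ℕ∞) where
  operad : Operad (T.{u} N)
  κ : ∀ {p m : Glb N} (h : p < m) (_ : p.dim + 1 = m.dim) (π : ((T N).obj (one N)).obj m),
    operad.P h π → operad.Fib π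
  src_κ : ∀ {p m : Glb N} (h : p < m) (e : p.dim + 1 = m.dim) (π : ((T N).obj (one N)).obj m)
    (x : operad.P h π), face operad.C Side.src h (κ h e π x).1 = x.src.1
  tgt_κ : ∀ {p m : Glb N} (h : p < m) (e : p.dim + 1 = m.dim) (π : ((T N).obj (one N)).obj m)
    (x : operad.P h π), face operad.C Side.tgt h (κ h e π x).1 = x.tgt.1

namespace Operad

variable {N K : ℕ∞}

def mapFib {O O' : Operad (T.{u} N)} (f : O ⟶ O') {m : Glb N} {π : ((T N).obj (one N)).obj m}
    (x : O.Fib π) : O'.Fib π :=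
  ⟨f.map.app m x.1,
    (congrArg (fun k : O.C ⟶ (T N).obj (one N) => k.app m x.1) f.map_arity).trans x.2⟩

def mapP {O O' : Operad (T.{u} N)} (f : O ⟶ O') {p m : Glb N} {h : p < m}
    {π : ((T N).obj (one N)).obj m} (x : O.P h π) : O'.P h π where
  src := mapFib f x.src
  tgt := mapFib f x.tgt
  parallel ε _ hq e := (face_app f.map ε hq x.src.1).symm.trans
    ((congrArg (f.map.app _) (x.parallel ε hq e)).trans (face_app f.map ε hq x.tgt.1))

end Operad

namespace OWP

variable {N K : ℕ∞}

/-- Maps of operads that preserve the precontractions. -/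
@[ext]
structure Hom (C D : OWP.{u} N) where
  map : C.operad ⟶ D.operad
  map_κ : ∀ {p m : Glb N} (h : p < m) (e : p.dim + 1 = m.dim) (π : ((T N).obj (one N)).obj m)
    (x : C.operad.P h π), Operad.mapFib map (C.κ h e π x) = D.κ h e π (Operad.mapP map x)

instance : Category (OWP.{u} N) where
  Hom := Hom
  id C := { map := 𝟙 _, map_κ := fun _ _ _ _ => rfl }
  comp f g :=
    { map := f.map ≫ g.map
      map_κ := fun h e π x => (congrArg (Operad.mapFib g.map) (f.map_κ h e π x)).trans
        (g.map_κ h e π (Operad.mapP f.map x)) }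

@[ext]
theorem hom_ext {C D : OWP.{u} N} {f g : C ⟶ D} (h : f.map = g.map) : f = g := Hom.ext h

/-- For finite `N`, a precontraction is a contraction if parallel operations of the same arity in the top
dimension `N` are equal. The condition is empty if `N = ⊤` or `N = 0`. -/
def IsContraction (C : OWP.{u} N) : Prop :=
  ∀ {p m : Glb N} (h : p < m), p.dim + 1 = m.dim → (m.dim : ℕ∞) = N →
    ∀ (π : ((T N).obj (one N)).obj m) (x y : C.operad.Fib π),
      face C.operad.C Side.src h x.1 = face C.operad.C Side.src h y.1 →
      face C.operad.C Side.tgt h x.1 = face C.operad.C Side.tgt h y.1 → x = y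

section Truncation

variable (h : K ≤ N)

theorem truncArity_iff (O : OperadData (T.{u} N)) {m : Glb K}
    (x : O.C.obj ((incl h).obj m)) (π : ((T K).obj (one K)).obj m) :
    (Operad.truncArity h O).app m x = π ↔
      O.arity.app ((incl h).obj m) x = (θ h (one N)).hom.app m π := by
  have h1 : ∀ x, (θ h (one N)).hom.app m ((Operad.truncArity h O).app m x) =
      O.arity.app ((incl h).obj m) x := fun x =>
    congrArg (fun k : (truncation h).obj O.C ⟶ (truncation h).obj ((T N).obj (one N)) =>
      k.app m x) (Operad.truncArity_θ h O)
  have h2 : ∀ y : ((T K).obj (one K)).obj m,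
      (θ h (one N)).inv.app m ((θ h (one N)).hom.app m y) = y := fun y =>
    congrArg (fun k : (T K).obj (one K) ⟶ (T K).obj (one K) => k.app m y)
      (θ h (one N)).hom_inv_id
  rw [← h1 x]
  exact ⟨fun e => congrArg _ e, fun e => by rw [← h2 π, ← e]; exact (h2 _).symm⟩

def fibEquiv (O : Operad (T.{u} N)) {m : Glb K} (π : ((T K).obj (one K)).obj m) :
    ((Operad.trunc h).obj O).Fib π ≃
      O.Fib (m := (incl h).obj m) ((θ h (one N)).hom.app m π) where
  toFun x := ⟨x.1, (truncArity_iff h O.toOperadData x.1 π).mp x.2⟩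
  invFun x := ⟨x.1, (truncArity_iff h O.toOperadData x.1 π).mpr x.2⟩
  left_inv _ := rfl
  right_inv _ := rfl

def truncP (O : Operad (T.{u} N)) {p m : Glb K} (l : p < m) (π : ((T K).obj (one K)).obj m)
    (x : ((Operad.trunc h).obj O).P l π) :
    O.P (p := (incl h).obj p) (m := (incl h).obj m) l ((θ h (one N)).hom.app m π) where
  src := ⟨x.src.1, (fibEquiv h O _ x.src).2.trans (face_app (θ h (one N)).hom Side.src l π)⟩
  tgt := ⟨x.tgt.1, (fibEquiv h O _ x.tgt).2.trans (face_app (θ h (one N)).hom Side.tgt l π)⟩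
  parallel ε q hq e := x.parallel ε (q := ⟨q.dim, (Nat.cast_le.mpr hq.le).trans p.le⟩) hq e

/-- Truncation of an operad with precontraction; `RC(π)` is identified with `C(θ π)`. -/
def truncObj (C : OWP.{u} N) : OWP.{u} K where
  operad := (Operad.trunc h).obj C.operad
  κ {p m} l e π x := (fibEquiv h C.operad π).symm
    (C.κ (p := (incl h).obj p) (m := (incl h).obj m) l e _ (truncP h C.operad l π x))
  src_κ {p m} l e π x :=
    C.src_κ (p := (incl h).obj p) (m := (incl h).obj m) l e _ (truncP h C.operad l π x)
  tgt_κ {p m} l e π x :=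
    C.tgt_κ (p := (incl h).obj p) (m := (incl h).obj m) l e _ (truncP h C.operad l π x)

def trunc : OWP.{u} N ⥤ OWP.{u} K where
  obj := truncObj h
  map {C D} f :=
    { map := (Operad.trunc h).map f.map
      map_κ := fun {p m} l e π x => by
        have h1 := f.map_κ (p := (incl h).obj p) (m := (incl h).obj m) l e _
          (truncP h C.operad l π x)
        exact Subtype.ext (congrArg (fun y : D.operad.Fib _ => y.1) h1) }
  map_id _ := rfl
  map_comp _ _ := rfl

end Truncation

end OWP

abbrev contractions (N : ℕ∞) : ObjectProperty (OWP.{u} N) := fun C => C.IsContraction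

/-- `T_N`-operads with contraction. In particular `OWC ⊤` is `OWP ⊤`, up to an always true condition. -/
abbrev OWC (N : ℕ∞) : Type (u + 1) := (contractions.{u} N).FullSubcategory

section Induced

variable {N K : ℕ∞} {h : K ≤ N} {S : GlobSet.{u} K ⥤ GlobSet.{u} N} {S' : OWP.{u} K ⥤ OWP.{u} N}

/-- The mate `T_N 1 → S (T_K 1)` of the isomorphism `R (T_N 1) ≅ T_K 1`. -/
def changeOfBase (adj : truncation h ⊣ S) : (T N).obj (one N) ⟶ S.obj ((T K).obj (one K)) :=
  adj.homEquiv _ _ (θ h (one N)).inv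

/-- The map `S'(D) → S(D)` adjoint to the counit `R(S'(D)) → D` on underlying globular sets. -/
def comparison (adj : truncation h ⊣ S) (adj' : OWP.trunc h ⊣ S') (D : OWP.{u} K) :
    (S'.obj D).operad.C ⟶ S.obj D.operad.C :=
  adj.homEquiv _ _ (adj'.counit.app D).map.map

/-- The adjunction `adj'` on operads with precontraction is induced by the adjunction `adj` on globular sets:
the collection underlying `S'(D)` is the change of base of `S(D) → S(T_K 1)` along `T_N 1 → S(T_K 1)`,
and the counit of `adj'` is the canonical map. -/
def IsInduced (adj : truncation h ⊣ S) (adj' : OWP.trunc h ⊣ S') : Prop :=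
  ∀ D : OWP.{u} K, IsPullback (comparison adj adj' D) (S'.obj D).operad.arity
    (S.map D.operad.arity) (changeOfBase adj)

end Induced

end

end GlobOp

open GlobOp

/-! The right adjoint of truncation on globular sets is the coskeleton: an `m`-cell is a compatible
family of cells of `D` indexed by the faces of dimension `≤ K` of the `m`-globe. For a collection `D
→ T_K 1`, pulling the coskeleton back along `T_N 1 → S(T_K 1)` gives a collection `coind` with a
simple universal property: a map `X → coind` is a map `b : X → T_N 1` together with a map `R X → D`
lying over the truncation of `b`. In particular the arity and the counit `R(coind) → D` are jointly
monic.

The operad structure on `coind` is forced by requiring these two maps to be homomorphisms. The arity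
lands in the terminal operad `T1` and the counit lands in `D`. The laws hold in both targets, so by
joint monicity they hold in `coind`.

The precontraction is also forced. In dimensions `≤ K` the counit is bijective
(`coindCounit_bijective`), and `κ` is transported from `D`. In a dimension `m > K`, the cells over
`π` correspond exactly to parallel pairs of `(m-1)`-cells over the source and target of `π`
(`coind_ext_of_face`, `exists_coind_of_face`), so there is exactly one filler. This uniqueness makes
every transposed map preserve `κ`, and shows that `coind` is a contraction when `K < N` is finite or
not.

The counit is always an isomorphism. For `N = n + 1` and `C` a contraction, the unit is bijective up
to dimension `n` by a triangle identity. In dimension `n + 1` it is injective because of the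
contraction condition, and surjective because `κ` fills every parallel pair. This gives the
equivalence.

The initial object is a term model. Formal expressions are kept when they are defined in every
operad with precontraction, and identified when they have the same value in all of them. Evaluations
are jointly injective by construction, so the laws again hold because they hold in each target. Maps
preserve values of expressions (`mapVal_ev`), and an expression evaluated in the term model is its
own class (`ev_owp`); hence initiality. Finally, truncation from `OWC` is a left adjoint and the
equivalence preserves initial objects, which settles the finite levels. -/

namespace GlobOp

/-! ### Homomorphisms of operad data, the terminal operad, isomorphisms -/

theorem app_congr {N : ℕ∞} {X Y : GlobSet.{u} N} {f g : X ⟶ Y} (h : f = g) (m : Glb N)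
    (x : X.obj m) : f.app m x = g.app m x := by rw [h]

namespace OperadData

variable {N : ℕ∞} {T : Monad (GlobSet.{u} N)} {O P : OperadData T}

/-- The map `C ∘ C → D ∘ D` induced by a map of collections. -/
def map₂ (f : O.C ⟶ P.C) (hf : f ≫ P.arity = O.arity) : O.CC ⟶ P.CC :=
  pbLift (pbFst _ _ ≫ T.map f) (pbSnd _ _ ≫ f) (by
    rw [Category.assoc, Category.assoc, hf, ← T.map_comp, toOne_unique (f ≫ toOne P.C) (toOne _)]
    exact pb_condition _ _)

/-- The map of ternary composites induced by a map of collections. -/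
def map₃ (f : O.C ⟶ P.C) (hf : f ≫ P.arity = O.arity) : O.CCC ⟶ P.CCC :=
  pbLift (pbFst _ _ ≫ T.map (map₂ f hf)) (pbSnd _ _ ≫ f) (by
    rw [Category.assoc, Category.assoc, hf, ← T.map_comp,
      toOne_unique (map₂ f hf ≫ toOne P.CC) (toOne _)]
    exact pb_condition _ _)

/-- Maps of collections that preserve identities and composition. -/
structure IsHom (f : O.C ⟶ P.C) : Prop where
  arity : f ≫ P.arity = O.arity
  ids : O.ids ≫ f = P.ids
  comp : O.comp ≫ f = map₂ f arity ≫ P.comp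

variable {f : O.C ⟶ P.C}

/-- The arity of a composite depends only on the arities of its parts, so over `T1` compatibility
with composition is automatic for a map of collections. -/
theorem comp_map_arity (hf : f ≫ P.arity = O.arity) :
    (O.comp ≫ f) ≫ P.arity = (map₂ f hf ≫ P.comp) ≫ P.arity := by
  have h1 : map₂ f hf ≫ pbFst _ _ = pbFst _ _ ≫ T.map f := rfl
  rw [Category.assoc, Category.assoc, hf, O.comp_arity, P.comp_arity, reassoc_of% h1,
    ← T.map_comp_assoc, hf]

/-- The maps `unitLeft`, `unitRight`, `assocLeft` and `assocRight` through which the operad laws are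
stated are natural in homomorphisms. This lemma and the following ones prove it without assuming any
law. -/
theorem IsHom.unitLeft (hf : IsHom f) : O.unitLeft ≫ map₂ f hf.arity = f ≫ P.unitLeft := by
  apply pb_hom_ext
  · change T.η.app O.C ≫ T.map f = f ≫ T.η.app P.C
    exact (T.η.naturality f).symm
  · change (toOne O.C ≫ O.ids) ≫ f = f ≫ toOne P.C ≫ P.ids
    rw [Category.assoc, hf.ids]
    rfl

theorem IsHom.unitRight (hf : IsHom f) : O.unitRight ≫ map₂ f hf.arity = f ≫ P.unitRight := by
  apply pb_hom_ext
  · change (O.arity ≫ T.map O.ids) ≫ T.map f = f ≫ P.arity ≫ T.map P.ids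
    rw [Category.assoc, ← T.map_comp, hf.ids, ← hf.arity, Category.assoc]
  · rfl

theorem IsHom.assocLeft (hf : IsHom f) :
    O.assocLeft ≫ map₂ f hf.arity = map₃ f hf.arity ≫ P.assocLeft := by
  apply pb_hom_ext
  · change (pbFst _ _ ≫ T.map O.comp) ≫ T.map f =
      (pbFst _ _ ≫ T.map (map₂ f hf.arity)) ≫ T.map P.comp
    rw [Category.assoc, Category.assoc, ← T.map_comp, ← T.map_comp, hf.comp]
  · rfl

theorem IsHom.assocInner (hf : IsHom f) :
    O.assocInner ≫ map₂ f hf.arity = map₃ f hf.arity ≫ P.assocInner := by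
  apply pb_hom_ext
  · change (pbFst _ _ ≫ T.map (pbSnd _ _)) ≫ T.map f =
      (pbFst _ _ ≫ T.map (map₂ f hf.arity)) ≫ T.map (pbSnd _ _)
    rw [Category.assoc, Category.assoc, ← T.map_comp, ← T.map_comp]
    rfl
  · rfl

theorem IsHom.assocRight (hf : IsHom f) :
    O.assocRight ≫ map₂ f hf.arity = map₃ f hf.arity ≫ P.assocRight := by
  apply pb_hom_ext
  · change (pbFst _ _ ≫ T.map (pbFst _ _) ≫ T.μ.app O.C) ≫ T.map f =
      (pbFst _ _ ≫ T.map (map₂ f hf.arity)) ≫ T.map (pbFst _ _) ≫ T.μ.app P.C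
    have h1 : T.μ.app O.C ≫ T.map f = T.map (T.map f) ≫ T.μ.app P.C := (T.μ.naturality f).symm
    simp only [Category.assoc]
    rw [h1, ← T.map_comp_assoc, ← T.map_comp_assoc]
    rfl
  · change (O.assocInner ≫ O.comp) ≫ f = map₃ f hf.arity ≫ P.assocInner ≫ P.comp
    rw [Category.assoc, hf.comp, ← Category.assoc, hf.assocInner, Category.assoc]

theorem IsHom.unitLeft_comp (hf : IsHom f) :
    (O.unitLeft ≫ O.comp) ≫ f = f ≫ P.unitLeft ≫ P.comp := by
  rw [Category.assoc, hf.comp, ← Category.assoc, hf.unitLeft, Category.assoc]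

theorem IsHom.unitRight_comp (hf : IsHom f) :
    (O.unitRight ≫ O.comp) ≫ f = f ≫ P.unitRight ≫ P.comp := by
  rw [Category.assoc, hf.comp, ← Category.assoc, hf.unitRight, Category.assoc]

theorem IsHom.assocLeft_comp (hf : IsHom f) :
    (O.assocLeft ≫ O.comp) ≫ f = map₃ f hf.arity ≫ P.assocLeft ≫ P.comp := by
  rw [Category.assoc, hf.comp, ← Category.assoc, hf.assocLeft, Category.assoc]

theorem IsHom.assocRight_comp (hf : IsHom f) :
    (O.assocRight ≫ O.comp) ≫ f = map₃ f hf.arity ≫ P.assocRight ≫ P.comp := by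
  rw [Category.assoc, hf.comp, ← Category.assoc, hf.assocRight, Category.assoc]

section

variable {P : Operad T} {f : O.C ⟶ P.C}

/-- The source is mere data while the target is an operad: the laws of the target hold in the source
after composition with `f`. Given a jointly monic family of such `f`, the source is itself an
operad; both constructions of operads below work in this way. -/
theorem IsHom.unitLeft_eq (hf : IsHom (P := P.toOperadData) f) :
    (O.unitLeft ≫ O.comp) ≫ f = 𝟙 _ ≫ f := by
  rw [hf.unitLeft_comp, P.unit_left, Category.comp_id, Category.id_comp]

theorem IsHom.unitRight_eq (hf : IsHom (P := P.toOperadData) f) :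
    (O.unitRight ≫ O.comp) ≫ f = 𝟙 _ ≫ f := by
  rw [hf.unitRight_comp, P.unit_right, Category.comp_id, Category.id_comp]

theorem IsHom.assoc_eq (hf : IsHom (P := P.toOperadData) f) :
    (O.assocLeft ≫ O.comp) ≫ f = (O.assocRight ≫ O.comp) ≫ f := by
  rw [hf.assocLeft_comp, P.assoc, hf.assocRight_comp]

end

end OperadData

namespace Operad

variable {N : ℕ∞}

theorem Hom.isHom {T : Monad (GlobSet.{u} N)} {O P : Operad T} (f : O ⟶ P) :
    OperadData.IsHom (O := O.toOperadData) (P := P.toOperadData) f.map :=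
  ⟨f.map_arity, f.map_ids, f.map_comp⟩

def homOfIsHom {T : Monad (GlobSet.{u} N)} {O P : Operad T} {f : O.C ⟶ P.C}
    (h : OperadData.IsHom (O := O.toOperadData) (P := P.toOperadData) f) : O ⟶ P :=
  (⟨f, h.arity, h.ids, h.comp⟩ : Hom O P)

/-- The collection `T1` with the multiplication of `T` as composition. -/
def topData (T : Monad (GlobSet.{u} N)) : OperadData T where
  C := T.obj (one N)
  arity := 𝟙 _
  ids := T.η.app _
  comp := pbFst _ _ ≫ T.μ.app (one N)
  ids_arity := Category.comp_id _
  comp_arity := by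
    rw [T.map_id]
    rfl

/-- The terminal operad. -/
def top (T : Monad (GlobSet.{u} N)) : Operad T where
  toOperadData := topData T
  unit_left := T.left_unit _
  unit_right := T.right_unit _
  assoc := by
    change (pbFst _ _ ≫ T.map (pbFst _ _ ≫ T.μ.app (one N))) ≫ T.μ.app (one N) =
      (pbFst _ _ ≫ T.map (pbFst _ _) ≫ T.μ.app (T.obj (one N))) ≫ T.μ.app (one N)
    rw [T.map_comp, Category.assoc, Category.assoc, Category.assoc, Category.assoc, T.assoc]

/-- The two axioms on arities in `OperadData` say precisely this, since composition in the terminal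
operad is the multiplication of the monad. -/
theorem isHom_arity {T : Monad (GlobSet.{u} N)} (O : OperadData T) :
    OperadData.IsHom (P := (top T).toOperadData) O.arity where
  arity := Category.comp_id _
  ids := O.ids_arity
  comp := O.comp_arity


end Operad

theorem bijective_of_isIso {N : ℕ∞} {X Y : GlobSet.{u} N} (f : X ⟶ Y) [IsIso f] (m : Glb N) :
    Function.Bijective (f.app m) := by
  have : IsIso (f.app m) := inferInstance
  exact (isIso_iff_bijective _).mp this

theorem isIso_of_bijective {N : ℕ∞} {X Y : GlobSet.{u} N} (f : X ⟶ Y)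
    (h : ∀ m, Function.Bijective (f.app m)) : IsIso f := by
  have : ∀ m, IsIso (f.app m) := fun m => (isIso_iff_bijective _).mpr (h m)
  exact NatIso.isIso_of_isIso_app f

theorem inv_isHom {N : ℕ∞} {T : Monad (GlobSet.{u} N)} {O P : OperadData T} {f : O.C ⟶ P.C}
    [IsIso f] (hf : OperadData.IsHom f) : OperadData.IsHom (O := P) (P := O) (inv f) := by
  have ha : inv f ≫ O.arity = P.arity := by rw [← hf.arity, IsIso.inv_hom_id_assoc]
  refine ⟨ha, by rw [← hf.ids, Category.assoc, IsIso.hom_inv_id, Category.comp_id], ?_⟩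
  have h2 : OperadData.map₂ (inv f) ha ≫ OperadData.map₂ f hf.arity = 𝟙 _ := by
    apply pb_hom_ext
    · change (pbFst _ _ ≫ T.map (inv f)) ≫ T.map f = pbFst _ _
      rw [Category.assoc, ← T.map_comp, IsIso.inv_hom_id, T.map_id, Category.comp_id]
    · change (pbSnd _ _ ≫ inv f) ≫ f = pbSnd _ _
      rw [Category.assoc, IsIso.inv_hom_id, Category.comp_id]
  rw [IsIso.comp_inv_eq, Category.assoc, hf.comp, ← Category.assoc, h2, Category.id_comp]

namespace OWP

variable {N : ℕ∞}

/-- Fibres and parallel pairs depend on the arity, which is often known only up to a propositional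
equality; comparing the underlying cells avoids transport between types. -/
theorem κ_congr (C : OWP.{u} N) {p m : Glb N} {h : p < m} {e : p.dim + 1 = m.dim}
    {π π' : ((T N).obj (one N)).obj m} (hπ : π = π') (x : C.operad.P h π) (x' : C.operad.P h π')
    (hs : x.src.1 = x'.src.1) (ht : x.tgt.1 = x'.tgt.1) :
    (C.κ h e π x).1 = (C.κ h e π' x').1 := by
  subst hπ
  obtain ⟨s, t, _⟩ := x
  obtain ⟨s', t', _⟩ := x'
  obtain rfl := Subtype.ext hs
  obtain rfl := Subtype.ext ht
  rfl

/-- The inverse preserves `κ` because, by injectivity, the equation may be checked after applying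
`f`, which preserves `κ`. -/
theorem isIso_of_bijective {C D : OWP.{u} N} (f : C ⟶ D)
    (h : ∀ m, Function.Bijective (f.map.map.app m)) : IsIso f := by
  have : IsIso f.map.map := GlobOp.isIso_of_bijective _ h
  let g : D.operad ⟶ C.operad := Operad.homOfIsHom (inv_isHom (Operad.Hom.isHom f.map))
  have hfg : f.map.map ≫ g.map = 𝟙 _ := IsIso.hom_inv_id f.map.map
  have hgf : g.map ≫ f.map.map = 𝟙 _ := IsIso.inv_hom_id f.map.map
  let g' : D ⟶ C :=
    { map := g
      map_κ := fun {p m} hp e π x => by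
        apply Subtype.ext
        apply (h m).1
        have h1 := congrArg Subtype.val (f.map_κ hp e π (Operad.mapP g x))
        refine (app_congr hgf m _).trans (Eq.trans ?_ h1.symm)
        exact κ_congr D rfl _ _ (app_congr hgf p x.src.1).symm (app_congr hgf p x.tgt.1).symm }
  exact ⟨g', hom_ext (Operad.hom_ext hfg), hom_ext (Operad.hom_ext hgf)⟩

end OWP

end GlobOp

/-! ### The coskeleton and the coinduced collection -/

namespace GlobOp

open Glb

variable {N K : ℕ∞}

/-- The right adjoint of truncation: an `m`-cell of the coskeleton of `D` is a compatible family of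
cells of `D`, indexed by the faces of dimension `≤ K` of the `m`-globe. -/
def coskeleton (h : K ≤ N) : GlobSet.{u} K ⥤ GlobSet.{u} N where
  obj D :=
    { obj := fun m => {x : ∀ p : Glb K, (m ⟶ (incl h).obj p) → D.obj p //
        ∀ (p q : Glb K) (g : p ⟶ q) (k : m ⟶ (incl h).obj p),
          D.map g (x p k) = x q (k ≫ (incl h).map g)}
      map := fun k => TypeCat.ofHom fun x => ⟨fun p l => x.1 p (k ≫ l), fun p q g l => by
        rw [x.2, Category.assoc]⟩
      map_id := fun m => by
        ext x p l
        exact congrArg (x.1 p) (Category.id_comp l)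
      map_comp := fun k k' => by
        ext x p l
        exact congrArg (x.1 p) (Category.assoc k k' l) }
  map f :=
    { app := fun m => TypeCat.ofHom fun x => ⟨fun p k => f.app p (x.1 p k), fun p q g k => by
        rw [← NatTrans.naturality_apply f, x.2]⟩
      naturality := fun _ _ _ => rfl }
  map_id _ := rfl
  map_comp _ _ := rfl

/-- A Yoneda argument: the component of `g x` at a face `k` equals, by naturality, the component of
`g` of that face at the identity. So `g` is recovered from its components at identities. -/
def coskeletonEquiv (h : K ≤ N) (X : GlobSet.{u} N) (D : GlobSet.{u} K) :
    ((truncation h).obj X ⟶ D) ≃ (X ⟶ (coskeleton h).obj D) where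
  toFun f :=
    { app := fun m => TypeCat.ofHom fun x => ⟨fun p k => f.app p (X.map k x), fun p q g k => by
        refine (NatTrans.naturality_apply f g _).symm.trans ?_
        exact congrArg (f.app q) (Functor.map_comp_apply X k ((incl h).map g) x).symm⟩
      naturality := fun m p k => by
        ext x
        refine Subtype.ext (funext fun q => funext fun l => ?_)
        exact congrArg (f.app q) (Functor.map_comp_apply X k l x).symm }
  invFun g :=
    { app := fun m => TypeCat.ofHom fun x => (g.app ((incl h).obj m) x).1 m (𝟙 _)
      naturality := fun m p k => by
        ext x
        have h1 := NatTrans.naturality_apply g ((incl h).map k) x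
        refine (congrArg (fun y => y.1 p (𝟙 _)) h1).trans ?_
        refine Eq.trans ?_ ((g.app ((incl h).obj m) x).2 m p k (𝟙 _)).symm
        change (g.app ((incl h).obj m) x).1 p _ = (g.app ((incl h).obj m) x).1 p _
        rw [Category.comp_id, Category.id_comp] }
  left_inv f := by
    refine globSet_hom_ext fun m x => ?_
    exact congrArg (f.app m) (Functor.map_id_apply X _ x)
  right_inv g := by
    refine globSet_hom_ext fun m x => Subtype.ext (funext fun p => funext fun k => ?_)
    have h1 := NatTrans.naturality_apply g k x
    refine (congrArg (fun y => y.1 p (𝟙 _)) h1).trans ?_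
    change (g.app m x).1 p _ = _
    rw [Category.comp_id]

/-- Truncation is left adjoint to the coskeleton. -/
def coskeletonAdj (h : K ≤ N) : truncation.{u} h ⊣ coskeleton h :=
  Adjunction.mkOfHomEquiv
    { homEquiv := coskeletonEquiv h
      homEquiv_naturality_left_symm := fun _ _ => rfl
      homEquiv_naturality_right := fun _ _ => rfl }

theorem coskeletonAdj_homEquiv (h : K ≤ N) (X : GlobSet.{u} N) (D : GlobSet.{u} K) :
    (coskeletonAdj h).homEquiv X D = coskeletonEquiv h X D := by
  simp [coskeletonAdj]

noncomputable section

variable (h : K ≤ N)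

/-- The canonical map `R (T_N 1) → T_K 1`. -/
abbrev baseInv : (truncation h).obj ((T.{u} N).obj (one N)) ⟶ (T K).obj (one K) :=
  (θ h (one N)).inv

theorem changeOfBase_eq :
    changeOfBase (coskeletonAdj.{u} h) = coskeletonEquiv h _ _ (baseInv h) :=
  congrArg (fun e => e (baseInv h)) (coskeletonAdj_homEquiv h _ _)

section Collection

variable {D : GlobSet.{u} K} (a : D ⟶ (T K).obj (one K))

/-- The change of base of `S(D) → S(T_K 1)` along `T_N 1 → S(T_K 1)`. -/
def coind : GlobSet.{u} N :=
  pb ((coskeleton h).map a) (coskeletonEquiv h _ _ (baseInv h))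

def coindArity : coind h a ⟶ (T N).obj (one N) := pbSnd _ _

/-- The transpose of the projection to `S(D)`. -/
def coindCounit : (truncation h).obj (coind h a) ⟶ D :=
  (coskeletonEquiv h _ _).symm (pbFst _ _)

/-- This is the transpose of the commutative square of the defining pullback. -/
theorem coindCounit_arity :
    coindCounit h a ≫ a = (truncation h).map (coindArity h a) ≫ baseInv h := by
  apply (coskeletonEquiv h _ _).injective
  refine Eq.trans ?_ ((pb_condition ((coskeleton h).map a)
    (coskeletonEquiv h _ _ (baseInv h))).trans ?_)
  · exact congrArg (· ≫ (coskeleton h).map a) ((coskeletonEquiv h _ _).apply_symm_apply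
      (pbFst ((coskeleton h).map a) (coskeletonEquiv h _ _ (baseInv h))))
  · refine globSet_hom_ext fun m x => Subtype.ext (funext fun p => funext fun k => ?_)
    exact congrArg ((baseInv h).app p)
      (NatTrans.naturality_apply (coindArity h a) k x).symm

/-- Joint monicity of the two pullback projections, with the first one transposed. All equations
between maps into the coinduced operad reduce to one in `T_N 1` and one in `D`. -/
theorem coind_hom_ext {X : GlobSet.{u} N} {f g : X ⟶ coind h a}
    (h₁ : f ≫ coindArity h a = g ≫ coindArity h a)
    (h₂ : (truncation h).map f ≫ coindCounit h a = (truncation h).map g ≫ coindCounit h a) :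
    f = g := by
  refine pb_hom_ext ?_ h₁
  apply (coskeletonEquiv h _ _).symm.injective
  exact h₂

variable {a}

/-- The existence half of the universal property: the map with arity `b` whose transpose is `f`. -/
def coindLift {X : GlobSet.{u} N} (b : X ⟶ (T N).obj (one N)) (f : (truncation h).obj X ⟶ D)
    (w : f ≫ a = (truncation h).map b ≫ baseInv h) : X ⟶ coind h a :=
  pbLift (coskeletonEquiv h _ _ f) b (by
    change coskeletonEquiv h _ _ (f ≫ a) = _
    rw [w]
    refine globSet_hom_ext fun m x => Subtype.ext (funext fun p => funext fun k => ?_)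
    exact congrArg ((baseInv h).app p) (NatTrans.naturality_apply b k x))

theorem coindLift_counit {X : GlobSet.{u} N} (b : X ⟶ (T N).obj (one N))
    (f : (truncation h).obj X ⟶ D) (w : f ≫ a = (truncation h).map b ≫ baseInv h) :
    (truncation h).map (coindLift h b f w) ≫ coindCounit h a = f :=
  (coskeletonEquiv h _ _).symm_apply_apply f


end Collection

end

end GlobOp

/-! ### Cells of the coinduced collection below and above dimension `K` -/

namespace GlobOp

open Glb

variable {N K : ℕ∞}

namespace Glb

theorem eq_δ {m p : Glb N} (h : p < m) (k : m ⟶ p) : ∃ ε, k = δ ε h := by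
  induction k using hom_ind with
  | id => exact (lt_irrefl' h).elim
  | bd ε _ => exact ⟨ε, rfl⟩

theorem eq_id {p : Glb N} (k : p ⟶ p) : k = 𝟙 p := by
  obtain ⟨p, hp⟩ := p
  change Hom p p at k
  cases k with
  | id => rfl
  | bd _ h => exact (Nat.lt_irrefl _ h).elim

/-- The side of a boundary map. -/
def Hom.side : {m p : ℕ} → Hom m p → Side
  -- An arbitrary default: the side is used only for maps that strictly lower the dimension.
  | _, _, .id _ => .src
  | _, _, .bd ε _ => ε

/-- The boundary map on the side `ε`, or the identity if the dimensions are equal. -/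
def bdry (ε : Side) {p q : Glb N} (h : q.dim ≤ p.dim) : p ⟶ q :=
  if hl : q < p then δ ε hl else eqToHom (Glb.ext (le_antisymm (Nat.le_of_not_lt hl) h))

theorem bdry_of_lt (ε : Side) {p q : Glb N} (h : q < p) : bdry ε (le_of_lt h) = δ ε h :=
  dif_pos h

theorem bdry_self (ε : Side) (p : Glb N) : bdry ε (le_refl p.dim) = 𝟙 p :=
  dif_neg lt_irrefl'

theorem δ_bdry (ε : Side) {m p q : Glb N} (h : p < m) (h' : q.dim ≤ p.dim) :
    δ ε h ≫ bdry ε h' = δ ε (lt_of_le_of_lt h' h : q.dim < m.dim) := by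
  rcases tri q p with hl | rfl | hl
  · rw [bdry_of_lt ε hl]; rfl
  · rw [bdry_self, Category.comp_id]
  · exact (Nat.not_lt.mpr h' hl).elim

theorem bdry_δ (ε ε' : Side) {p q r : Glb N} (h : q.dim ≤ p.dim) (h' : r < q) :
    bdry ε h ≫ δ ε' h' = δ ε' (lt_of_lt_of_le h' h : r.dim < p.dim) := by
  rcases tri q p with hl | rfl | hl
  · rw [bdry_of_lt ε hl]; rfl
  · rw [bdry_self, Category.id_comp]
  · exact (Nat.not_lt.mpr h hl).elim

end Glb

/-- The definition of a parallel pair mentions only faces of codimension one; globularity gives the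
lower ones, by passing through dimension `p - 1`. -/
theorem face_eq_of_parallel {X : GlobSet.{u} N} {p : Glb N} {x y : X.obj p}
    (hxy : ∀ (ε : Side) {q : Glb N} (hq : q < p), q.dim + 1 = p.dim →
      face X ε hq x = face X ε hq y) (ε : Side) {q : Glb N} (hq : q < p) :
    face X ε hq x = face X ε hq y := by
  have hq' : q.dim < p.dim := hq
  let r : Glb N := ⟨p.dim - 1, (Nat.cast_le.mpr (Nat.sub_le _ _)).trans p.le⟩
  have hr : r < p := Nat.sub_lt (by omega) one_pos
  have e : r.dim + 1 = p.dim := Nat.sub_add_cancel (by omega)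
  rcases Nat.lt_or_ge q.dim r.dim with hl | hl
  · rw [← face_face X ε ε hr hl, ← face_face X ε ε hr hl, hxy ε hr e]
  · exact hxy ε hq (by omega)

noncomputable section

variable (h : K ≤ N) {D : GlobSet.{u} K} (a : D ⟶ (T K).obj (one K))

theorem baseInv_injective (m : Glb K) : Function.Injective ((baseInv.{u} h).app m) :=
  (bijective_of_isIso (baseInv h) m).1

theorem θ_baseInv {m : Glb K} (π : ((T.{u} K).obj (one K)).obj m) :
    (baseInv h).app m ((θ h (one N)).hom.app m π) = π :=
  app_congr (θ h (one N)).hom_inv_id m π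

theorem baseInv_θ {m : Glb K} (π : ((T.{u} N).obj (one N)).obj ((incl h).obj m)) :
    (θ h (one N)).hom.app m ((baseInv h).app m π) = π :=
  app_congr (θ h (one N)).inv_hom_id m π

variable {a} in
theorem coind_ext {m : Glb N} {y y' : (coind h a).obj m}
    (h₁ : ∀ (p : Glb K) (k : m ⟶ (incl h).obj p), y.1.1.1 p k = y'.1.1.1 p k)
    (h₂ : (coindArity h a).app m y = (coindArity h a).app m y') : y = y' :=
  Subtype.ext (Prod.ext (Subtype.ext (funext fun p => funext fun k => h₁ p k)) h₂)

/-- In a dimension `≤ K` the globe is one of its own admissible faces, so a compatible family is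
determined by its component at the identity. The arity is then determined as well, since `R(T_N 1) →
T_K 1` is an isomorphism. -/
theorem coindCounit_bijective (m : Glb K) : Function.Bijective ((coindCounit h a).app m) := by
  constructor
  · intro y y' e
    have e' : y.1.1.1 m (𝟙 _) = y'.1.1.1 m (𝟙 _) := e
    refine coind_ext h (fun p k => ?_) ?_
    · have h1 := y.1.1.2 m p k (𝟙 _)
      have h2 := y'.1.1.2 m p k (𝟙 _)
      rw [e'] at h1
      have h3 := h1.symm.trans h2
      have h4 : 𝟙 ((incl h).obj m) ≫ (incl h).map (X := m) (Y := p) k = k := Category.id_comp k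
      rw [h4] at h3
      exact h3
    · apply baseInv_injective h
      exact (app_congr (coindCounit_arity h a) m y).symm.trans
        ((congrArg (a.app m) e).trans (app_congr (coindCounit_arity h a) m y'))
  · intro d
    -- The preimage of `d` is the family of all faces of `d`, with the arity of `d` transported
    -- along `θ`.
    refine ⟨⟨(⟨fun p k => D.map (X := m) (Y := p) k d, fun p q g k =>
      (Functor.map_comp_apply D (X := m) (Y := p) k g d).symm⟩,
      (θ h (one N)).hom.app m (a.app m d)), ?_⟩, Functor.map_id_apply D m d⟩
    refine Subtype.ext (funext fun p => funext fun k => ?_)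
    refine (NatTrans.naturality_apply a (X := m) (Y := p) k d).trans ?_
    refine Eq.trans ?_ (NatTrans.naturality_apply (baseInv h) (X := m) (Y := p) k
      ((θ h (one N)).hom.app m (a.app m d))).symm
    rw [θ_baseInv]

instance : IsIso (coindCounit h a) := isIso_of_bijective _ (coindCounit_bijective h a)

variable {a}

/-- Above dimension `K` every admissible face of the `m`-globe is proper, hence factors through one
of its two `(m-1)`-dimensional faces. -/
theorem coind_ext_of_face {p m : Glb N} (hp : p < m) (e : p.dim + 1 = m.dim)
    (hm : ¬ (m.dim : ℕ∞) ≤ K) {y y' : (coind h a).obj m}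
    (h₁ : (coindArity h a).app m y = (coindArity h a).app m y')
    (h₂ : ∀ ε, face (coind h a) ε hp y = face (coind h a) ε hp y') : y = y' := by
  refine coind_ext h (fun q k => ?_) h₁
  have hq : q.dim < m.dim := by
    by_contra hq
    exact hm ((Nat.cast_le.mpr (Nat.le_of_not_lt hq)).trans q.le)
  obtain ⟨ε, rfl⟩ := eq_δ (show (incl h).obj q < m from hq) k
  have hq' : ((incl h).obj q).dim ≤ p.dim := by
    change q.dim ≤ p.dim
    omega
  rw [← δ_bdry ε hp hq']
  exact congrArg (fun z => z.1.1.1 q (bdry ε hq')) (h₂ ε)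

/-- Two parallel `(m-1)`-cells glue: the `m`-globe above dimension `K` has no admissible face
outside its boundary, so nothing but a compatible boundary and an arity has to be given. -/
theorem exists_coind_of_face {p m : Glb N} (hp : p < m) (e : p.dim + 1 = m.dim)
    (hm : ¬ (m.dim : ℕ∞) ≤ K) (π : ((T N).obj (one N)).obj m) (x : Side → (coind h a).obj p)
    (hx : ∀ ε, (coindArity h a).app p (x ε) = face _ ε hp π)
    (hpar : ∀ (ε : Side) {q : Glb N} (hq : q < p), face (coind h a) ε hq (x .src) =
      face (coind h a) ε hq (x .tgt)) :
    ∃ y : (coind h a).obj m, (coindArity h a).app m y = π ∧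
      ∀ ε, face (coind h a) ε hp y = x ε := by
  have hlt : ∀ q : Glb K, q.dim < m.dim := fun q => by
    by_contra hq
    exact hm ((Nat.cast_le.mpr (Nat.le_of_not_lt hq)).trans q.le)
  have hle : ∀ q : Glb K, ((incl h).obj q).dim ≤ p.dim := fun q => by
    have := hlt q
    change q.dim ≤ p.dim
    omega
  have hpar' : ∀ ε₁ ε₂ ε {q : Glb N} (hq : q < p), face (coind h a) ε hq (x ε₁) =
      face (coind h a) ε hq (x ε₂) := by
    rintro (_ | _) (_ | _) ε q hq
    exacts [rfl, hpar ε hq, (hpar ε hq).symm, rfl]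
  have hσ : ∀ ε₁ ε₂ ε {q : Glb K} (hq : (incl h).obj q < p),
      (x ε₁).1.1.1 q (δ ε hq) = (x ε₂).1.1.1 q (δ ε hq) := fun ε₁ ε₂ ε q hq => by
    have h1 := congrArg (fun z => z.1.1.1 q (𝟙 _)) (hpar' ε₁ ε₂ ε hq)
    change (x ε₁).1.1.1 q (δ ε hq ≫ 𝟙 _) = (x ε₂).1.1.1 q (δ ε hq ≫ 𝟙 _) at h1
    rwa [Category.comp_id] at h1
  -- A map `k` out of `m` factors through the `p`-dimensional face on its own side; its value is
  -- read off from the cell given on that side.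
  let σ : ∀ q : Glb K, (m ⟶ (incl h).obj q) → D.obj q := fun q k =>
    (x (Hom.side k)).1.1.1 q (bdry (Hom.side k) (hle q))
  have hσ' : ∀ (q r : Glb K) (g : q ⟶ r) (k : m ⟶ (incl h).obj q),
      D.map g (σ q k) = σ r (k ≫ (incl h).map g) := by
    intro q r g k
    refine ((x (Hom.side k)).1.1.2 q r g _).trans ?_
    obtain ⟨ε, rfl⟩ := eq_δ (show (incl h).obj q < m from hlt q) k
    induction g using hom_ind with
    | id q =>
      rw [CategoryTheory.Functor.map_id, Category.comp_id, Category.comp_id]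
    -- The composite takes the side `ε'` of its last factor, whereas the left-hand value comes from
    -- `x ε`. The two agree since `r` lies strictly below `p`, where the given cells have the same
    -- faces.
    | @bd ε' q r hrq =>
      change (x ε).1.1.1 r (bdry ε (hle q) ≫ δ ε' hrq) = (x ε').1.1.1 r (bdry ε' (hle r))
      have hrp : (incl h).obj r < p := lt_of_lt_of_le hrq (hle q)
      exact (congrArg (fun k => (x ε).1.1.1 r k) (bdry_δ ε ε' (hle q) (r := (incl h).obj r)
        hrq)).trans ((hσ ε ε' ε' hrp).trans (congrArg (fun k => (x ε').1.1.1 r k)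
          (bdry_of_lt ε' hrp)).symm)
  refine ⟨⟨(⟨σ, hσ'⟩, π), ?_⟩, rfl, fun ε => ?_⟩
  · refine Subtype.ext (funext fun q => funext fun k => ?_)
    obtain ⟨ε, rfl⟩ := eq_δ (show (incl h).obj q < m from hlt q) k
    change a.app q ((x ε).1.1.1 q (bdry ε (hle q))) =
      (baseInv h).app q (((T N).obj (one N)).map (δ ε (hlt q)) π)
    have h1 := congrArg (fun z => z.1 q (bdry ε (hle q))) (x ε).2
    refine h1.trans (congrArg ((baseInv h).app q) ?_)
    have h2 : (x ε).1.2 = face _ ε hp π := hx ε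
    rw [h2]
    refine (Functor.map_comp_apply ((T N).obj (one N)) (δ ε hp) (bdry ε (hle q)) π).symm.trans ?_
    rw [δ_bdry]
  · refine coind_ext h (fun q k => ?_) (hx ε).symm
    change (x (Hom.side (δ ε hp ≫ k))).1.1.1 q (bdry (Hom.side (δ ε hp ≫ k)) (hle q)) = _
    -- Strictly below `p` the side recorded by the composite may differ from `ε`, and `hσ` repairs
    -- this; at `q = p` the only map is the identity and the component is that of `x ε`.
    rcases tri ((incl h).obj q) p with hl | rfl | hl
    · obtain ⟨ε', rfl⟩ := eq_δ hl k
      change (x ε').1.1.1 q (bdry ε' (hle q)) = _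
      rw [bdry_of_lt ε' hl]
      exact hσ ε' ε ε' hl
    · rw [eq_id k, Category.comp_id]
      change (x ε).1.1.1 q (bdry ε (hle q)) = _
      rw [bdry_self]
    · exact (Nat.not_lt.mpr (hle q) hl).elim

end

end GlobOp

/-! ### The operad structure on the coinduced collection -/

namespace GlobOp

open Glb

variable {N K : ℕ∞}

noncomputable section

namespace Operad

variable (h : K ≤ N)

/-- The inverse of the canonical map `RC ∘ RC → R(C ∘ C)`. -/
def truncPairInv (O : OperadData (T.{u} N)) : (truncation h).obj O.CC ⟶ (truncData h O).CC :=
  pbLift ((truncation h).map (pbFst _ _) ≫ (θ h O.C).inv) ((truncation h).map (pbSnd _ _)) (by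
    refine globSet_hom_ext fun m w => ?_
    apply (bijective_of_isIso (θ h (one N)).hom m).1
    refine (θ_nat h (toOne O.C) m _).trans ?_
    refine (congrArg (((T N).map (toOne O.C)).app ((incl h).obj m))
      (app_congr (θ h O.C).inv_hom_id m _)).trans ?_
    exact w.2.trans (app_congr (truncArity_θ h O) m _).symm)

/-- Only this composite is needed: it makes `truncPair` surjective on cells, so equations on `R(C ∘
C)` may be tested on `RC ∘ RC`. The ternary version below serves the same purpose for associativity.
-/
theorem truncPairInv_truncPair (O : OperadData (T.{u} N)) :
    truncPairInv h O ≫ truncPair h O = 𝟙 _ :=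
  globSet_hom_ext fun m w => Subtype.ext (Prod.ext (app_congr (θ h O.C).inv_hom_id m w.1.1) rfl)

def truncTripleInv (O : OperadData (T.{u} N)) :
    (truncation h).obj O.CCC ⟶ (truncData h O).CCC :=
  pbLift ((truncation h).map (pbFst _ _) ≫ (θ h O.CC).inv ≫ (T K).map (truncPairInv h O))
    ((truncation h).map (pbSnd _ _)) (by
    refine globSet_hom_ext fun m w => ?_
    apply (bijective_of_isIso (θ h (one N)).hom m).1
    refine (congrArg ((θ h (one N)).hom.app m) (T_map_comp (truncPairInv h O)
      ((toOne (truncData h O).CC)) m _).symm).trans ?_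
    refine (θ_nat h (toOne O.CC) m _).trans ?_
    refine (congrArg (((T N).map (toOne O.CC)).app ((incl h).obj m))
      (app_congr (θ h O.CC).inv_hom_id m _)).trans ?_
    exact w.2.trans (app_congr (truncArity_θ h O) m _).symm)

theorem truncTripleInv_truncTriple (O : OperadData (T.{u} N)) :
    truncTripleInv h O ≫ truncTriple h O = 𝟙 _ := by
  refine globSet_hom_ext fun m w => Subtype.ext (Prod.ext ?_ rfl)
  refine (congrArg ((θ h O.CC).hom.app m) (T_map_comp (truncPairInv h O)
    (truncPair h O) m _).symm).trans ?_
  rw [truncPairInv_truncPair]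
  refine (congrArg ((θ h O.CC).hom.app m) (app_congr ((T K).map_id _) m _)).trans ?_
  exact app_congr (θ h O.CC).inv_hom_id m w.1.1

end Operad

open Operad

variable (h : K ≤ N)

theorem θ_inv_naturality {X Y : GlobSet.{u} N} (f : X ⟶ Y) :
    (truncation h).map ((T N).map f) ≫ (θ h Y).inv =
      (θ h X).inv ≫ (T K).map ((truncation h).map f) := by
  rw [Iso.comp_inv_eq, Category.assoc, θ_naturality, Iso.inv_hom_id_assoc]

section

variable {O : OperadData (T.{u} N)} {D : Operad (T.{u} K)} {c : (truncation h).obj O.C ⟶ D.C}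

/-- The laws are not yet known for `O`; they hold after truncation and composition with a
homomorphism `c` into the operad `D`. -/
theorem trunc_unitLeft_eq
    (hc : OperadData.IsHom (O := truncData h O) (P := D.toOperadData) c) :
    (truncation h).map (O.unitLeft ≫ O.comp) ≫ c = (truncation h).map (𝟙 _) ≫ c := by
  refine globSet_hom_ext fun m x => ?_
  exact (congrArg (fun y => c.app m (O.comp.app ((incl h).obj m) y))
    (app_congr (trunc_unitLeft h O) m x)).symm.trans (app_congr hc.unitLeft_eq m x)

theorem trunc_unitRight_eq
    (hc : OperadData.IsHom (O := truncData h O) (P := D.toOperadData) c) :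
    (truncation h).map (O.unitRight ≫ O.comp) ≫ c = (truncation h).map (𝟙 _) ≫ c := by
  refine globSet_hom_ext fun m x => ?_
  exact (congrArg (fun y => c.app m (O.comp.app ((incl h).obj m) y))
    (app_congr (trunc_unitRight h O) m x)).symm.trans (app_congr hc.unitRight_eq m x)

theorem trunc_assoc_eq
    (hc : OperadData.IsHom (O := truncData h O) (P := D.toOperadData) c) :
    (truncation h).map (O.assocLeft ≫ O.comp) ≫ c =
      (truncation h).map (O.assocRight ≫ O.comp) ≫ c := by
  refine globSet_hom_ext fun m w => ?_
  -- Associativity for the truncated data is stated on its own ternary composites, so the cell must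
  -- first be lifted along the surjection `truncTriple`.
  obtain ⟨v, rfl⟩ : ∃ v, (truncTriple h O).app m v = w :=
    ⟨_, app_congr (truncTripleInv_truncTriple h O) m w⟩
  have h1 := congrArg (fun y => c.app m (O.comp.app ((incl h).obj m) y))
    (app_congr (trunc_assocLeft h O) m v)
  have h2 := congrArg (fun y => c.app m (O.comp.app ((incl h).obj m) y))
    (app_congr (trunc_assocRight h O) m v)
  exact h1.symm.trans ((app_congr hc.assoc_eq m v).trans h2)

end

section Coind

variable (D : Operad (T.{u} K))

/-- Sends a truncated composable pair of the coinduced collection to the pair of its images in `D`;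
composing that pair in `D` gives the `D`-component of the composition. No operad data on `coind` is
needed to state it. -/
def coindPair : (truncation h).obj (pb ((T N).map (toOne (coind h D.arity)))
    (coindArity h D.arity)) ⟶ D.CC :=
  pbLift ((truncation h).map (pbFst _ _) ≫ (θ h _).inv ≫ (T K).map (coindCounit h D.arity))
    ((truncation h).map (pbSnd _ _) ≫ coindCounit h D.arity) (by
    rw [Category.assoc, Category.assoc, Category.assoc, ← (T K).map_comp,
      toOne_unique (coindCounit h D.arity ≫ toOne D.C) (toOne _), coindCounit_arity]
    refine globSet_hom_ext fun m w => ?_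
    apply (bijective_of_isIso (θ h (one N)).hom m).1
    refine (θ_nat h (toOne _) m _).trans ?_
    refine (congrArg (((T N).map (toOne _)).app ((incl h).obj m))
      (app_congr (θ h _).inv_hom_id m _)).trans ?_
    exact w.2.trans (baseInv_θ h _).symm)

/-- The condition under which `coindLift` yields a composition. It holds because `θ` is compatible
with the multiplications of the two monads, so arities of composites computed in `T_K` and in `T_N`
correspond. -/
theorem coindPair_comp_arity : (coindPair h D ≫ D.comp) ≫ D.arity =
    (truncation h).map (pbFst _ _ ≫ (T N).map (coindArity h D.arity) ≫ (T N).μ.app (one N)) ≫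
      baseInv h := by
  have h1 : coindPair h D ≫ pbFst _ _ =
    (truncation h).map (pbFst _ _) ≫ (θ h _).inv ≫ (T K).map (coindCounit h D.arity) := rfl
  rw [Category.assoc, D.comp_arity, ← Category.assoc, h1, Category.assoc, Category.assoc,
    ← (T K).map_comp_assoc, coindCounit_arity, (T K).map_comp, Category.assoc]
  have h2 := θ_μ_inv h (one.{u} N)
  have h3 := θ_inv_naturality h (coindArity h D.arity)
  refine (congrArg (fun k => (truncation h).map (pbFst _ _) ≫ (θ h _).inv ≫
    (T K).map ((truncation h).map (coindArity h D.arity)) ≫ k) h2.symm).trans ?_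
  -- Naturality of the inverse of `θ` at the arity map, whiskered so that the adjacent `θ` and its
  -- inverse cancel afterwards.
  have h4 := congrArg (fun k => (truncation h).map (pbFst ((T N).map (toOne _))
    (coindArity h D.arity)) ≫ k ≫ (θ h _).hom ≫
    (truncation h).map ((T N).μ.app (one N)) ≫ baseInv h) h3.symm
  simp only [Category.assoc] at h4
  refine h4.trans ?_
  rw [Iso.inv_hom_id_assoc]
  rfl

theorem coindIds_arity :
    D.ids ≫ D.arity = (truncation h).map ((T N).η.app (one N)) ≫ baseInv h := by
  rw [D.ids_arity]
  exact ((Iso.comp_inv_eq _).mpr (η_θ h (one N)).symm).symm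

/-- The only structure for which the arity and the counit are both homomorphisms. -/
def coindData : OperadData (T.{u} N) where
  C := coind h D.arity
  arity := coindArity h D.arity
  ids := coindLift h (a := D.arity) ((T N).η.app (one N)) D.ids (coindIds_arity h D)
  comp := coindLift h (a := D.arity)
    (pbFst _ _ ≫ (T N).map (coindArity h D.arity) ≫ (T N).μ.app (one N))
    (coindPair h D ≫ D.comp) (coindPair_comp_arity h D)
  ids_arity := rfl
  comp_arity := rfl

theorem coindData_ids :
    (truncation h).map (coindData h D).ids ≫ coindCounit h D.arity = D.ids :=
  coindLift_counit h (a := D.arity) ((T N).η.app (one N)) D.ids (coindIds_arity h D)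

theorem coindData_comp :
    (truncation h).map (coindData h D).comp ≫ coindCounit h D.arity = coindPair h D ≫ D.comp :=
  coindLift_counit h (a := D.arity) _ _ (coindPair_comp_arity h D)

theorem coindCounit_isHom :
    OperadData.IsHom (O := truncData h (coindData h D)) (P := D.toOperadData)
      (coindCounit h D.arity) where
  arity := coindCounit_arity h D.arity
  ids := coindData_ids h D
  comp := by
    have h1 : truncPair h (coindData h D) ≫ coindPair h D =
        OperadData.map₂ (O := truncData h (coindData h D)) (P := D.toOperadData)
          (coindCounit h D.arity) (coindCounit_arity h D.arity) := by
      refine globSet_hom_ext fun m w => Subtype.ext (Prod.ext ?_ rfl)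
      exact congrArg (((T K).map (coindCounit h D.arity)).app m)
        (app_congr (θ h _).hom_inv_id m w.1.1)
    refine (congrArg (truncPair h (coindData h D) ≫ ·) (coindData_comp h D)).trans ?_
    exact congrArg (· ≫ D.comp) h1

/-- The operad structure on the change of base, making the counit a map of operads. -/
def coindOperad : Operad (T.{u} N) where
  toOperadData := coindData h D
  -- Each law is checked in the terminal operad through the arity, and in `D` through the counit.
  unit_left := coind_hom_ext h D.arity
    (OperadData.IsHom.unitLeft_eq (P := top (T N)) (isHom_arity (coindData h D)))
    (trunc_unitLeft_eq h (coindCounit_isHom h D))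
  unit_right := coind_hom_ext h D.arity
    (OperadData.IsHom.unitRight_eq (P := top (T N)) (isHom_arity (coindData h D)))
    (trunc_unitRight_eq h (coindCounit_isHom h D))
  assoc := coind_hom_ext h D.arity
    (OperadData.IsHom.assoc_eq (P := top (T N)) (isHom_arity (coindData h D)))
    (trunc_assoc_eq h (coindCounit_isHom h D))

def coindCounitHom : (Operad.trunc h).obj (coindOperad h D) ⟶ D :=
  homOfIsHom (coindCounit_isHom h D)

variable {D}

/-- Maps of operads preserve arities, so one of the two conditions of `coind_hom_ext` comes for
free. -/
theorem coindHom_ext {P : Operad (T.{u} N)} {f g : P ⟶ coindOperad h D}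
    (e : (Operad.trunc h).map f ≫ coindCounitHom h D = (Operad.trunc h).map g ≫ coindCounitHom h D) :
    f = g :=
  Operad.hom_ext (coind_hom_ext h D.arity (f.map_arity.trans g.map_arity.symm)
    (congrArg Operad.Hom.map e))

theorem coindLift_isHom {P : OperadData (T.{u} N)} {f : (truncation h).obj P.C ⟶ D.C}
    (hf : OperadData.IsHom (O := truncData h P) (P := D.toOperadData) f) :
    OperadData.IsHom (O := P) (P := coindData h D) (coindLift h P.arity f hf.arity) := by
  have ha : coindLift h P.arity f hf.arity ≫ (coindData h D).arity = P.arity := rfl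
  have hc := coindLift_counit h P.arity f hf.arity
  refine ⟨ha, ?_, ?_⟩
  · refine coind_hom_ext h D.arity P.ids_arity ?_
    refine (congrArg ((truncation h).map P.ids ≫ ·) hc).trans ?_
    exact hf.ids.trans (coindData_ids h D).symm
  · refine coind_hom_ext h D.arity (OperadData.comp_map_arity ha) ?_
    refine globSet_hom_ext fun m w => ?_
    -- By surjectivity of `truncPair` it suffices to test pairs coming from `RP ∘ RP`, to which
    -- `hf.comp` applies.
    obtain ⟨v, rfl⟩ : ∃ v, (truncPair h P).app m v = w :=
      ⟨_, app_congr (truncPairInv_truncPair h P) m w⟩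
    refine (app_congr hc m _).trans ((app_congr hf.comp m v).trans ?_)
    refine Eq.trans ?_ (app_congr (coindData_comp h D) m _).symm
    refine congrArg (D.comp.app m) (Subtype.ext (Prod.ext ?_ ?_))
    · change ((T K).map f).app m v.1.1 = ((T K).map (coindCounit h D.arity)).app m
        ((θ h _).inv.app m (((T N).map (coindLift h P.arity f hf.arity)).app ((incl h).obj m)
          ((θ h P.C).hom.app m v.1.1)))
      have h4 := app_congr (θ_inv_naturality h (coindLift h P.arity f hf.arity)) m
        ((θ h P.C).hom.app m v.1.1)
      refine Eq.trans ?_ (congrArg (((T K).map (coindCounit h D.arity)).app m) h4).symm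
      refine Eq.trans ?_ (congrArg (fun y => ((T K).map (coindCounit h D.arity)).app m
        (((T K).map ((truncation h).map (coindLift h P.arity f hf.arity))).app m y))
        (app_congr (θ h P.C).hom_inv_id m v.1.1)).symm
      refine Eq.trans ?_ (T_map_comp ((truncation h).map (coindLift h P.arity f hf.arity))
        (coindCounit h D.arity) m v.1.1)
      rw [hc]
    · exact (app_congr hc m v.1.2).symm

/-- The transpose of a map of operads. -/
def coindHom {P : Operad (T.{u} N)} (f : (Operad.trunc h).obj P ⟶ D) : P ⟶ coindOperad h D :=
  homOfIsHom (O := P) (P := coindOperad h D) (coindLift_isHom h (Operad.Hom.isHom f))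

theorem coindHom_counit {P : Operad (T.{u} N)} (f : (Operad.trunc h).obj P ⟶ D) :
    (Operad.trunc h).map (coindHom h f) ≫ coindCounitHom h D = f :=
  Operad.hom_ext (coindLift_counit h P.arity f.map f.map_arity)

end Coind

end

end GlobOp

/-! ### The coinduced precontraction and the adjunction on `OWP` -/

namespace GlobOp

open Glb

variable {N K : ℕ∞}

noncomputable section

variable (h : K ≤ N)

/-- Parallel pairs of operations of `C` as parallel pairs of operations of its truncation. -/
def untruncP (O : Operad (T.{u} N)) {p m : Glb K} (l : p < m)
    {π : ((T N).obj (one N)).obj ((incl h).obj m)}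
    (x : O.P (p := (incl h).obj p) (m := (incl h).obj m) l π) :
    ((Operad.trunc h).obj O).P l ((baseInv h).app m π) where
  src := ⟨x.src.1, (congrArg ((baseInv h).app p) x.src.2).trans (face_app (baseInv h) .src l π)⟩
  tgt := ⟨x.tgt.1, (congrArg ((baseInv h).app p) x.tgt.2).trans (face_app (baseInv h) .tgt l π)⟩
  parallel ε q hq e := x.parallel ε (q := (incl h).obj q) hq e

variable (D : OWP.{u} K)

/-- One statement for both ranges of dimension: the boundary clause determines the filler above `K`,
and the clause on the counit determines it up to `K`. The precontraction can thus be chosen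
uniformly. -/
theorem exists_coind_κ {p m : Glb N} (l : p < m) (e : p.dim + 1 = m.dim)
    (π : ((T N).obj (one N)).obj m) (x : (coindOperad h D.operad).P l π) :
    ∃ y : (coindOperad h D.operad).Fib π,
      (∀ ε, face (coind h D.operad.arity) ε l y.1 = Side.rec x.src.1 x.tgt.1 ε) ∧
      ∀ hm : (m.dim : ℕ∞) ≤ K, (coindCounit h D.operad.arity).app ⟨m.dim, hm⟩ y.1 =
        (D.κ (p := ⟨p.dim, Free.dim_le l hm⟩) (m := ⟨m.dim, hm⟩) l e _
          (Operad.mapP (coindCounitHom h D.operad)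
            (untruncP h (p := ⟨p.dim, Free.dim_le l hm⟩) (m := ⟨m.dim, hm⟩) _ l x))).1 := by
  by_cases hm : (m.dim : ℕ∞) ≤ K
  · let m' : Glb K := ⟨m.dim, hm⟩
    let p' : Glb K := ⟨p.dim, Free.dim_le l hm⟩
    -- Up to dimension `K` the pair is moved to `D`, filled there, and the filler is pulled back
    -- along the bijective counit; its boundary is checked after applying the counit.
    let x' := Operad.mapP (coindCounitHom h D.operad) (untruncP h (p := p') (m := m') _ l x)
    obtain ⟨y, hy⟩ := (coindCounit_bijective h D.operad.arity m').2
      (D.κ (p := p') (m := m') l e _ x').1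
    have hyπ : (coindArity h D.operad.arity).app m y = π := by
      apply baseInv_injective h m'
      refine (app_congr (coindCounit_arity h D.operad.arity) m' y).symm.trans ?_
      exact (congrArg (D.operad.arity.app m') hy).trans (D.κ (p := p') (m := m') l e _ x').2
    refine ⟨⟨y, hyπ⟩, fun ε => ?_, fun _ => hy⟩
    apply (coindCounit_bijective h D.operad.arity p').1
    refine (face_app (coindCounit h D.operad.arity) ε (m := m') (p := p') l y).trans ?_
    refine (congrArg (face D.operad.C ε (m := m') (p := p') l) hy).trans ?_
    cases ε
    · exact D.src_κ (p := p') (m := m') l e _ x'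
    · exact D.tgt_κ (p := p') (m := m') l e _ x'
  · obtain ⟨y, hy, hy'⟩ := exists_coind_of_face h l e hm π
      (fun ε => Side.rec x.src.1 x.tgt.1 ε) (by rintro (_ | _); exacts [x.src.2, x.tgt.2])
      (fun ε _ hq => face_eq_of_parallel (X := coind h D.operad.arity) x.parallel ε hq)
    exact ⟨⟨y, hy⟩, hy', fun hm' => (hm hm').elim⟩

/-- The operad with precontraction coinduced along truncation. -/
def coindObj : OWP.{u} N where
  operad := coindOperad h D.operad
  κ l e π x := (exists_coind_κ h D l e π x).choose
  src_κ l e π x := (exists_coind_κ h D l e π x).choose_spec.1 .src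
  tgt_κ l e π x := (exists_coind_κ h D l e π x).choose_spec.1 .tgt

theorem coindCounit_κ {p m : Glb K} (l : p < m) (e : p.dim + 1 = m.dim)
    (π : ((T N).obj (one N)).obj ((incl h).obj m))
    (x : (coindOperad h D.operad).P (p := (incl h).obj p) (m := (incl h).obj m) l π) :
    (coindCounit h D.operad.arity).app m
      ((coindObj h D).κ (p := (incl h).obj p) (m := (incl h).obj m) l e π x).1 =
      (D.κ l e _ (Operad.mapP (coindCounitHom h D.operad) (untruncP h _ l x))).1 :=
  (exists_coind_κ h D (p := (incl h).obj p) (m := (incl h).obj m) l e π x).choose_spec.2 m.le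

def coindObjCounit : (OWP.trunc h).obj (coindObj h D) ⟶ D :=
  ({map := coindCounitHom h D.operad
    map_κ := fun l e π x => Subtype.ext
      ((coindCounit_κ h D l e _ (OWP.truncP h (coindOperad h D.operad) l π x)).trans
        (OWP.κ_congr D (θ_baseInv h π) _ (Operad.mapP (coindCounitHom h D.operad) x) rfl rfl)) } :
    OWP.Hom ((OWP.trunc h).obj (coindObj h D)) D)

variable {D}

/-- Above dimension `K` fillers are unique. This is why transposed maps preserve `κ`, why the
coinduced operad is a contraction, and why the unit hits every top cell. -/
theorem coind_κ_unique {p m : Glb N} (l : p < m) (e : p.dim + 1 = m.dim)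
    (hm : ¬ (m.dim : ℕ∞) ≤ K) {π : ((T N).obj (one N)).obj m}
    (x y : (coindOperad h D.operad).Fib π)
    (hs : face (coindOperad h D.operad).C .src l x.1 = face (coindOperad h D.operad).C .src l y.1)
    (ht : face (coindOperad h D.operad).C .tgt l x.1 = face (coindOperad h D.operad).C .tgt l y.1) :
    x = y :=
  Subtype.ext (coind_ext_of_face h l e hm (x.2.trans y.2.symm)
    (by rintro (_ | _); exacts [hs, ht]))

/-- The transpose of a map of operads with precontraction. -/
def coindObjHom {C : OWP.{u} N} (f : (OWP.trunc h).obj C ⟶ D) : C ⟶ coindObj h D :=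
  (⟨coindHom h f.map, fun {p m} l e π x => by
    have hg : ∀ (q : Glb K) (z : C.operad.C.obj ((incl h).obj q)),
        (coindCounit h D.operad.arity).app q ((coindHom h f.map).map.app ((incl h).obj q) z) =
          f.map.map.app q z :=
      fun q z => app_congr (congrArg Operad.Hom.map (coindHom_counit h f.map)) q z
    by_cases hm : (m.dim : ℕ∞) ≤ K
    -- Up to dimension `K` the equation is checked after the injective counit, where it says that
    -- `f` preserves `κ`.
    · let m' : Glb K := ⟨m.dim, hm⟩
      let p' : Glb K := ⟨p.dim, Free.dim_le l hm⟩
      refine Subtype.ext ((coindCounit_bijective h D.operad.arity m').1 ?_)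
      refine (hg m' _).trans ?_
      refine Eq.trans ?_ (coindCounit_κ h D (p := p') (m := m') l e π
        (Operad.mapP (coindHom h f.map) x)).symm
      have h1 := congrArg Subtype.val
        (f.map_κ (p := p') (m := m') l e _ (untruncP h (p := p') (m := m') C.operad l x))
      refine (congrArg (f.map.map.app m') ?_).trans (h1.trans ?_)
      · exact OWP.κ_congr C (baseInv_θ h (m := m') π).symm x _ rfl rfl
      · exact OWP.κ_congr D rfl _ _ (hg p' x.src.1).symm (hg p' x.tgt.1).symm
    -- Above `K` both sides have the arity `π`, so only their sources and targets have to be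
    -- compared.
    · refine coind_κ_unique h l e hm _ _ ?_ ?_
      · refine Eq.trans ?_ ((coindObj h D).src_κ l e π _).symm
        exact (face_app (coindHom h f.map).map _ l _).symm.trans
          (congrArg ((coindHom h f.map).map.app p) (C.src_κ l e π x))
      · refine Eq.trans ?_ ((coindObj h D).tgt_κ l e π _).symm
        exact (face_app (coindHom h f.map).map _ l _).symm.trans
          (congrArg ((coindHom h f.map).map.app p) (C.tgt_κ l e π x))⟩ : OWP.Hom _ _)

def coindObjEquiv (C : OWP.{u} N) (D : OWP.{u} K) :
    ((OWP.trunc h).obj C ⟶ D) ≃ (C ⟶ coindObj h D) where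
  toFun f := coindObjHom h f
  invFun g := (OWP.trunc h).map g ≫ coindObjCounit h D
  left_inv f := OWP.hom_ext (coindHom_counit h f.map)
  right_inv g := OWP.hom_ext (coindHom_ext h
    (coindHom_counit h ((OWP.trunc h).map g ≫ coindObjCounit h D).map))

theorem coindObjEquiv_symm_naturality {C' C : OWP.{u} N} {D : OWP.{u} K} (k : C' ⟶ C)
    (g : C ⟶ coindObj h D) : (coindObjEquiv h C' D).symm (k ≫ g) =
      (OWP.trunc h).map k ≫ (coindObjEquiv h C D).symm g := by
  change (OWP.trunc h).map (k ≫ g) ≫ _ = _ ≫ (OWP.trunc h).map g ≫ _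
  rw [Functor.map_comp, Category.assoc]

theorem coindObjEquiv_naturality {C' C : OWP.{u} N} {D : OWP.{u} K} (k : C' ⟶ C)
    (f : (OWP.trunc h).obj C ⟶ D) : coindObjEquiv h C' D ((OWP.trunc h).map k ≫ f) =
      k ≫ coindObjEquiv h C D f := by
  rw [← Equiv.eq_symm_apply, coindObjEquiv_symm_naturality, Equiv.symm_apply_apply]

/-- The right adjoint of truncation of operads with precontraction. -/
def coindFunctor : OWP.{u} K ⥤ OWP.{u} N :=
  Adjunction.rightAdjointOfEquiv (F := OWP.trunc h) (coindObjEquiv h)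
    (fun _ _ _ k f => coindObjEquiv_naturality h k f)

def coindAdj : OWP.trunc.{u} h ⊣ coindFunctor h :=
  Adjunction.adjunctionOfEquivRight _ _

theorem coindAdj_counit (D : OWP.{u} K) : (coindAdj h).counit.app D = coindObjCounit h D := by
  change (coindObjEquiv h (coindObj h D) D).symm (𝟙 _) = _
  change (OWP.trunc h).map (𝟙 _) ≫ _ = _
  rw [CategoryTheory.Functor.map_id, Category.id_comp]

theorem isPullback_pb {X Y Z : GlobSet.{u} N} (f : X ⟶ Z) (g : Y ⟶ Z) :
    IsPullback (pbFst f g) (pbSnd f g) f g :=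
  ⟨⟨pb_condition f g⟩, ⟨Limits.PullbackCone.IsLimit.mk _
    (fun s => pbLift s.fst s.snd s.condition) (fun _ => rfl) (fun _ => rfl)
    (fun _ _ h₁ h₂ => pb_hom_ext h₁ h₂)⟩⟩

/-- The counit was defined as the transpose of the first pullback projection, so transposing it back
gives that projection and the required square is the defining pullback. -/
theorem coindAdj_isInduced : IsInduced (coskeletonAdj.{u} h) (coindAdj h) := by
  intro D
  have h1 : comparison (coskeletonAdj h) (coindAdj h) D = pbFst ((coskeleton h).map D.operad.arity)
      (coskeletonEquiv h _ _ (baseInv h)) := by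
    rw [comparison, coindAdj_counit, coskeletonAdj_homEquiv]
    exact (coskeletonEquiv h _ _).apply_symm_apply _
  rw [h1, changeOfBase_eq]
  exact isPullback_pb _ _

theorem isIso_coindObjCounit (D : OWP.{u} K) : IsIso (coindObjCounit h D) :=
  OWP.isIso_of_bijective _ (coindCounit_bijective h D.operad.arity)

end

end GlobOp

/-! ### Contractions and the equivalence -/

namespace GlobOp

open Glb

variable {N K : ℕ∞}

noncomputable section

theorem coindObj_isContraction {h : K ≤ N} (hKN : K < N) (D : OWP.{u} K) :
    (coindObj h D).IsContraction := fun l e hm _ x y hs ht =>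
  coind_κ_unique h l e (by rw [hm]; exact not_le.mpr hKN) x y hs ht

theorem coindAdj_unit (h : K ≤ N) (C : OWP.{u} N) :
    (coindAdj h).unit.app C = coindObjHom h (𝟙 _) := rfl

/-- By a triangle identity the unit, followed by the bijective counit, is the identity in these
dimensions. -/
theorem coindUnit_bijective_of_le (h : K ≤ N) (C : OWP.{u} N) (m : Glb K) :
    Function.Bijective ((coindObjHom h (𝟙 ((OWP.trunc h).obj C))).map.map.app
      ((incl h).obj m)) := by
  refine (Function.Bijective.of_comp_iff'
    (coindCounit_bijective h (Operad.truncArity h C.operad.toOperadData) m) _).mp ?_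
  have h1 : ∀ x, ((coindCounit h (Operad.truncArity h C.operad.toOperadData)).app m ∘
      (coindObjHom h (𝟙 ((OWP.trunc h).obj C))).map.map.app ((incl h).obj m)) x = x :=
    fun x => app_congr (congrArg Operad.Hom.map (coindHom_counit h
      (𝟙 ((Operad.trunc h).obj C.operad)))) m x
  rw [show _ = id from funext h1]
  exact Function.bijective_id

/-- Only the dimension `n + 1` lies above the truncation, so the boundary of a new cell lies where
the unit is already bijective. There the contraction condition on `C` gives injectivity and the
precontraction gives surjectivity. -/
theorem coindUnit_bijective {n : ℕ} (h : (n : ℕ∞) ≤ ((n + 1 : ℕ) : ℕ∞))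
    {C : OWP.{u} (n + 1 : ℕ)} (hC : C.IsContraction) (m : Glb ((n + 1 : ℕ) : ℕ∞)) :
    Function.Bijective ((coindObjHom h (𝟙 ((OWP.trunc h).obj C))).map.map.app m) := by
  set g := coindObjHom h (𝟙 ((OWP.trunc h).obj C)) with hg
  by_cases hm : (m.dim : ℕ∞) ≤ n
  · exact coindUnit_bijective_of_le h C ⟨m.dim, hm⟩
  · have hlow : ∀ q : Glb ((n + 1 : ℕ) : ℕ∞), q < m → Function.Bijective (g.map.map.app q) := by
      intro q hq
      have h1 : q.dim < m.dim := hq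
      have h2 := Nat.cast_le.mp m.le
      exact coindUnit_bijective_of_le h C ⟨q.dim, Nat.cast_le.mpr (by omega)⟩
    have hmn : m.dim = n + 1 :=
      le_antisymm (Nat.cast_le.mp m.le) (Nat.lt_of_not_le fun hle => hm (Nat.cast_le.mpr hle))
    let p : Glb ((n + 1 : ℕ) : ℕ∞) := ⟨n, h⟩
    have l : p < m := by
      change n < m.dim
      omega
    have e : p.dim + 1 = m.dim := hmn.symm
    have harity : ∀ q x, (coindObj h ((OWP.trunc h).obj C)).operad.arity.app q (g.map.map.app q x) =
        C.operad.arity.app q x := fun q x => app_congr g.map.map_arity q x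
    constructor
    · intro x y hxy
      have hf : ∀ ε, face C.operad.C ε l x = face C.operad.C ε l y := fun ε => by
        apply (hlow p l).1
        exact (face_app g.map.map ε l x).trans ((congrArg (face _ ε l) hxy).trans
          (face_app g.map.map ε l y).symm)
      have hπ : C.operad.arity.app m x = C.operad.arity.app m y :=
        (harity m x).symm.trans ((congrArg _ hxy).trans (harity m y))
      exact congrArg Subtype.val (hC l e (by rw [hmn]) _ ⟨x, hπ⟩ ⟨y, rfl⟩ (hf _) (hf _))
    · intro z
      have hex : ∀ ε, ∃ x, g.map.map.app p x = face _ ε l z := fun ε => (hlow p l).2 _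
      -- The two faces of `z` are lifted to `C`; `κ` fills the lifted pair over the arity of `z`,
      -- and the image of the filler has the boundary and arity of `z`, hence equals `z`.
      choose θ hθ using hex
      have hθa : ∀ ε, C.operad.arity.app p (θ ε) = face _ ε l
          ((coindObj h ((OWP.trunc h).obj C)).operad.arity.app m z) := fun ε =>
        (harity p (θ ε)).symm.trans ((congrArg _ (hθ ε)).trans (face_app _ ε l z))
      let x : C.operad.P l ((coindObj h ((OWP.trunc h).obj C)).operad.arity.app m z) :=
        { src := ⟨θ .src, hθa .src⟩
          tgt := ⟨θ .tgt, hθa .tgt⟩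
          -- The faces of `z` are parallel, and injectivity of the unit below `p` carries this back
          -- to the lifts.
          parallel := fun ε q hq _ => by
            apply (hlow q (lt_trans' hq l)).1
            refine (face_app g.map.map ε hq _).trans (Eq.trans ?_ (face_app g.map.map ε hq _).symm)
            rw [hθ, hθ, face_face, face_face] }
      refine ⟨(C.κ l e _ x).1, ?_⟩
      have hy := coind_κ_unique h (D := (OWP.trunc h).obj C) l e hm
        (Operad.mapFib g.map (C.κ l e _ x)) ⟨z, rfl⟩ ?_ ?_
      · exact congrArg Subtype.val hy
      · exact (face_app g.map.map _ l _).symm.trans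
          ((congrArg (g.map.map.app p) (C.src_κ l e _ x)).trans (hθ .src))
      · exact (face_app g.map.map _ l _).symm.trans
          ((congrArg (g.map.map.app p) (C.tgt_κ l e _ x)).trans (hθ .tgt))

instance isIso_coindAdj_counit (h : K ≤ N) (D : OWP.{u} K) :
    IsIso ((coindAdj h).counit.app D) := by
  rw [coindAdj_counit]
  exact isIso_coindObjCounit h D

theorem isIso_coindAdj_unit {n : ℕ} (h : (n : ℕ∞) ≤ ((n + 1 : ℕ) : ℕ∞))
    {C : OWP.{u} (n + 1 : ℕ)} (hC : C.IsContraction) : IsIso ((coindAdj h).unit.app C) :=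
  OWP.isIso_of_bijective _ (coindUnit_bijective h hC)

/-- The adjunction with values in operads with contraction. -/
def contractionAdj (h : K ≤ N) (hS : ∀ D : OWP.{u} K, contractions.{u} N ((coindFunctor h).obj D)) :
    (contractions.{u} N).ι ⋙ OWP.trunc.{u} h ⊣ (contractions.{u} N).lift (coindFunctor h) hS :=
  (coindAdj h).restrictFullyFaithful (contractions.{u} N).fullyFaithfulι
    (Functor.FullyFaithful.id _) (Iso.refl _) (Iso.refl _)

instance isIso_contractionAdj_counit (h : K ≤ N)
    (hS : ∀ D : OWP.{u} K, contractions.{u} N ((coindFunctor h).obj D)) (D : OWP.{u} K) :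
    IsIso ((contractionAdj h hS).counit.app D) := by
  have h1 := Adjunction.map_restrictFullyFaithful_counit_app (adj := coindAdj.{u} h)
    (contractions.{u} N).fullyFaithfulι (Functor.FullyFaithful.id (OWP.{u} K))
    (L := (contractions.{u} N).ι ⋙ OWP.trunc.{u} h)
    (R := (contractions.{u} N).lift (coindFunctor h) hS) (Iso.refl _) (Iso.refl _) D
  change (contractionAdj h hS).counit.app D = _ at h1
  rw [h1]
  change IsIso (𝟙 _ ≫ (OWP.trunc h).map (𝟙 _) ≫ (coindAdj h).counit.app D)
  infer_instance

theorem isIso_contractionAdj_unit {n : ℕ} (h : (n : ℕ∞) ≤ ((n + 1 : ℕ) : ℕ∞))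
    (hS : ∀ D : OWP.{u} n, contractions.{u} (n + 1 : ℕ) ((coindFunctor h).obj D))
    (C : OWC.{u} (n + 1 : ℕ)) : IsIso ((contractionAdj h hS).unit.app C) := by
  have h1 := Adjunction.map_restrictFullyFaithful_unit_app (adj := coindAdj.{u} h)
    (contractions.{u} (n + 1 : ℕ)).fullyFaithfulι (Functor.FullyFaithful.id (OWP.{u} n))
    (L := (contractions.{u} (n + 1 : ℕ)).ι ⋙ OWP.trunc.{u} h)
    (R := (contractions.{u} (n + 1 : ℕ)).lift (coindFunctor h) hS) (Iso.refl _) (Iso.refl _) C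
  -- The inclusion of the full subcategory turns this unit into the unit of the adjunction on `OWP`,
  -- and reflects isomorphisms.
  change (contractions.{u} (n + 1 : ℕ)).ι.map ((contractionAdj h hS).unit.app C) = _ at h1
  have := isIso_coindAdj_unit h (C := (contractions.{u} (n + 1 : ℕ)).ι.obj C) C.property
  have h2 : IsIso ((contractions.{u} (n + 1 : ℕ)).ι.map ((contractionAdj h hS).unit.app C)) := by
    rw [h1]
    simp only [Iso.refl_hom]
    infer_instance
  exact isIso_of_reflects_iso _ (contractions.{u} (n + 1 : ℕ)).ι

/-- Operads with contraction in dimension `n + 1` are operads with precontraction in dimension `n`. -/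
def contractionEquivalence {n : ℕ} (h : (n : ℕ∞) ≤ ((n + 1 : ℕ) : ℕ∞))
    (hS : ∀ D : OWP.{u} n, contractions.{u} (n + 1 : ℕ) ((coindFunctor h).obj D)) :
    OWC.{u} (n + 1 : ℕ) ≌ OWP.{u} n :=
  have := isIso_contractionAdj_unit h hS
  (contractionAdj h hS).toEquivalence

theorem contractions_top (C : OWP.{u} ⊤) : contractions.{u} ⊤ C :=
  fun {_ m} _ _ hm => (ENat.natCast_ne_top m.dim hm).elim

/-- The coinduced truncation of an initial object is initial. -/
theorem isInitial_coind_trunc {n : ℕ} (h : (n : ℕ∞) ≤ ((n + 1 : ℕ) : ℕ∞))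
    (hS : ∀ D : OWP.{u} n, contractions.{u} (n + 1 : ℕ) ((coindFunctor h).obj D))
    (L : OWC.{u} ⊤) (hL : Limits.IsInitial L) :
    Nonempty (Limits.IsInitial (((contractions.{u} (n + 1 : ℕ)).lift (coindFunctor h) hS).obj
      ((OWP.trunc.{u} (le_top : (n : ℕ∞) ≤ ⊤)).obj L.obj))) := by
  -- At level `ω` every object is a contraction, so truncation from `OWC` has a right adjoint and
  -- preserves initial objects.
  have := (contractionAdj.{u} (le_top : (n : ℕ∞) ≤ ⊤) fun _ => contractions_top _).isLeftAdjoint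
  have h1 := hL.isInitialObj ((contractions.{u} ⊤).ι ⋙ OWP.trunc.{u} (le_top : (n : ℕ∞) ≤ ⊤)) L
  exact ⟨h1.isInitialObj (contractionEquivalence h hS).inverse _⟩

end

end GlobOp

/-! ### Formal expressions and their evaluation -/

namespace GlobOp

open Glb

variable {N : ℕ∞}

/-- The two kinds of formal expressions: operations, and pasting diagrams of operations. -/
inductive Kind : Type
  | op
  | past

/-- Formal operations built from identities, compositions, faces and the precontraction. -/
inductive Term (N : ℕ∞) : Kind → Glb N → Type u
  | ids (m : Glb N) : Term N .op m
  | κ {p m : Glb N} (h : p < m) (e : p.dim + 1 = m.dim) (π : ((T.{u} N).obj (one N)).obj m)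
      (a b : Term N .op p) : Term N .op m
  | comp {m : Glb N} (t : Term N .past m) (a : Term N .op m) : Term N .op m
  | face (ε : Side) {m p : Glb N} (h : p < m) (a : Term N .op m) : Term N .op p
  | var {m : Glb N} (a : Term N .op m) : Term N .past m
  | ident {p m : Glb N} (h : p < m) (t : Term N .past p) : Term N .past m
  | pcomp {p m : Glb N} (h : p < m) (t t' : Term N .past m) : Term N .past m

noncomputable section

namespace Term

/-- The values in `C` of formal expressions. -/
abbrev Val (C : OWP.{u} N) : Kind → Glb N → Type u
  | .op, m => C.operad.C.obj m
  | .past, m => ((free N).obj C.operad.C).cells.obj m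

/-- The data from which the precontraction produces an operation. -/
structure IsPair (C : OWP.{u} N) {p m : Glb N} (h : p < m) (π : ((T.{u} N).obj (one N)).obj m)
    (x y : C.operad.C.obj p) : Prop where
  src : C.operad.arity.app p x = GlobOp.face _ .src h π
  tgt : C.operad.arity.app p y = GlobOp.face _ .tgt h π
  parallel : ∀ (ε : Side) {q : Glb N} (hq : q < p), q.dim + 1 = p.dim →
    GlobOp.face C.operad.C ε hq x = GlobOp.face C.operad.C ε hq y

def IsPair.toP {C : OWP.{u} N} {p m : Glb N} {h : p < m} {π : ((T.{u} N).obj (one N)).obj m}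
    {x y : C.operad.C.obj p} (w : IsPair C h π x y) : C.operad.P h π :=
  ⟨⟨x, w.src⟩, ⟨y, w.tgt⟩, w.parallel⟩

open Classical in
/-- Evaluation of formal expressions, with arbitrary values where it is not defined. -/
def ev (C : OWP.{u} N) : {k : Kind} → {m : Glb N} → Term.{u} N k m → Val C k m
  | _, _, .ids m => C.operad.ids.app m PUnit.unit
  | _, m, .κ h e π a b =>
      if w : IsPair C h π (ev C a) (ev C b) then (C.κ h e π w.toP).1
      else C.operad.ids.app m PUnit.unit
  | _, m, .comp t a =>
      if w : ((T N).map (toOne C.operad.C)).app m (ev C t) = C.operad.arity.app m (ev C a) then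
        C.operad.comp.app m ⟨(ev C t, ev C a), w⟩
      else ev C a
  | _, _, .face ε h a => GlobOp.face C.operad.C ε h (ev C a)
  | _, m, .var a => (unit C.operad.C).app m (ev C a)
  | _, _, .ident h t => ((free N).obj C.operad.C).ident h (ev C t)
  | _, _, .pcomp h t t' =>
      if w : GlobOp.face _ .tgt h (ev C t) = GlobOp.face _ .src h (ev C t') then
        ((free N).obj C.operad.C).comp h (ev C t) (ev C t') w
      else ev C t

/-- Expressions that are defined in every operad with precontraction. -/
def Good : {k : Kind} → {m : Glb N} → Term.{u} N k m → Prop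
  | _, _, .ids _ => True
  | _, _, .κ h _ π a b => Good a ∧ Good b ∧ ∀ C : OWP.{u} N, IsPair C h π (ev C a) (ev C b)
  | _, m, .comp t a => Good t ∧ Good a ∧ ∀ C : OWP.{u} N,
      ((T N).map (toOne C.operad.C)).app m (ev C t) = C.operad.arity.app m (ev C a)
  | _, _, .face _ _ a => Good a
  | _, _, .var a => Good a
  | _, _, .ident _ t => Good t
  | _, _, .pcomp h t t' => Good t ∧ Good t' ∧ ∀ C : OWP.{u} N,
      GlobOp.face ((free N).obj C.operad.C).cells .tgt h (ev C t) =
        GlobOp.face ((free N).obj C.operad.C).cells .src h (ev C t')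

/-- The map of values induced by a map of operads with precontraction. -/
def mapVal {C D : OWP.{u} N} (f : C ⟶ D) : {k : Kind} → {m : Glb N} → Val C k m → Val D k m
  | .op, m, x => f.map.map.app m x
  | .past, m, x => ((free N).map f.map.map).map.app m x

/-- `Good` cannot be dropped: an expression undefined in `C` may be defined in `D`, as in the
terminal operad where more cells are parallel, and default values are then not preserved. When both
values are defined, each constructor is preserved by one clause of the definition of a map. -/
theorem mapVal_ev {C D : OWP.{u} N} (f : C ⟶ D) {k : Kind} {m : Glb N} {t : Term.{u} N k m}
    (ht : Good t) : mapVal f (ev C t) = ev D t := by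
  induction t with
  | ids m => exact app_congr f.map.map_ids m _
  | @κ p m h e π a b iha ihb =>
    obtain ⟨ha, hb, hw⟩ := ht
    have h1 := congrArg Subtype.val (f.map_κ h e π (hw C).toP)
    simp only [ev, dif_pos (hw C), dif_pos (hw D)]
    exact h1.trans (OWP.κ_congr D rfl _ _ (iha ha) (ihb hb))
  | @comp m t a iht iha =>
    obtain ⟨ht, ha, hw⟩ := ht
    simp only [ev, dif_pos (hw C), dif_pos (hw D)]
    refine (app_congr f.map.map_comp m _).trans ?_
    exact congrArg (D.operad.comp.app m) (Subtype.ext (Prod.ext (iht ht) (iha ha)))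
  | face ε h a ih =>
    exact (face_app f.map.map ε h _).trans (congrArg _ (ih ht))
  | @var m a ih =>
    exact (app_congr (free_map f.map.map) m _).trans
      (congrArg ((unit D.operad.C).app m) (ih ht))
  | ident h t ih =>
    exact (((free N).map f.map.map).map_ident h _).trans (congrArg _ (ih ht))
  | @pcomp p m h t t' iht iht' =>
    obtain ⟨ht, ht', hw⟩ := ht
    simp only [ev, dif_pos (hw C), dif_pos (hw D)]
    refine (((free N).map f.map.map).map_comp h _ _ _
      (StrictCat.Hom.comp_compat _ h (hw C))).trans ?_
    have h1 := iht ht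
    have h2 := iht' ht'
    change ((free N).map f.map.map).map.app m _ = _ at h1 h2
    congr 1

end Term

end

end GlobOp

/-! ### The term model and its initiality -/

namespace GlobOp

open Glb

variable {N : ℕ∞}

noncomputable section

/-- Induction on the cells of a free strict category. -/
theorem free_ind {X : GlobSet.{u} N} {P : ∀ {m : Glb N}, ((free N).obj X).cells.obj m → Prop}
    (var : ∀ {m : Glb N} (x : X.obj m), P ((unit X).app m x))
    (ident : ∀ {p m : Glb N} (h : p < m) (z : ((free N).obj X).cells.obj p), P z →
      P (((free N).obj X).ident h z))
    (comp : ∀ {p m : Glb N} (h : p < m) (z z' : ((free N).obj X).cells.obj m) (e), P z → P z' →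
      P (((free N).obj X).comp h z z' e))
    {m : Glb N} (z : ((free N).obj X).cells.obj m) : P z := by
  have key : ∀ (m : Glb N) (a : Raw X m), Raw.WF a → ∀ ha : Raw.Eqv a a,
      P (m := m) (Free.mk a ha) := by
    intro m a hw
    induction hw with
    | var x => exact fun _ => var x
    | @ident p m h a _ ih =>
      intro ha
      -- For identities `WF` does not record that `a` is meaningful; this is recovered because `a`
      -- is the `p`-dimensional source of its identity.
      have haa : Raw.Eqv a a := by
        have := ha.bd .src h
        rwa [Raw.bd_ident_eq] at this
      have h1 := ident h _ (ih haa)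
      rwa [show ((free N).obj X).ident h (Free.mk a haa) = Free.mk _ ha from
        Free.ident_mk h a haa] at h1
    | @comp p m h a b _ _ haa hbb e iha ihb =>
      intro ha
      have e' : face (Free.cells X) .tgt h (Free.mk a haa) =
          face (Free.cells X) .src h (Free.mk b hbb) := by
        rw [Free.face_mk, Free.face_mk]
        exact Free.mk_eq.2 e
      have h1 := comp h _ _ e' (iha haa) (ihb hbb)
      rwa [show ((free N).obj X).comp h (Free.mk a haa) (Free.mk b hbb) e' = Free.mk _ ha from
        Free.comp_mk h a b haa hbb e'] at h1
  induction z using Free.ind with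
  | h a ha => exact key m a ha.good.wf ha

namespace OWP

/-- The terminal operad with its precontraction. -/
def top (N : ℕ∞) : OWP.{u} N where
  operad := Operad.top (T N)
  κ _ _ π _ := ⟨π, rfl⟩
  src_κ _ _ _ x := x.src.2.symm
  tgt_κ _ _ _ x := x.tgt.2.symm

def toTop (C : OWP.{u} N) : C ⟶ top N :=
  ({map := Operad.homOfIsHom (P := Operad.top (T N)) (Operad.isHom_arity C.operad.toOperadData)
    map_κ := fun h e π x => Subtype.ext (C.κ h e π x).2 } : Hom C (top N))

end OWP

namespace Term

/-- The quantifier over the large class of operads with precontraction stays inside a proposition,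
so the quotient remains in the universe `u`; no weakly initial family has to be selected. -/
def setoid (m : Glb N) : Setoid {t : Term.{u} N .op m // Good t} where
  r a b := ∀ C : OWP.{u} N, ev C a.1 = ev C b.1
  iseqv := ⟨fun _ _ => rfl, fun h C => (h C).symm, fun h h' C => (h C).trans (h' C)⟩

/-- Formal operations, modulo having the same values everywhere. -/
def cells (N : ℕ∞) : GlobSet.{u} N :=
  mkGlobSet (fun m => Quotient (setoid m))
    (fun ε _ _ h => Quotient.map (fun t => ⟨.face ε h t.1, t.2⟩)
      fun _ _ e C => congrArg (GlobOp.face C.operad.C ε h) (e C))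
    (fun ε ε' _ _ _ h h' x => Quotient.inductionOn x fun _ => Quotient.sound fun C =>
      face_face C.operad.C ε ε' h h' _)

def mk {m : Glb N} (t : Term.{u} N .op m) (ht : Good t) : (cells N).obj m :=
  Quotient.mk (setoid m) ⟨t, ht⟩

theorem exists_mk {m : Glb N} (x : (cells.{u} N).obj m) : ∃ t ht, mk t ht = x :=
  Quotient.inductionOn x fun t => ⟨t.1, t.2, rfl⟩

def evMap (C : OWP.{u} N) : cells N ⟶ C.operad.C :=
  mkGlobMap (fun m => Quotient.lift (s := setoid m) (fun t => ev C t.1) fun _ _ e => e C)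
    fun _ _ _ _ x => Quotient.inductionOn x fun _ => rfl

theorem evMap_mk (C : OWP.{u} N) {m : Glb N} (t : Term.{u} N .op m) (ht : Good t) :
    (evMap C).app m (mk t ht) = ev C t := rfl

/-- Evaluations are jointly injective by the choice of the equivalence relation; every equation in
the term model is proved by evaluating in all `C`. -/
theorem cells_ext {m : Glb N} {x y : (cells.{u} N).obj m}
    (h : ∀ C : OWP.{u} N, (evMap C).app m x = (evMap C).app m y) : x = y := by
  obtain ⟨t, ht, rfl⟩ := exists_mk x
  obtain ⟨t', ht', rfl⟩ := exists_mk y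
  exact Quotient.sound h

theorem cells_hom_ext {X : GlobSet.{u} N} {f g : X ⟶ cells N}
    (h : ∀ C : OWP.{u} N, f ≫ evMap C = g ≫ evMap C) : f = g :=
  globSet_hom_ext fun m x => cells_ext fun C => app_congr (h C) m x

theorem evMap_map {C D : OWP.{u} N} (f : C ⟶ D) : evMap C ≫ f.map.map = evMap D := by
  refine globSet_hom_ext fun m x => ?_
  obtain ⟨t, ht, rfl⟩ := exists_mk x
  exact mapVal_ev f ht

/-- The arity of an expression is its value in the terminal operad, since the arity map of `C` is a
map of operads with precontraction into it. -/
theorem evMap_arity (C : OWP.{u} N) : evMap C ≫ C.operad.arity = evMap (OWP.top N) :=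
  evMap_map (OWP.toTop C)

section Lift

variable {X : GlobSet.{u} N} {φ : ∀ C : OWP.{u} N, X ⟶ C.operad.C}
  (H : ∀ (m : Glb N) (x : X.obj m), ∃ l, ∀ C, (evMap C).app m l = (φ C).app m x)

/-- A family of maps `X → C` factors through the term model as soon as each single cell of `X` has
an expression with the prescribed values. Naturality of the chosen classes then follows from joint
injectivity. -/
def cellsLift : X ⟶ cells N :=
  mkGlobMap (fun m x => (H m x).choose) fun ε m p h x => cells_ext fun C => by
    rw [face_app (evMap C), (H p _).choose_spec, (H m x).choose_spec, face_app]

theorem cellsLift_evMap (C : OWP.{u} N) : cellsLift H ≫ evMap C = φ C :=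
  globSet_hom_ext fun m x => (H m x).choose_spec C

end Lift

/-- A pasting diagram of classes of expressions is represented by a single expression of kind
`past`. Induction on free cells picks representatives for the classes that occur, and composability
is preserved by every evaluation. -/
theorem exists_past {m : Glb N} (z : ((free N).obj (cells.{u} N)).cells.obj m) :
    ∃ t : Term.{u} N .past m, Good t ∧
      ∀ C : OWP.{u} N, ev C t = ((free N).map (evMap C)).map.app m z := by
  induction z using free_ind with
  | @var m x =>
    obtain ⟨t, ht, rfl⟩ := exists_mk x
    exact ⟨.var t, ht, fun C => (app_congr (free_map (evMap C)) m (mk t ht)).symm⟩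
  | ident h z ih =>
    obtain ⟨t, ht, e⟩ := ih
    exact ⟨.ident h t, ht, fun C => (congrArg _ (e C)).trans
      (((free N).map (evMap C)).map_ident h z).symm⟩
  | comp h z z' w ih ih' =>
    obtain ⟨t, ht, e⟩ := ih
    obtain ⟨t', ht', e'⟩ := ih'
    have hw : ∀ C : OWP.{u} N, GlobOp.face ((free N).obj C.operad.C).cells .tgt h (ev C t) =
        GlobOp.face ((free N).obj C.operad.C).cells .src h (ev C t') := fun C => by
      rw [e, e']
      exact StrictCat.Hom.comp_compat _ h w
    refine ⟨.pcomp h t t', ⟨ht, ht', hw⟩, fun C => ?_⟩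
    refine Eq.trans ?_ (((free N).map (evMap C)).map_comp h z z' w
      (StrictCat.Hom.comp_compat _ h w)).symm
    simp only [ev, dif_pos (hw C)]
    have h1 := e C
    have h2 := e' C
    congr 1

theorem exists_ids (m : Glb N) (x : (one.{u} N).obj m) :
    ∃ l, ∀ C : OWP.{u} N, (evMap C).app m l = C.operad.ids.app m x :=
  ⟨mk (.ids m) trivial, fun _ => rfl⟩

/-- The map of composable pairs induced by evaluation. -/
def evPair (C : OWP.{u} N) :
    pb ((T N).map (toOne (cells.{u} N))) (evMap (OWP.top N)) ⟶ C.operad.CC :=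
  pbLift (pbFst _ _ ≫ (T N).map (evMap C)) (pbSnd _ _ ≫ evMap C) (by
    rw [Category.assoc, Category.assoc, evMap_arity, ← (T N).map_comp,
      toOne_unique (evMap C ≫ toOne _) (toOne _)]
    exact pb_condition _ _)

theorem exists_comp (m : Glb N)
    (w : (pb ((T N).map (toOne (cells.{u} N))) (evMap (OWP.top N))).obj m) :
    ∃ l, ∀ C : OWP.{u} N, (evMap C).app m l = (evPair C ≫ C.operad.comp).app m w := by
  obtain ⟨t, ht, e⟩ := exists_past w.1.1
  obtain ⟨a, ha, e'⟩ := exists_mk w.1.2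
  have e'' : ∀ C : OWP.{u} N, ev C a = (evMap C).app m w.1.2 := fun C => by rw [← e', evMap_mk]
  -- Composability in every `C` holds because `evPair` lands in the pullback `C ∘ C`; hence the new
  -- expression is good.
  have hw : ∀ C : OWP.{u} N, ((T N).map (toOne C.operad.C)).app m (ev C t) =
      C.operad.arity.app m (ev C a) := fun C => by
    have h1 := ((evPair C).app m w).2
    change ((T N).map (toOne C.operad.C)).app m (((free N).map (evMap C)).map.app m w.1.1) =
      C.operad.arity.app m ((evMap C).app m w.1.2) at h1
    rw [← e, ← e''] at h1
    exact h1
  refine ⟨mk (.comp t a) ⟨ht, ha, hw⟩, fun C => ?_⟩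
  refine Eq.trans (b := ev C (.comp t a)) rfl ?_
  simp only [ev, dif_pos (hw C)]
  exact congrArg (C.operad.comp.app m) (Subtype.ext (Prod.ext (e C) (e'' C)))

def data (N : ℕ∞) : OperadData (T.{u} N) where
  C := cells N
  arity := evMap (OWP.top N)
  ids := cellsLift exists_ids
  comp := cellsLift exists_comp
  ids_arity := cellsLift_evMap _ _
  comp_arity := cellsLift_evMap _ _

theorem evMap_isHom (C : OWP.{u} N) :
    OperadData.IsHom (O := data N) (P := C.operad.toOperadData) (evMap C) where
  arity := evMap_arity C
  ids := cellsLift_evMap _ _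
  comp := cellsLift_evMap _ _

def operad (N : ℕ∞) : Operad (T.{u} N) where
  toOperadData := data N
  unit_left := cells_hom_ext fun C => (evMap_isHom C).unitLeft_eq
  unit_right := cells_hom_ext fun C => (evMap_isHom C).unitRight_eq
  assoc := cells_hom_ext fun C => (evMap_isHom C).assoc_eq

/-- Each evaluation is an operad map, so it carries a parallel pair of classes to a parallel pair in
`C`; the formal `κ` of representatives is therefore good. -/
theorem exists_κ {p m : Glb N} (h : p < m) (e : p.dim + 1 = m.dim)
    (π : ((T.{u} N).obj (one N)).obj m) (x : (operad N).P h π) :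
    ∃ l, ∀ C : OWP.{u} N, (evMap C).app m l =
      (C.κ h e π (Operad.mapP (Operad.homOfIsHom (O := operad N) (evMap_isHom C)) x)).1 := by
  obtain ⟨a, ha, e₁⟩ := exists_mk x.src.1
  obtain ⟨b, hb, e₂⟩ := exists_mk x.tgt.1
  have ha' : ∀ C : OWP.{u} N, ev C a = (evMap C).app p x.src.1 := fun C => by rw [← e₁, evMap_mk]
  have hb' : ∀ C : OWP.{u} N, ev C b = (evMap C).app p x.tgt.1 := fun C => by rw [← e₂, evMap_mk]
  have hw : ∀ C : OWP.{u} N, IsPair C h π (ev C a) (ev C b) := fun C => by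
    let y := Operad.mapP (Operad.homOfIsHom (O := operad N) (evMap_isHom C)) x
    rw [ha', hb']
    exact ⟨y.src.2, y.tgt.2, y.parallel⟩
  refine ⟨mk (.κ h e π a b) ⟨ha, hb, hw⟩, fun C => ?_⟩
  refine Eq.trans (b := ev C (.κ h e π a b)) rfl ?_
  simp only [ev, dif_pos (hw C)]
  exact OWP.κ_congr C rfl _ _ (ha' C) (hb' C)

/-- The operad with precontraction of formal operations. -/
def owp (N : ℕ∞) : OWP.{u} N where
  operad := operad N
  -- The arity is the value in the terminal operad, where `κ` returns `π` itself.
  κ h e π x := ⟨(exists_κ h e π x).choose, ((exists_κ h e π x).choose_spec (OWP.top N)).trans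
    rfl⟩
  src_κ h e π x := cells_ext fun C => by
    refine (face_app (evMap C) _ h _).trans ?_
    rw [(exists_κ h e π x).choose_spec]
    exact C.src_κ h e π _
  tgt_κ h e π x := cells_ext fun C => by
    refine (face_app (evMap C) _ h _).trans ?_
    rw [(exists_κ h e π x).choose_spec]
    exact C.tgt_κ h e π _

def evHom (C : OWP.{u} N) : owp N ⟶ C :=
  ({map := Operad.homOfIsHom (O := operad N) (evMap_isHom C)
    map_κ := fun h e π x => Subtype.ext ((exists_κ h e π x).choose_spec C) } : OWP.Hom (owp N) C)

/-- Checked after each evaluation: being a map of operads with precontraction, it sends the value of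
`t` in the term model to the value of `t` in `C`. -/
theorem ev_owp {m : Glb N} {t : Term.{u} N .op m} (ht : Good t) : ev (owp N) t = mk t ht :=
  cells_ext fun C => mapVal_ev (evHom C) ht

theorem evMap_owp : evMap (owp.{u} N) = 𝟙 _ := by
  refine globSet_hom_ext fun m x => ?_
  obtain ⟨t, ht, rfl⟩ := exists_mk x
  exact ev_owp ht

/-- The formal operations are the initial operad with precontraction. -/
def isInitialOwp (N : ℕ∞) : Limits.IsInitial (owp.{u} N) :=
  Limits.IsInitial.ofUniqueHom evHom fun C f => OWP.hom_ext (Operad.hom_ext (by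
    -- A map `f` out of the term model sends values there to values in `C`; since evaluation in the
    -- term model is the identity, `f` is the evaluation.
    have h1 := evMap_map f
    rw [evMap_owp] at h1
    exact h1))

end Term

end

end GlobOp

/-! ### Initial objects and the main theorem -/

namespace GlobOp

theorem hasInitial_owc_top : Limits.HasInitial (OWC.{u} ⊤) :=
  Limits.IsInitial.hasInitial (X := (⟨Term.owp ⊤, contractions_top _⟩ : OWC.{u} ⊤))
    (Limits.IsInitial.ofUniqueHom (fun C => ⟨(Term.isInitialOwp ⊤).to C.obj⟩)
      fun _ _ => ObjectProperty.hom_ext _ ((Term.isInitialOwp ⊤).hom_ext _ _))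

theorem coindFunctor_contractions {n : ℕ} (h : (n : ℕ∞) ≤ ((n + 1 : ℕ) : ℕ∞)) (D : OWP.{u} n) :
    contractions.{u} (n + 1 : ℕ) ((coindFunctor h).obj D) :=
  coindObj_isContraction (Nat.cast_lt.mpr n.lt_succ_self) D

theorem hasInitial_owc (n : ℕ) : Limits.HasInitial (OWC.{u} (n + 1 : ℕ)) := by
  have := hasInitial_owc_top.{u}
  obtain ⟨h⟩ := isInitial_coind_trunc (Nat.cast_le.mpr n.le_succ) (coindFunctor_contractions _)
    _ (Limits.initialIsInitial (C := OWC.{u} ⊤))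
  exact h.hasInitial

end GlobOp

theorem mainTheorem11 :
    (∀ (n : ℕ) (h : (n : ℕ∞) ≤ ((n + 1 : ℕ) : ℕ∞)),
      ∃ (S : GlobSet.{u} n ⥤ GlobSet.{u} (n + 1 : ℕ)) (adj : truncation.{u} h ⊣ S)
        (S' : OWP.{u} n ⥤ OWP.{u} (n + 1 : ℕ)) (adj' : OWP.trunc.{u} h ⊣ S'),
        IsInduced adj adj' ∧
        ∃ hS : ∀ D : OWP.{u} n, contractions.{u} (n + 1 : ℕ) (S'.obj D),
          (∀ C : OWC.{u} (n + 1 : ℕ), IsIso (adj'.unit.app C.obj)) ∧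
          (∀ D : OWP.{u} n, IsIso (adj'.counit.app D)) ∧
          ((contractions.{u} (n + 1 : ℕ)).ι ⋙ OWP.trunc.{u} h).IsEquivalence ∧
          ((contractions.{u} (n + 1 : ℕ)).lift S' hS).IsEquivalence ∧
          ∀ L : OWC.{u} ⊤, Nonempty (Limits.IsInitial L) →
            Nonempty (Limits.IsInitial (((contractions.{u} (n + 1 : ℕ)).lift S' hS).obj
              ((OWP.trunc.{u} (le_top : (n : ℕ∞) ≤ ⊤)).obj L.obj)))) ∧
    (∀ (k : ℕ) (h : (k : ℕ∞) ≤ ⊤),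
      ∃ (S : GlobSet.{u} k ⥤ GlobSet.{u} ⊤) (adj : truncation.{u} h ⊣ S)
        (S' : OWP.{u} k ⥤ OWP.{u} ⊤) (adj' : OWP.trunc.{u} h ⊣ S'),
        IsInduced adj adj' ∧
        ∃ hS : ∀ D : OWP.{u} k, contractions.{u} ⊤ (S'.obj D),
          Nonempty ((contractions.{u} ⊤).ι ⋙ OWP.trunc.{u} h ⊣ (contractions.{u} ⊤).lift S' hS)) ∧
    Limits.HasInitial (OWC.{u} ⊤) ∧
    ∀ n : ℕ, Limits.HasInitial (OWC.{u} (n + 1 : ℕ)) := by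
  refine ⟨fun n h => ?_, fun k h => ?_, hasInitial_owc_top, hasInitial_owc⟩
  · have hS := coindFunctor_contractions.{u} h
    refine ⟨coskeleton h, coskeletonAdj h, coindFunctor h, coindAdj h, coindAdj_isInduced h, hS,
      fun C => isIso_coindAdj_unit h C.property, fun D => isIso_coindAdj_counit h D,
      (contractionEquivalence h hS).isEquivalence_functor,
      (contractionEquivalence h hS).isEquivalence_inverse,
      fun L hL => hL.elim (isInitial_coind_trunc h hS L)⟩
  · exact ⟨coskeleton h, coskeletonAdj h, coindFunctor h, coindAdj h, coindAdj_isInduced h,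
      fun _ => contractions_top _, ⟨contractionAdj h _⟩⟩
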